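/- Let $M$ be a compact smooth manifold with boundary of dimension $n\ge 2$, let $\bar g$ be a smooth Riemannian metric on $M$ and let $\rho\colon M\to[0,\infty)$ be a boundary defining function (smooth, with $\rho^{-1}(0)=\partial M$ and $d\rho\neq 0$ on $\partial M$). The pair $(M,g)$ with $g=\rho^{-1}\bar g$ is called a gas giant. Equip $M$ with the smooth structure whose charts near the boundary are $(x,y)=(\sqrt s,y)$ for charts $(s,y)$ of the original structure with $s\ge 0$ and $\{s=0\}$ the boundary (boundary normal coordinates of $g$, in which $g=dx^2+x^{-2}h(x,y,dy)$, are charts of this structure); from now on smoothness, $TM$ and $T^*M$ refer to it. A maximal geodesic is a curve $(\gamma,\zeta)\colon[0,\tau]\to T^*M$ with $0<\tau<\infty$, continuous up to the end points, with $\gamma(0),\gamma(\tau)\in\partial M$, with $\gamma(t)$ in the interior of $M$ for $0<t<\tau$, and solving there Hamilton's equations for $H(z,\zeta)=\frac12|\zeta|_g^2$ with $|\zeta|_g=1$. For a smooth $1$-form $f$ on $M$ let $$If(\gamma)=\int_0^\tau f(\dot\gamma(t))\,dt=\int_0^\tau f_\mu g^{\mu\nu}\zeta_\nu\,dt .$$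 Let $f$ be a $1$-form that is smooth up to the boundary and satisfies $If(\gamma)=0$ for every maximal geodesic $\gamma$. Then: (1) For every open neighbourhood $U$ of $\partial M$ there is a smooth function $q\colon M\to\mathbb R$ with $\operatorname{supp} q\subset U$ and $q|_{\partial M}=0$ such that $f-dq$ vanishes to infinite order at the boundary, that is, for every integer $k\ge 0$ there is a smooth $1$-form $w_k$ on $M$ with $f-dq=\rho^{k/2}\,w_k$ (here $\sqrt\rho$ is a boundary defining function of the smooth structure in use). (2) Let $(x,y)=(z^0,z^1,\dots,z^{n-1})$ be any chart of this smooth structure with $x\ge 0$ vanishing exactly on the boundary (for instance boundary normal coordinates of $g$), and let $q$ be a smooth function on its domain that vanishes on the boundary and for which $\tilde f=f-dq$ has $\tilde f_0=0$ throughout the chart. Then $\partial_x^k\tilde f_i(0,y)=0$ for all $k\ge 0$, all $i$ and all boundary points $(0,y)$ of the chart. -/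

import Mathlib

open Set Filter Topology Manifold Bundle
open scoped ContDiff

namespace GasGiant

/-- Smooth dependence of an integral over `[0, 1]` on parameters. -/
theorem contDiff_integral_param {E F : Type} [NormedAddCommGroup E] [NormedSpace ℝ E]
    [FiniteDimensional ℝ E] [NormedAddCommGroup F] [NormedSpace ℝ F]
    {K : E × ℝ → F} (hK : ContDiff ℝ ∞ K) :
    ContDiff ℝ ∞ (fun z => ∫ t in (0 : ℝ)..1, K (z, t)) := by
  rw [contDiff_infty]
  intro m
  induction m generalizing F with
  | zero =>
    rw [Nat.cast_zero, contDiff_zero]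
    exact intervalIntegral.continuous_parametric_intervalIntegral_of_continuous'
      (f := fun z t => K (z, t)) hK.continuous 0 1
  | succ m ih =>
    have hK1 : Differentiable ℝ K := hK.differentiable (by simp)
    have hL : ContDiff ℝ ∞ (fun p : E × ℝ => (fderiv ℝ K p).comp (ContinuousLinearMap.inl ℝ E ℝ)) :=
      (hK.fderiv_right (m := ∞) (by simp)).clm_comp contDiff_const
    have hd : ∀ z, HasFDerivAt (fun z => ∫ t in (0 : ℝ)..1, K (z, t))
        (∫ t in (0 : ℝ)..1, (fderiv ℝ K (z, t)).comp (ContinuousLinearMap.inl ℝ E ℝ)) z := by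
      intro z
      obtain ⟨C, hC⟩ := ((isCompact_closedBall z 1).prod (isCompact_Icc (a := (0 : ℝ)) (b := 1))).exists_bound_of_continuousOn
        hL.continuous.continuousOn
      refine (intervalIntegral.hasFDerivAt_integral_of_dominated_of_fderiv_le
        (F := fun z t => K (z, t))
        (F' := fun z t => (fderiv ℝ K (z, t)).comp (ContinuousLinearMap.inl ℝ E ℝ))
        (bound := fun _ => C) (Metric.ball_mem_nhds z one_pos) ?_ ?_ ?_ ?_ ?_ ?_)
      · exact Eventually.of_forall fun w =>
          (hK.continuous.comp (by fun_prop : Continuous fun t : ℝ => (w, t))).aestronglyMeasurable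
      · exact (hK.continuous.comp (by fun_prop : Continuous fun t : ℝ => (z, t))).intervalIntegrable _ _
      · exact (hL.continuous.comp (by fun_prop : Continuous fun t : ℝ => (z, t))).aestronglyMeasurable
      · refine Eventually.of_forall fun t ht w hw => hC (w, t) ⟨Metric.ball_subset_closedBall hw, ?_⟩
        rw [uIoc_of_le zero_le_one] at ht
        exact ⟨ht.1.le, ht.2⟩
      · exact intervalIntegrable_const
      · refine Eventually.of_forall fun t _ w _ => ?_
        exact (hK1 (w, t)).hasFDerivAt.comp w (hasFDerivAt_prodMk_left w t)
    rw [Nat.cast_succ, contDiff_succ_iff_fderiv]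
    refine ⟨fun z => (hd z).differentiableAt, by simp, ?_⟩
    rw [funext fun z => (hd z).fderiv]
    exact ih hL

variable {n : ℕ} [NeZero n]

/-- Hadamard's lemma: a smooth function vanishing where the first coordinate vanishes is locally
divisible by that coordinate. -/
theorem exists_eq_coord_mul {W : Set (EuclideanSpace ℝ (Fin n))} (hW : IsOpen W)
    {z₀ : EuclideanSpace ℝ (Fin n)} (hz₀ : z₀ ∈ W) {f : EuclideanSpace ℝ (Fin n) → ℝ}
    (hf : ContDiffOn ℝ ∞ f W) (h0 : ∀ z ∈ W, z 0 = 0 → f z = 0) :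
    ∃ c : EuclideanSpace ℝ (Fin n) → ℝ, ContDiff ℝ ∞ c ∧ ∀ᶠ z in 𝓝 z₀, f z = z 0 * c z := by
  obtain ⟨r, hr, hrW⟩ := Metric.nhds_basis_closedBall.mem_iff.1 (hW.mem_nhds hz₀)
  let χ : ContDiffBump z₀ := ⟨r / 2, r, by positivity, by linarith⟩
  set F : EuclideanSpace ℝ (Fin n) → ℝ := fun z => χ z * f z with hFdef
  have hF : ContDiff ℝ ∞ F := by
    rw [contDiff_iff_contDiffAt]
    intro z
    by_cases hz : z ∈ W
    · exact χ.contDiff.contDiffAt.mul (hf.contDiffAt (hW.mem_nhds hz))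
    · have hz' : z ∉ tsupport χ := by
        rw [χ.tsupport_eq]
        exact fun h => hz (hrW h)
      have : F =ᶠ[𝓝 z] fun _ => 0 := by
        filter_upwards [(notMem_tsupport_iff_eventuallyEq.1 hz')] with w hw
        simp [hFdef, hw]
      exact contDiffAt_const.congr_of_eventuallyEq this
  have hF0 : ∀ z, z 0 = 0 → F z = 0 := by
    intro z hz
    by_cases hzW : z ∈ W
    · simp [hFdef, h0 z hzW hz]
    · have : χ z = 0 := by
        rw [← Function.notMem_support, χ.support_eq]
        exact fun h => hzW (hrW (Metric.ball_subset_closedBall h))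
      simp [hFdef, this]
  let u : EuclideanSpace ℝ (Fin n) := EuclideanSpace.single 0 1
  let P : EuclideanSpace ℝ (Fin n) × ℝ → EuclideanSpace ℝ (Fin n) :=
    fun p => p.1 - ((1 - p.2) * p.1 0) • u
  have hcoord : ContDiff ℝ ∞ (fun p : EuclideanSpace ℝ (Fin n) × ℝ => p.1 0) :=
    ((EuclideanSpace.proj (𝕜 := ℝ) (0 : Fin n)).contDiff).comp contDiff_fst
  have hP : ContDiff ℝ ∞ P :=
    contDiff_fst.sub (((contDiff_const.sub contDiff_snd).mul hcoord).smul contDiff_const)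
  have hK : ContDiff ℝ ∞ (fun p => fderiv ℝ F (P p) u) :=
    ((hF.fderiv_right (m := ∞) (by simp)).comp hP).clm_apply contDiff_const
  refine ⟨_, contDiff_integral_param hK, ?_⟩
  have hev : ∀ᶠ z in 𝓝 z₀, χ z = 1 := χ.eventuallyEq_one
  filter_upwards [hev] with z hz
  have hderiv : ∀ t ∈ uIcc (0 : ℝ) 1, HasDerivAt (fun t => F (P (z, t)))
      (z 0 * fderiv ℝ F (P (z, t)) u) t := by
    intro t _
    have h1 : HasDerivAt (fun t => P (z, t)) (z 0 • u) t := by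
      have := (((hasDerivAt_id t).const_sub 1).mul_const (z 0)).smul_const u |>.const_sub z
      simpa [P] using this
    have := ((hF.differentiable (by simp)) (P (z, t))).hasFDerivAt.comp_hasDerivAt t h1
    rw [map_smul, smul_eq_mul] at this
    exact this
  have hint := intervalIntegral.integral_eq_sub_of_hasDerivAt hderiv
    ((continuous_const.mul (hK.continuous.comp
      (by fun_prop : Continuous fun t : ℝ => (z, t)))).intervalIntegrable _ _)
  rw [intervalIntegral.integral_const_mul] at hint
  rw [hint]
  have e1 : F (P (z, 1)) = f z := by simp [P, hFdef, hz]
  have e0 : F (P (z, 0)) = 0 := hF0 _ (by simp [P, u])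
  rw [e1, e0, sub_zero]


/-- The map `(x, y) ↦ (x ^ 2, y)`. -/
def squareMap (z : EuclideanSpace ℝ (Fin n)) : EuclideanSpace ℝ (Fin n) :=
  WithLp.toLp 2 (Function.update z 0 (z 0 ^ 2))

/-- The map `(s, y) ↦ (√s, y)`. -/
noncomputable def rootMap (z : EuclideanSpace ℝ (Fin n)) : EuclideanSpace ℝ (Fin n) :=
  WithLp.toLp 2 (Function.update z 0 (√(z 0)))

@[simp] theorem squareMap_zero (z : EuclideanSpace ℝ (Fin n)) : squareMap z 0 = z 0 ^ 2 := by
  simp [squareMap]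

@[simp] theorem rootMap_zero (z : EuclideanSpace ℝ (Fin n)) : rootMap z 0 = √(z 0) := by
  simp [rootMap]

theorem squareMap_of_ne (z : EuclideanSpace ℝ (Fin n)) {i : Fin n} (hi : i ≠ 0) :
    squareMap z i = z i := by
  simp [squareMap, hi]

theorem rootMap_of_ne (z : EuclideanSpace ℝ (Fin n)) {i : Fin n} (hi : i ≠ 0) :
    rootMap z i = z i := by
  simp [rootMap, hi]

theorem contDiff_squareMap : ContDiff ℝ ∞ (squareMap (n := n)) := by
  rw [contDiff_euclidean]
  intro i
  by_cases hi : i = 0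
  · subst hi
    simp only [squareMap_zero]
    fun_prop
  · simp only [squareMap_of_ne _ hi]
    fun_prop

theorem continuous_rootMap : Continuous (rootMap (n := n)) := by
  refine (PiLp.continuous_toLp 2 _).comp ?_
  exact (PiLp.continuous_ofLp 2 _).update 0 (PiLp.continuous_apply 2 _ 0).sqrt

theorem rootMap_squareMap {z : EuclideanSpace ℝ (Fin n)} (hz : 0 ≤ z 0) :
    rootMap (squareMap z) = z := by
  ext i
  by_cases hi : i = 0
  · subst hi; simp [Real.sqrt_sq hz]
  · rw [rootMap_of_ne _ hi, squareMap_of_ne _ hi]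

theorem squareMap_rootMap {z : EuclideanSpace ℝ (Fin n)} (hz : 0 ≤ z 0) :
    squareMap (rootMap z) = z := by
  ext i
  by_cases hi : i = 0
  · subst hi; simp [Real.sq_sqrt hz]
  · rw [squareMap_of_ne _ hi, rootMap_of_ne _ hi]

theorem exists_eq_coord_sq_mul {D O : Set (EuclideanSpace ℝ (Fin n))} (hO : IsOpen O)
    (hD : D = O ∩ {z | 0 ≤ z 0}) {z₀ : EuclideanSpace ℝ (Fin n)} (hz₀ : squareMap z₀ ∈ D)
    {f : EuclideanSpace ℝ (Fin n) → ℝ} (hf : ContDiffOn ℝ ∞ f D) (hpos : ∀ z ∈ D, 0 ≤ f z)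
    (h0 : ∀ z ∈ D, z 0 = 0 → f z = 0) :
    ∃ b : EuclideanSpace ℝ (Fin n) → ℝ, ContDiff ℝ ∞ b ∧
      ∀ᶠ z in 𝓝 z₀, f (squareMap z) = z 0 ^ 2 * b z := by
  set W := squareMap ⁻¹' O with hWdef
  have hW : IsOpen W := hO.preimage contDiff_squareMap.continuous
  have hWD : ∀ z ∈ W, squareMap z ∈ D := fun z hz => by
    rw [hD]; exact ⟨hz, by simp [sq_nonneg]⟩
  have hzW : z₀ ∈ W := by rw [hD] at hz₀; exact hz₀.1
  have hψ : ContDiffOn ℝ ∞ (fun z => f (squareMap z)) W :=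
    hf.comp contDiff_squareMap.contDiffOn hWD
  obtain ⟨c, hc, hfc⟩ := exists_eq_coord_mul hW hzW hψ
    (fun z hz hz0 => h0 _ (hWD z hz) (by simp [hz0]))
  obtain ⟨V, hVsub, hVo, hzV⟩ := eventually_nhds_iff.1 (hfc.and (hW.mem_nhds hzW))
  let u : EuclideanSpace ℝ (Fin n) := EuclideanSpace.single 0 1
  have hc0 : ∀ z ∈ V, z 0 = 0 → c z = 0 := by
    intro z hz hz0
    have hline : Tendsto (fun t : ℝ => z + t • u) (𝓝 0) (𝓝 z) := by
      have : Continuous (fun t : ℝ => z + t • u) := by fun_prop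
      simpa using this.tendsto 0
    have hcl : Tendsto (fun t : ℝ => c (z + t • u)) (𝓝 0) (𝓝 (c z)) :=
      (hc.continuous.tendsto z).comp hline
    have hVl : ∀ᶠ t : ℝ in 𝓝 0, z + t • u ∈ V := hline.eventually (hVo.mem_nhds hz)
    have hval : ∀ t : ℝ, z + t • u ∈ V → 0 ≤ t * c (z + t • u) := by
      intro t ht
      have h1 := (hVsub _ ht).1
      have h2 := hpos _ (hWD _ (hVsub _ ht).2)
      rw [h1] at h2
      simpa [u, hz0] using h2
    apply le_antisymm
    · refine le_of_tendsto (hcl.mono_left (nhdsWithin_le_nhds (s := Iio 0))) ?_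
      filter_upwards [hVl.filter_mono nhdsWithin_le_nhds, self_mem_nhdsWithin] with t ht htn
      have := hval t ht
      by_contra hcon
      exact absurd this (not_le.2 (mul_neg_of_neg_of_pos htn (not_le.1 hcon)))
    · refine ge_of_tendsto (hcl.mono_left (nhdsWithin_le_nhds (s := Ioi 0))) ?_
      filter_upwards [hVl.filter_mono nhdsWithin_le_nhds, self_mem_nhdsWithin] with t ht htn
      exact nonneg_of_mul_nonneg_right (hval t ht) htn
  obtain ⟨b, hb, hcb⟩ := exists_eq_coord_mul hVo hzV hc.contDiffOn hc0
  refine ⟨b, hb, ?_⟩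
  filter_upwards [hfc, hcb] with z h1 h2
  rw [h1, h2]; ring

/-- A diffeomorphism between relatively open subsets of the half space that preserves the boundary
stays smooth after conjugation with `(x, y) ↦ (x ^ 2, y)`. -/
theorem contDiffOn_root_conj {D O D' O' : Set (EuclideanSpace ℝ (Fin n))}
    (hO : IsOpen O) (hD : D = O ∩ {z | 0 ≤ z 0}) (hO' : IsOpen O') (hD' : D' = O' ∩ {z | 0 ≤ z 0})
    {φ φ' : EuclideanSpace ℝ (Fin n) → EuclideanSpace ℝ (Fin n)}
    (hφ : ContDiffOn ℝ ∞ φ D) (hφ' : ContDiffOn ℝ ∞ φ' D') (hm : MapsTo φ D D')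
    (hm' : MapsTo φ' D' D) (hinv : ∀ z ∈ D, φ' (φ z) = z)
    (hbd : ∀ z ∈ D, φ z 0 = 0 ↔ z 0 = 0) (hbd' : ∀ z ∈ D', φ' z 0 = 0 ↔ z 0 = 0) :
    ContDiffOn ℝ ∞ (fun z => rootMap (φ (squareMap z))) (squareMap ⁻¹' D ∩ {z | 0 ≤ z 0}) := by
  have hDpos : ∀ z ∈ D, 0 ≤ z 0 := fun z hz => by rw [hD] at hz; exact hz.2
  have hDpos' : ∀ z ∈ D', 0 ≤ z 0 := fun z hz => by rw [hD'] at hz; exact hz.2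
  have hcomp : ContDiffOn ℝ ∞ (fun z => φ (squareMap z)) (squareMap ⁻¹' D ∩ {z | 0 ≤ z 0}) :=
    hφ.comp contDiff_squareMap.contDiffOn (fun z hz => hz.1)
  have hcompi := contDiffOn_euclidean.1 hcomp
  rw [contDiffOn_euclidean]
  intro i
  by_cases hi : i ≠ 0
  · simp only [rootMap_of_ne _ hi]
    exact hcompi i
  push Not at hi
  subst hi
  simp only [rootMap_zero]
  intro z₀ hz₀
  have hφ0 := contDiffOn_euclidean.1 hφ 0
  by_cases hz : z₀ 0 = 0
  swap
  · have : φ (squareMap z₀) 0 ≠ 0 := fun h => hz (by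
      have := (hbd _ hz₀.1).1 h
      simpa using this)
    exact (hcompi 0 z₀ hz₀).sqrt this
  obtain ⟨b, hb, hfb⟩ := exists_eq_coord_sq_mul hO hD hz₀.1 hφ0
    (fun z hz => hDpos' _ (hm hz)) (fun z hz h => (hbd z hz).2 h)
  set g : EuclideanSpace ℝ (Fin n) → EuclideanSpace ℝ (Fin n) :=
    fun z => rootMap (φ (squareMap z)) with hg
  have hgz : ∀ z ∈ squareMap ⁻¹' D ∩ {z : EuclideanSpace ℝ (Fin n) | 0 ≤ z 0},
      squareMap (g z) = φ (squareMap z) := fun z hz =>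
    squareMap_rootMap (hDpos' _ (hm hz.1))
  obtain ⟨b', hb', hfb'⟩ := exists_eq_coord_sq_mul hO' hD' (z₀ := g z₀)
    (by rw [hgz _ hz₀]; exact hm hz₀.1) (contDiffOn_euclidean.1 hφ' 0)
    (fun z hz => hDpos _ (hm' hz)) (fun z hz h => (hbd' z hz).2 h)
  have hgc : ContinuousOn g (squareMap ⁻¹' D ∩ {z : EuclideanSpace ℝ (Fin n) | 0 ≤ z 0}) :=
    continuous_rootMap.comp_continuousOn hcomp.continuousOn
  let u : EuclideanSpace ℝ (Fin n) := EuclideanSpace.single 0 1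
  have hl : Tendsto (fun t : ℝ => z₀ + t • u) (𝓝 0) (𝓝 z₀) := by
    have : Continuous (fun t : ℝ => z₀ + t • u) := by fun_prop
    simpa using this.tendsto 0
  have hl' : ∀ᶠ t : ℝ in 𝓝[>] 0,
      z₀ + t • u ∈ squareMap ⁻¹' D ∩ {z : EuclideanSpace ℝ (Fin n) | 0 ≤ z 0} := by
    have hzO : z₀ ∈ squareMap ⁻¹' O := by
      have := hz₀.1
      rw [hD] at this; exact this.1
    have h1 := (hl.eventually ((hO.preimage contDiff_squareMap.continuous).mem_nhds hzO)).filter_mono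
      (nhdsWithin_le_nhds (s := Ioi 0))
    filter_upwards [h1, self_mem_nhdsWithin] with t ht htp
    refine ⟨?_, ?_⟩
    · rw [hD]; exact ⟨ht, by simp [sq_nonneg]⟩
    · have : (0 : ℝ) < t := htp
      simp [u, hz, this.le]
  have hlw := tendsto_nhdsWithin_iff.2 ⟨hl.mono_left (nhdsWithin_le_nhds (s := Ioi 0)), hl'⟩
  have hgl : Tendsto (fun t : ℝ => g (z₀ + t • u)) (𝓝[>] 0) (𝓝 (g z₀)) := (hgc z₀ hz₀).tendsto.comp hlw
  have hprod : ∀ᶠ t : ℝ in 𝓝[>] 0, b (z₀ + t • u) * b' (g (z₀ + t • u)) = 1 := by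
    filter_upwards [hl', (hl.eventually hfb).filter_mono nhdsWithin_le_nhds, hgl.eventually hfb',
      self_mem_nhdsWithin] with t h1 h2 h3 h4
    have h4 : (0 : ℝ) < t := h4
    have hz1 : (z₀ + t • u) 0 = t := by simp [u, hz]
    rw [hgz _ h1, hinv _ h1.1, squareMap_zero, hz1] at h3
    have h5 : g (z₀ + t • u) 0 ^ 2 = φ (squareMap (z₀ + t • u)) 0 := by
      rw [← hgz _ h1, squareMap_zero]
    rw [h5, h2, hz1] at h3
    have : t ^ 2 ≠ 0 := by positivity
    apply mul_left_cancel₀ this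
    linarith
  have hlim : b z₀ * b' (g z₀) = 1 := by
    have h1 : Tendsto (fun t : ℝ => b (z₀ + t • u) * b' (g (z₀ + t • u))) (𝓝[>] 0)
        (𝓝 (b z₀ * b' (g z₀))) :=
      ((hb.continuous.tendsto z₀).comp (hl.mono_left nhdsWithin_le_nhds)).mul
        ((hb'.continuous.tendsto _).comp hgl)
    exact tendsto_nhds_unique (h1.congr' hprod) tendsto_const_nhds
  have hbne : b z₀ ≠ 0 := left_ne_zero_of_mul_eq_one hlim
  have hsm : ContDiffWithinAt ℝ ∞ (fun z : EuclideanSpace ℝ (Fin n) => z 0 * √(b z))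
      (squareMap ⁻¹' D ∩ {z : EuclideanSpace ℝ (Fin n) | 0 ≤ z 0}) z₀ := by
    refine ContDiffAt.contDiffWithinAt (ContDiffAt.mul (by fun_prop) (hb.contDiffAt.sqrt hbne))
  refine hsm.congr_of_eventuallyEq ?_ ?_
  · filter_upwards [hfb.filter_mono nhdsWithin_le_nhds, self_mem_nhdsWithin] with z h1 h2
    have h3 : (0 : ℝ) ≤ z 0 := h2.2
    rw [h1, Real.sqrt_mul (sq_nonneg _), Real.sqrt_sq h3]
  · rw [hfb.self_of_nhds, Real.sqrt_mul (sq_nonneg _), Real.sqrt_sq (by simp [hz])]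


/-- The homeomorphism `(x, y) ↦ (x ^ 2, y)` of the half space. -/
noncomputable def squareHomeomorph (n : ℕ) [NeZero n] :
    EuclideanHalfSpace n ≃ₜ EuclideanHalfSpace n where
  toFun z := ⟨squareMap z.1, by rw [squareMap_zero]; exact sq_nonneg _⟩
  invFun z := ⟨rootMap z.1, by rw [rootMap_zero]; exact Real.sqrt_nonneg _⟩
  left_inv z := Subtype.ext (rootMap_squareMap z.2)
  right_inv z := Subtype.ext (squareMap_rootMap z.2)
  continuous_toFun := (contDiff_squareMap.continuous.comp continuous_subtype_val).subtype_mk _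
  continuous_invFun := (continuous_rootMap.comp continuous_subtype_val).subtype_mk _

/-- The manifold `M` with its second smooth structure: the same topological space, with the chart
`(√s, y)` for every chart `(s, y)` of `M`, where `s ≥ 0` is the coordinate that vanishes on the
boundary. -/
def RootManifold (M : Type*) : Type _ := M

namespace RootManifold

variable {M : Type*} [TopologicalSpace M]

instance : TopologicalSpace (RootManifold M) := inferInstanceAs (TopologicalSpace M)

/-- The identity map, from the second smooth structure to the original one; it reads
`(x, y) ↦ (x ^ 2, y)` in corresponding charts. -/
def toBase : RootManifold M ≃ₜ M := Homeomorph.refl M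

variable [ChartedSpace (EuclideanHalfSpace n) M]

noncomputable instance : ChartedSpace (EuclideanHalfSpace n) (RootManifold M) where
  atlas := (fun e : OpenPartialHomeomorph M (EuclideanHalfSpace n) =>
    (toBase.toOpenPartialHomeomorph.trans e).trans
      (squareHomeomorph n).symm.toOpenPartialHomeomorph) '' atlas (EuclideanHalfSpace n) M
  chartAt p := (toBase.toOpenPartialHomeomorph.trans (chartAt (EuclideanHalfSpace n) (toBase p))).trans
      (squareHomeomorph n).symm.toOpenPartialHomeomorph
  mem_chart_source p := by simp
  chart_mem_atlas p := mem_image_of_mem _ (chart_mem_atlas _ _)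

/-- Charts of `M` agree on which points are boundary points. -/
theorem transition_boundary [IsManifold (𝓡∂ n) ∞ M]
    {e e' : OpenPartialHomeomorph M (EuclideanHalfSpace n)}
    (he : e ∈ atlas (EuclideanHalfSpace n) M) (he' : e' ∈ atlas (EuclideanHalfSpace n) M)
    {p : M} (hp : p ∈ e.source) (hp' : p ∈ e'.source) :
    (e' p).1 0 = 0 ↔ (e p).1 0 = 0 := by
  have key : ∀ {a : OpenPartialHomeomorph M (EuclideanHalfSpace n)}, p ∈ a.source →
      (a.extend (𝓡∂ n) p ∈ interior (a.extend (𝓡∂ n)).target ↔ (a p).1 0 ≠ 0) := by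
    intro a ha
    refine ⟨fun h => ?_, fun h => a.mem_interior_extend_target (a.map_source ha) ?_⟩
    · have h1 := a.interior_extend_target_subset_interior_range h
      rw [interior_range_modelWithCornersEuclideanHalfSpace] at h1
      exact ne_of_gt h1
    · rw [interior_range_modelWithCornersEuclideanHalfSpace]
      exact lt_of_le_of_ne (a p).2 (Ne.symm h)
  have := ModelWithCorners.mem_interior_range_iff_of_mem_atlas (I := 𝓡∂ n) (n := ∞) (by simp)
    he he' hp hp'
  rw [key hp, key hp'] at this
  tauto

/-- The charts `(√s, y)` are smoothly compatible up to the boundary. -/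
instance [IsManifold (𝓡∂ n) ∞ M] : IsManifold (𝓡∂ n) ∞ (RootManifold M) := by
  apply isManifold_of_contDiffOn
  rintro _ _ ⟨e, he, rfl⟩ ⟨e', he', rfl⟩
  set I := 𝓡∂ n with hI
  have hrange : range I = {z : EuclideanSpace ℝ (Fin n) | 0 ≤ z 0} :=
    range_modelWithCornersEuclideanHalfSpace n
  have hIs : ∀ z ∈ range I, (I.symm z).1 = z := fun z hz => I.right_inv hz
  have hopen : ∀ a a' : OpenPartialHomeomorph M (EuclideanHalfSpace n),
      IsOpen (I.symm ⁻¹' (a.symm.trans a').source) := fun a a' =>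
    (a.symm.trans a').open_source.preimage I.continuous_symm
  have hsmooth : ∀ a ∈ atlas (EuclideanHalfSpace n) M, ∀ a' ∈ atlas (EuclideanHalfSpace n) M,
      ContDiffOn ℝ ∞ (fun z => I ((a.symm.trans a') (I.symm z)))
        (I.symm ⁻¹' (a.symm.trans a').source ∩ {z | 0 ≤ z 0}) := by
    intro a ha a' ha'
    have := (contDiffGroupoid ∞ I).compatible ha ha'
    rw [contDiffGroupoid, mem_groupoid_of_pregroupoid] at this
    rw [← hrange]
    exact this.1
  have hmaps : ∀ a a' : OpenPartialHomeomorph M (EuclideanHalfSpace n),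
      MapsTo (fun z => I ((a.symm.trans a') (I.symm z)))
        (I.symm ⁻¹' (a.symm.trans a').source ∩ {z | 0 ≤ z 0})
        (I.symm ⁻¹' (a'.symm.trans a).source ∩ {z | 0 ≤ z 0}) := by
    intro a a' z hz
    refine ⟨?_, by rw [← hrange]; exact mem_range_self _⟩
    have h1 : I.symm z ∈ (a.symm.trans a').source := hz.1
    simp only [mem_preimage, I.left_inv]
    have h2 := (a.symm.trans a').map_source h1
    rwa [← OpenPartialHomeomorph.symm_source, OpenPartialHomeomorph.trans_symm_eq_symm_trans_symm,
      OpenPartialHomeomorph.symm_symm] at h2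
  have hbdy : ∀ a ∈ atlas (EuclideanHalfSpace n) M, ∀ a' ∈ atlas (EuclideanHalfSpace n) M,
      ∀ z ∈ (I.symm ⁻¹' (a.symm.trans a').source ∩ {z : EuclideanSpace ℝ (Fin n) | 0 ≤ z 0}),
      (I ((a.symm.trans a') (I.symm z))) 0 = 0 ↔ z 0 = 0 := by
    intro a ha a' ha' z hz
    have h1 : I.symm z ∈ a.target ∧ a.symm (I.symm z) ∈ a'.source := by simpa using hz.1
    have h2 := transition_boundary ha ha' (p := a.symm (I.symm z)) (a.map_target h1.1) h1.2
    rw [a.right_inv h1.1, hIs z (by rw [hrange]; exact hz.2)] at h2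
    exact h2
  have main := contDiffOn_root_conj (hopen e e') rfl (hopen e' e) rfl (hsmooth e he e' he')
    (hsmooth e' he' e he) (hmaps e e') (hmaps e' e)
    (by
      intro z hz
      have h1 : I.symm z ∈ e.target ∧ e.symm (I.symm z) ∈ e'.source := by simpa using hz.1
      have h2 : e (e'.symm (e' (e.symm (I.symm z)))) = I.symm z := by
        rw [e'.left_inv h1.2, e.right_inv h1.1]
      simp only [OpenPartialHomeomorph.coe_trans, Function.comp_apply, I.left_inv, h2]
      exact hIs z (by rw [hrange]; exact hz.2))
    (hbdy e he e' he') (hbdy e' he' e he)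
  have hsq : ∀ z ∈ range I, squareHomeomorph n (I.symm z) = I.symm (squareMap z) := by
    intro z hz
    apply Subtype.ext
    rw [hIs (squareMap z) (by rw [hrange]; simp [sq_nonneg])]
    change squareMap (I.symm z).1 = _
    rw [hIs z hz]
  refine ContDiffOn.congr (main.mono ?_) ?_
  · rintro z ⟨hz, hzr⟩
    refine ⟨⟨?_, by simp [sq_nonneg]⟩, by rw [← hrange]; exact hzr⟩
    rw [mem_preimage, ← hsq z hzr]
    simpa using hz
  · rintro z ⟨hz, hzr⟩
    simp only [Function.comp_apply]
    rw [← hsq z hzr]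
    rfl

end RootManifold


/-- A (not necessarily continuous) field of covectors. -/
abbrev OneForm (n : ℕ) [NeZero n] (N : Type*) [TopologicalSpace N] [ChartedSpace (EuclideanHalfSpace n) N] :=
  ∀ p : N, TangentSpace (𝓡∂ n) p →L[ℝ] ℝ

variable {N : Type*} [TopologicalSpace N] [ChartedSpace (EuclideanHalfSpace n) N]

/-- Smoothness of a 1-form, up to the boundary, as a section of the cotangent bundle. -/
def OneForm.IsSmooth [IsManifold (𝓡∂ n) ∞ N] (f : OneForm n N) : Prop :=
  ContMDiff (𝓡∂ n) ((𝓡∂ n).prod 𝓘(ℝ, EuclideanSpace ℝ (Fin n) →L[ℝ] ℝ)) ∞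
    (fun p => TotalSpace.mk' (EuclideanSpace ℝ (Fin n) →L[ℝ] ℝ)
      (E := fun p : N => TangentSpace (𝓡∂ n) p →L[ℝ] ℝ) p (f p))

variable (n) in
/-- The 1-form `dq`. -/
noncomputable def differential (q : N → ℝ) : OneForm n N := fun p => mfderiv (𝓡∂ n) 𝓘(ℝ, ℝ) q p

/-- The derivative of the coordinate map of the chart `e`, i.e. `(dz⁰, …, dzⁿ⁻¹)` at `p`. -/
noncomputable def coordCovector (e : OpenPartialHomeomorph N (EuclideanHalfSpace n)) (p : N) :
    TangentSpace (𝓡∂ n) p →L[ℝ] EuclideanSpace ℝ (Fin n) :=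
  mfderiv (𝓡∂ n) 𝓘(ℝ, EuclideanSpace ℝ (Fin n)) (e.extend (𝓡∂ n)) p

/-- The inverse of `coordCovector e p`: the standard basis goes to the coordinate vector fields
`∂_μ` of the chart `e` at `p`. -/
noncomputable def coordVector (e : OpenPartialHomeomorph N (EuclideanHalfSpace n)) (p : N) :
    EuclideanSpace ℝ (Fin n) →L[ℝ] TangentSpace (𝓡∂ n) p :=
  (coordCovector e p).inverse

/-- The component `f_μ` of the 1-form `f` in the chart `e`, as a function of the coordinates. -/
noncomputable def OneForm.coeff (f : OneForm n N) (e : OpenPartialHomeomorph N (EuclideanHalfSpace n))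
    (μ : Fin n) (z : EuclideanSpace ℝ (Fin n)) : ℝ :=
  f ((e.extend (𝓡∂ n)).symm z) (coordVector e _ (EuclideanSpace.single μ 1))

end GasGiant

/-- A gas giant on the manifold with boundary `M`: a smooth Riemannian metric `gbar` and a boundary
defining function `ρ`. The gas giant metric is `g = ρ⁻¹ gbar`. -/
structure GasGiant (n : ℕ) [NeZero n] (M : Type*) [TopologicalSpace M]
    [ChartedSpace (EuclideanHalfSpace n) M] [IsManifold (𝓡∂ n) ∞ M] where
  gbar : ContMDiffRiemannianMetric (𝓡∂ n) ∞ (EuclideanSpace ℝ (Fin n))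
    (fun p : M => TangentSpace (𝓡∂ n) p)
  ρ : M → ℝ
  contMDiff_ρ : ContMDiff (𝓡∂ n) 𝓘(ℝ, ℝ) ∞ ρ
  ρ_nonneg : ∀ p, 0 ≤ ρ p
  ρ_eq_zero_iff : ∀ p, ρ p = 0 ↔ p ∈ (𝓡∂ n).boundary M
  mfderiv_ρ_ne_zero : ∀ p ∈ (𝓡∂ n).boundary M, mfderiv (𝓡∂ n) 𝓘(ℝ, ℝ) ρ p ≠ 0

namespace GasGiant

variable {n : ℕ} [NeZero n] {M : Type*} [TopologicalSpace M]
    [ChartedSpace (EuclideanHalfSpace n) M] [IsManifold (𝓡∂ n) ∞ M] (G : GasGiant n M)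

/-- The boundary defining function `x = √ρ` of the second smooth structure. -/
noncomputable def x (p : RootManifold M) : ℝ := √(G.ρ p.toBase)

/-- The metric `g = ρ⁻¹ gbar` on the tangent spaces of the second smooth structure; meaningful at
interior points. -/
noncomputable def metric (p : RootManifold M) :
    TangentSpace (𝓡∂ n) p →L[ℝ] TangentSpace (𝓡∂ n) p →L[ℝ] ℝ :=
  (G.ρ p.toBase)⁻¹ •
    (ContinuousLinearMap.precomp ℝ (mfderiv (𝓡∂ n) (𝓡∂ n) RootManifold.toBase p)).comp
      ((G.gbar.inner p.toBase).comp (mfderiv (𝓡∂ n) (𝓡∂ n) RootManifold.toBase p))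

theorem metric_apply (p : RootManifold M) (v w : TangentSpace (𝓡∂ n) p) :
    G.metric p v w = (G.ρ p.toBase)⁻¹ * G.gbar.inner p.toBase
      (mfderiv (𝓡∂ n) (𝓡∂ n) RootManifold.toBase p v)
      (mfderiv (𝓡∂ n) (𝓡∂ n) RootManifold.toBase p w) := rfl

/-- The vector `ζ♯` with `g(ζ♯, ·) = ζ`; meaningful at interior points, where `g` is invertible. -/
noncomputable def sharp (p : RootManifold M) (ζ : TangentSpace (𝓡∂ n) p →L[ℝ] ℝ) :
    TangentSpace (𝓡∂ n) p :=
  (G.metric p).inverse ζ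

/-- The Hamiltonian `H(p, ζ) = |ζ|_g ^ 2 / 2`. -/
noncomputable def hamiltonian (p : RootManifold M) (ζ : TangentSpace (𝓡∂ n) p →L[ℝ] ℝ) : ℝ :=
  1 / 2 * ζ (G.sharp p ζ)

/-- The Hamiltonian in the canonical coordinates `(z, P)` of the cotangent bundle induced by the
chart `e`. -/
noncomputable def chartHamiltonian
    (e : OpenPartialHomeomorph (RootManifold M) (EuclideanHalfSpace n))
    (w : EuclideanSpace ℝ (Fin n) × (EuclideanSpace ℝ (Fin n) →L[ℝ] ℝ)) : ℝ :=
  G.hamiltonian ((e.extend (𝓡∂ n)).symm w.1) (w.2.comp (coordCovector e _))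

/-- Hamilton's equations at time `t` for the curve `(γ, ζ)` in the cotangent bundle, in canonical
coordinates `(z, P)` of some chart around `γ t` (by invariance, of every such chart): with `v` and
`w` the derivatives of `z` and `P`, `dH(u, Q) = Q(v) - w(u)`, that is `v = ∂H/∂P`, `w = -∂H/∂z`. -/
def IsHamiltonianAt (γ : ℝ → RootManifold M)
    (ζ : ∀ t, TangentSpace (𝓡∂ n) (γ t) →L[ℝ] ℝ) (t : ℝ) : Prop :=
  ∃ e ∈ IsManifold.maximalAtlas (𝓡∂ n) ∞ (RootManifold M), γ t ∈ e.source ∧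
    ∃ (v : EuclideanSpace ℝ (Fin n)) (w : EuclideanSpace ℝ (Fin n) →L[ℝ] ℝ),
      HasDerivAt (fun s => e.extend (𝓡∂ n) (γ s)) v t ∧
      HasDerivAt (fun s => (ζ s).comp (coordVector e (γ s))) w t ∧
      HasFDerivAt (G.chartHamiltonian e) ((-w).coprod (ContinuousLinearMap.apply ℝ ℝ v))
        (e.extend (𝓡∂ n) (γ t), (ζ t).comp (coordVector e (γ t)))

/-- A maximal unit speed geodesic of finite exit time `τ`, as a curve `(γ, ζ)` in the cotangent
bundle of the second smooth structure: it is continuous up to the end points, starts and ends over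
the boundary, runs over the interior in between and solves Hamilton's equations there.
Only `t ∈ [0, τ]` matters. -/
structure MaximalGeodesic where
  τ : ℝ
  τ_pos : 0 < τ
  γ : ℝ → RootManifold M
  ζ : ∀ t, TangentSpace (𝓡∂ n) (γ t) →L[ℝ] ℝ
  continuousOn : ContinuousOn (fun t => TotalSpace.mk' (EuclideanSpace ℝ (Fin n) →L[ℝ] ℝ)
    (E := fun p : RootManifold M => TangentSpace (𝓡∂ n) p →L[ℝ] ℝ) (γ t) (ζ t)) (Icc 0 τ)
  start_mem : γ 0 ∈ (𝓡∂ n).boundary (RootManifold M)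
  end_mem : γ τ ∈ (𝓡∂ n).boundary (RootManifold M)
  interior_mem : ∀ t ∈ Ioo 0 τ, γ t ∈ (𝓡∂ n).interior (RootManifold M)
  unit_speed : ∀ t ∈ Ioo 0 τ, ζ t (G.sharp (γ t) (ζ t)) = 1
  hamilton : ∀ t ∈ Ioo 0 τ, G.IsHamiltonianAt γ ζ t

/-- The X-ray transform of a 1-form: the integral over `[0, τ]` of `f(γ̇) = f_μ g^{μν} ζ_ν`. -/
noncomputable def xray (f : OneForm n (RootManifold M)) (c : G.MaximalGeodesic) : ℝ :=
  ∫ t in (0 : ℝ)..c.τ, f (c.γ t) (G.sharp (c.γ t) (c.ζ t))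

end GasGiant

/-! Near a boundary point, integrate the normal component of `f` in the direction of `x`. This gives
a function `q` that vanishes on the boundary and for which `F = f - dq` has no normal component
(`exists_normal_primitive`). Since `q` vanishes at both ends of a maximal geodesic, the integrals of
`F` along short geodesics still vanish. The claim is that `F` is divisible by every power of `x`.
Inductively `F = x ^ m w` with `w` smooth up to the boundary, and by Hadamard's lemma it suffices
that the tangential part `θ` of `w` vanishes at each boundary point `z₁`.

Short geodesics detect `θ`. In the coordinates `(x, y)` one has `ρ = x² a`, and the squared length
of a covector `(ξ, η)` is the value of `k = a ḡ⁻¹`, taken at `(x², y)`, on `(ξ / 2, x η)`. Hence the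
Hamiltonian extends smoothly across `x = 0`. Put `x = ε X`, `t = ε T` and start at `z₁` with `η = θ
/ ε`. The equations of motion remain smooth at `ε = 0`, where the point `y` and the momentum `θ`
freeze and `(X, ξ)` is a harmonic oscillator of frequency `κ`. So for small `ε` the geodesic returns
to the boundary. After division by a power of `ε`, the integral of `F` tends, along a sequence `ε →
0`, to a positive multiple of the integral of `sin ^ (m + 1) (κT) (b cos (κT) + κ sin (κT))` over
`[0, π / κ]`. The first summand integrates to zero and the second to something positive, which
contradicts the vanishing of the integrals. The assumption `θ ≠ 0` enters as `κ > 0`, by strict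
Cauchy–Schwarz. This is `tangential_eq_zero_of_integral_eq_zero`, and the induction is
`exists_eq_coord_pow_smul_normal_form`.

Two functions that vanish on the boundary and both make `f - dq` flat differ by a flat function,
because such a function is recovered from its normal derivative (`flatFn_of_normal_derivative`).
Therefore a partition of unity glues the local functions without losing flatness, and using `q = 0`
away from the boundary keeps the support in `U` (`exists_global_gauge`). The same comparison shows
that the normal gauge of an arbitrary chart produces a flat form (`flatForm_of_normal`), and the
coefficients of a flat form have vanishing normal derivatives. -/

namespace GasGiant

/-! ### Integrals depending on a parameter, up to the boundary of a convex set. -/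

theorem continuousOn_integral_param {E F : Type} [NormedAddCommGroup E]
    [NormedAddCommGroup F] [NormedSpace ℝ F] {D : Set E}
    {K : E × ℝ → F} (hK : ContinuousOn K (D ×ˢ Icc 0 1)) :
    ContinuousOn (fun z => ∫ t in (0 : ℝ)..1, K (z, t)) D := by
  rw [continuousOn_iff_continuous_domRestrict]
  -- Projecting `t` to `[0, 1]` extends the integrand continuously to all `t` without changing the
  -- integral.
  have h1 : Continuous (fun p : D × ℝ => K (p.1, (projIcc (0 : ℝ) 1 zero_le_one p.2 : ℝ))) :=
    hK.comp_continuous (by fun_prop) (fun p => ⟨p.1.2, (projIcc (0 : ℝ) 1 zero_le_one p.2).2⟩)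
  refine (intervalIntegral.continuous_parametric_intervalIntegral_of_continuous'
      (μ := MeasureTheory.volume) (f := fun (z : D) t => K (z, (projIcc (0 : ℝ) 1 zero_le_one t : ℝ))) h1 0 1).congr ?_
  intro z
  refine intervalIntegral.integral_congr fun t ht => ?_
  rw [uIcc_of_le zero_le_one] at ht
  simp only [projIcc_of_mem _ ht]

/-- Differentiation under the integral sign, up to the boundary of a convex set. -/
theorem hasFDerivWithinAt_integral_param {E F : Type} [NormedAddCommGroup E] [NormedSpace ℝ E]
    [NormedAddCommGroup F] [NormedSpace ℝ F] [CompleteSpace F] {D : Set E} (hD : Convex ℝ D)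
    {K : E × ℝ → F} {K' : E × ℝ → E →L[ℝ] F} (hK : ContinuousOn K (D ×ˢ Icc 0 1))
    (hK' : ContinuousOn K' (D ×ˢ Icc 0 1))
    (hd : ∀ z ∈ D, ∀ t ∈ Icc (0 : ℝ) 1, HasFDerivWithinAt (fun w => K (w, t)) (K' (z, t)) D z)
    {z : E} (hz : z ∈ D) :
    HasFDerivWithinAt (fun z => ∫ t in (0 : ℝ)..1, K (z, t)) (∫ t in (0 : ℝ)..1, K' (z, t)) D z := by
  have hsec : ∀ {G : Type} [NormedAddCommGroup G] {L : E × ℝ → G} (_ : ContinuousOn L (D ×ˢ Icc 0 1))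
      {w : E} (_ : w ∈ D), IntervalIntegrable (fun t => L (w, t)) MeasureTheory.volume 0 1 := by
    intro G _ L hL w hw
    refine ContinuousOn.intervalIntegrable ?_
    rw [uIcc_of_le zero_le_one]
    exact hL.comp (by fun_prop) (fun t ht => ⟨hw, ht⟩)
  rw [hasFDerivWithinAt_iff_isLittleO, Asymptotics.isLittleO_iff]
  intro c hc
  -- Compactness of `[0, 1]` makes `K' (w, t)` close to `K' (z, t)` uniformly in `t`. The mean value
  -- inequality on a convex piece of `D` then bounds the first order remainder uniformly in `t`.
  obtain ⟨v, hv, hvc⟩ := isCompact_Icc.mem_uniformity_of_prod (f := fun z t => K' (z, t))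
    (s := D) (k := Icc (0 : ℝ) 1) (q := z) hK' hz (Metric.dist_mem_uniformity hc)
  obtain ⟨δ, hδ, hδv⟩ := Metric.mem_nhdsWithin_iff.1 hv
  filter_upwards [inter_mem_nhdsWithin D (Metric.ball_mem_nhds z hδ)] with w hw
  have hconv : Convex ℝ (Metric.ball z δ ∩ D) := (convex_ball z δ).inter hD
  have hb : ∀ t ∈ Icc (0 : ℝ) 1, ‖K (w, t) - K (z, t) - K' (z, t) (w - z)‖ ≤ c * ‖w - z‖ := by
    intro t ht
    refine hconv.norm_image_sub_le_of_norm_hasFDerivWithin_le' (f := fun w => K (w, t))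
      (f' := fun w => K' (w, t)) (fun y hy => (hd y hy.2 t ht).mono inter_subset_right) ?_
      ⟨Metric.mem_ball_self hδ, hz⟩ ⟨hw.2, hw.1⟩
    intro y hy
    have := hvc y (hδv hy) t ht
    simp only [mem_ofPred_eq, dist_eq_norm] at this
    exact this.le
  have e1 : (∫ t in (0 : ℝ)..1, K' (z, t)) (w - z) = ∫ t in (0 : ℝ)..1, K' (z, t) (w - z) :=
    (ContinuousLinearMap.intervalIntegral_comp_comm
      (ContinuousLinearMap.apply ℝ F (w - z)) (hsec hK' hz)).symm
  have hi3 : IntervalIntegrable (fun t => K' (z, t) (w - z)) MeasureTheory.volume 0 1 :=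
    hsec (L := fun p => K' p (w - z)) (hK'.clm_apply continuousOn_const) hz
  rw [e1, ← intervalIntegral.integral_sub (hsec hK hw.1) (hsec hK hz),
    ← intervalIntegral.integral_sub ((hsec hK hw.1).sub (hsec hK hz)) hi3]
  have := intervalIntegral.norm_integral_le_of_norm_le_const (a := (0 : ℝ)) (b := 1)
    (f := fun t => K (w, t) - K (z, t) - K' (z, t) (w - z)) (C := c * ‖w - z‖) (by
      intro t ht
      rw [uIoc_of_le zero_le_one] at ht
      exact hb t ⟨ht.1.le, ht.2⟩)
  simpa using this

/-- Smooth dependence of an integral over `[0, 1]` on a parameter in a convex set, up to the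
boundary. -/
theorem contDiffOn_integral_param {E F : Type} [NormedAddCommGroup E] [NormedSpace ℝ E]
    [NormedAddCommGroup F] [NormedSpace ℝ F] [CompleteSpace F] {D : Set E} (hD : Convex ℝ D) (hDu : UniqueDiffOn ℝ D)
    {K : E × ℝ → F} (hK : ContDiffOn ℝ ∞ K (D ×ˢ Icc 0 1)) :
    ContDiffOn ℝ ∞ (fun z => ∫ t in (0 : ℝ)..1, K (z, t)) D := by
  rw [contDiffOn_infty]
  intro m
  induction m generalizing F with
  | zero =>
    rw [Nat.cast_zero, contDiffOn_zero]
    exact continuousOn_integral_param hK.continuousOn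
  | succ m ih =>
    have hu : UniqueDiffOn ℝ (D ×ˢ Icc (0 : ℝ) 1) := hDu.prod (uniqueDiffOn_Icc_zero_one)
    have hL : ContDiffOn ℝ ∞ (fun p : E × ℝ =>
        (fderivWithin ℝ K (D ×ˢ Icc 0 1) p).comp (ContinuousLinearMap.inl ℝ E ℝ)) (D ×ˢ Icc 0 1) :=
      (hK.fderivWithin hu (m := ∞) (by simp)).clm_comp contDiffOn_const
    have hd : ∀ z ∈ D, HasFDerivWithinAt (fun z => ∫ t in (0 : ℝ)..1, K (z, t))
        (∫ t in (0 : ℝ)..1, (fderivWithin ℝ K (D ×ˢ Icc 0 1) (z, t)).comp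
          (ContinuousLinearMap.inl ℝ E ℝ)) D z := by
      intro z hz
      refine hasFDerivWithinAt_integral_param hD hK.continuousOn hL.continuousOn ?_ hz
      intro z hz t ht
      have h1 := (hK.differentiableOn (by simp) (z, t) ⟨hz, ht⟩).hasFDerivWithinAt
      exact HasFDerivWithinAt.comp (g := K) (f := fun w => (w, t)) z h1
        (hasFDerivAt_prodMk_left z t).hasFDerivWithinAt
        (fun w hw => (⟨hw, ht⟩ : (w, t) ∈ D ×ˢ Icc (0 : ℝ) 1))
    rw [Nat.cast_succ, contDiffOn_succ_iff_fderivWithin hDu]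
    refine ⟨fun z hz => (hd z hz).differentiableWithinAt, by simp, ?_⟩
    exact (ih hL).congr fun z hz => (hd z hz).fderivWithin (hDu z hz)

/-! ### Hadamard's lemma and normal primitives on half balls. -/

section HalfSpace

variable {n : ℕ} [NeZero n] {F : Type} [NormedAddCommGroup F] [NormedSpace ℝ F]

/-- The half ball of radius `r` around `z₀`. -/
def halfBall (z₀ : EuclideanSpace ℝ (Fin n)) (r : ℝ) : Set (EuclideanSpace ℝ (Fin n)) :=
  Metric.ball z₀ r ∩ {z | 0 ≤ z 0}

theorem mem_halfBall {z₀ z : EuclideanSpace ℝ (Fin n)} {r : ℝ} :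
    z ∈ halfBall z₀ r ↔ dist z z₀ < r ∧ 0 ≤ z 0 := Iff.rfl

theorem convex_halfBall (z₀ : EuclideanSpace ℝ (Fin n)) (r : ℝ) : Convex ℝ (halfBall z₀ r) :=
  (convex_ball z₀ r).inter
    (convex_halfSpace_ge (f := fun z : EuclideanSpace ℝ (Fin n) => z 0)
      ⟨fun _ _ => rfl, fun _ _ => rfl⟩ 0)

/-- The point `(t x, y)`, where `z = (x, y)`. -/
noncomputable def squeeze (t : ℝ) (z : EuclideanSpace ℝ (Fin n)) : EuclideanSpace ℝ (Fin n) :=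
  z - ((1 - t) * z 0) • EuclideanSpace.single 0 1

@[simp] theorem squeeze_zero (t : ℝ) (z : EuclideanSpace ℝ (Fin n)) : squeeze t z 0 = t * z 0 := by
  simp [squeeze]; ring

theorem squeeze_of_ne (t : ℝ) (z : EuclideanSpace ℝ (Fin n)) {i : Fin n} (hi : i ≠ 0) :
    squeeze t z i = z i := by
  simp [squeeze, hi]

@[simp] theorem squeeze_one (z : EuclideanSpace ℝ (Fin n)) : squeeze 1 z = z := by
  simp [squeeze]

theorem contDiff_squeeze :
    ContDiff ℝ ∞ (fun p : EuclideanSpace ℝ (Fin n) × ℝ => squeeze p.2 p.1) := by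
  have hcoord : ContDiff ℝ ∞ (fun p : EuclideanSpace ℝ (Fin n) × ℝ => p.1 0) :=
    ((EuclideanSpace.proj (𝕜 := ℝ) (0 : Fin n)).contDiff).comp contDiff_fst
  exact contDiff_fst.sub (((contDiff_const.sub contDiff_snd).mul hcoord).smul contDiff_const)

/-- The centre lies on the boundary, so shrinking the first coordinate only decreases the distance
to it. Integration along normal segments thus stays inside the half ball. -/
theorem squeeze_mem_halfBall {z₀ z : EuclideanSpace ℝ (Fin n)} {r : ℝ} (h0 : z₀ 0 = 0)
    (hz : z ∈ halfBall z₀ r) {t : ℝ} (ht : t ∈ Icc (0 : ℝ) 1) : squeeze t z ∈ halfBall z₀ r := by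
  rw [mem_halfBall] at hz ⊢
  refine ⟨lt_of_le_of_lt ?_ hz.1, by simpa using mul_nonneg ht.1 hz.2⟩
  rw [EuclideanSpace.dist_eq, EuclideanSpace.dist_eq]
  apply Real.sqrt_le_sqrt
  refine Finset.sum_le_sum fun i _ => ?_
  by_cases hi : i = 0
  · subst hi
    rw [Real.dist_eq, Real.dist_eq, h0, squeeze_zero, sub_zero, sub_zero, abs_mul, mul_pow]
    rw [abs_of_nonneg ht.1]
    exact mul_le_of_le_one_left (by positivity) (pow_le_one₀ ht.1 ht.2)
  · rw [squeeze_of_ne _ _ hi]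

theorem uniqueDiffOn_halfBall {z₀ : EuclideanSpace ℝ (Fin n)} (h0 : z₀ 0 = 0) (r : ℝ) :
    UniqueDiffOn ℝ (halfBall z₀ r) := by
  rcases le_or_gt r 0 with hr | hr
  · rw [halfBall, Metric.ball_eq_empty.2 hr, empty_inter]
    exact uniqueDiffOn_empty
  refine uniqueDiffOn_convex (convex_halfBall z₀ r) ?_
  refine ⟨z₀ + (r / 2) • EuclideanSpace.single 0 1, ?_⟩
  have hopen : IsOpen (Metric.ball z₀ r ∩ {z : EuclideanSpace ℝ (Fin n) | 0 < z 0}) :=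
    Metric.isOpen_ball.inter (isOpen_lt continuous_const (by fun_prop))
  refine mem_interior.2 ⟨_, ?_, hopen, ?_⟩
  · exact fun z hz => mem_halfBall.2 ⟨hz.1, le_of_lt hz.2⟩
  · refine ⟨?_, ?_⟩
    · simp [norm_smul, abs_of_pos hr]
      linarith
    · simp [h0, hr]

/-- A smooth function on a half ball that vanishes on the boundary is the integral of its normal
derivative. -/
theorem eq_coord_smul_integral {z₀ : EuclideanSpace ℝ (Fin n)} (h0 : z₀ 0 = 0) {r : ℝ}
    [CompleteSpace F]
    {f : EuclideanSpace ℝ (Fin n) → F} (hf : ContDiffOn ℝ ∞ f (halfBall z₀ r))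
    (hb : ∀ z ∈ halfBall z₀ r, z 0 = 0 → f z = 0) {z : EuclideanSpace ℝ (Fin n)}
    (hz : z ∈ halfBall z₀ r) :
    f z = z 0 • ∫ t in (0 : ℝ)..1,
      fderivWithin ℝ f (halfBall z₀ r) (squeeze t z) (EuclideanSpace.single 0 1) := by
  have hu := uniqueDiffOn_halfBall h0 r
  have hK : ContinuousOn (fun t : ℝ => fderivWithin ℝ f (halfBall z₀ r) (squeeze t z)
      (EuclideanSpace.single 0 1)) (Icc 0 1) := by
    refine ContinuousOn.clm_apply ?_ continuousOn_const
    refine (hf.continuousOn_fderivWithin hu (by simp)).comp ?_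
      (fun t ht => squeeze_mem_halfBall h0 hz ht)
    exact (contDiff_squeeze.continuous.comp (by fun_prop : Continuous fun t : ℝ => (z, t))).continuousOn
  have hline : ∀ t : ℝ, HasDerivAt (fun t => squeeze t z)
      (z 0 • EuclideanSpace.single 0 1 : EuclideanSpace ℝ (Fin n)) t := by
    intro t
    have := (((hasDerivAt_id t).const_sub 1).mul_const (z 0)).smul_const
      (EuclideanSpace.single 0 1 : EuclideanSpace ℝ (Fin n)) |>.const_sub z
    simpa [squeeze] using this
  have hderiv : ∀ t ∈ Icc (0 : ℝ) 1, HasDerivWithinAt (fun t => f (squeeze t z))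
      (z 0 • fderivWithin ℝ f (halfBall z₀ r) (squeeze t z) (EuclideanSpace.single 0 1))
      (Icc 0 1) t := by
    intro t ht
    have h1 := ((hf.differentiableOn (by simp)) _ (squeeze_mem_halfBall h0 hz ht)).hasFDerivWithinAt
    have := h1.comp_hasDerivWithinAt t ((hline t).hasDerivWithinAt (s := Icc 0 1))
      (fun s hs => squeeze_mem_halfBall h0 hz hs)
    rwa [map_smul] at this
  have hint := intervalIntegral.integral_eq_sub_of_hasDerivAt_of_le zero_le_one
    (f := fun t => f (squeeze t z))
    (fun t ht => (hderiv t ht).continuousWithinAt)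
    (fun t ht => (hderiv t (Ioo_subset_Icc_self ht)).hasDerivAt (Icc_mem_nhds ht.1 ht.2))
    ((hK.const_smul (z 0)).intervalIntegrable_of_Icc zero_le_one)
  rw [intervalIntegral.integral_smul] at hint
  rw [hint, hb (squeeze 0 z) (squeeze_mem_halfBall h0 hz (by simp)) (by simp)]
  simp

/-- Hadamard's lemma up to the boundary of a half ball, with a power of the first coordinate: if
the normal derivative is divisible by `x ^ k` and the function vanishes on the boundary, then the
function is divisible by `x ^ (k + 1)`. -/
theorem exists_eq_coord_pow_smul {z₀ : EuclideanSpace ℝ (Fin n)} (h0 : z₀ 0 = 0) {r : ℝ}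
    [CompleteSpace F]
    {f : EuclideanSpace ℝ (Fin n) → F} (hf : ContDiffOn ℝ ∞ f (halfBall z₀ r))
    (hb : ∀ z ∈ halfBall z₀ r, z 0 = 0 → f z = 0) {k : ℕ} {g : EuclideanSpace ℝ (Fin n) → F}
    (hg : ContDiffOn ℝ ∞ g (halfBall z₀ r))
    (hfg : ∀ z ∈ halfBall z₀ r,
      fderivWithin ℝ f (halfBall z₀ r) z (EuclideanSpace.single 0 1) = z 0 ^ k • g z) :
    ∃ G : EuclideanSpace ℝ (Fin n) → F, ContDiffOn ℝ ∞ G (halfBall z₀ r) ∧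
      ∀ z ∈ halfBall z₀ r, f z = z 0 ^ (k + 1) • G z := by
  -- Insert `(t x) ^ k g` for the normal derivative in `f = x ∫ ∂ₓf (t x, y) dt` and take `x ^ k`
  -- out of the integral.
  refine ⟨fun z => ∫ t in (0 : ℝ)..1, t ^ k • g (squeeze t z), ?_, ?_⟩
  · refine contDiffOn_integral_param (convex_halfBall z₀ r) (uniqueDiffOn_halfBall h0 r)
      (K := fun p => p.2 ^ k • g (squeeze p.2 p.1)) ?_
    have h1 : ContDiffOn ℝ ∞ (fun p : EuclideanSpace ℝ (Fin n) × ℝ => g (squeeze p.2 p.1))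
        (halfBall z₀ r ×ˢ Icc 0 1) := by
      refine hg.comp contDiff_squeeze.contDiffOn ?_
      rintro ⟨z, t⟩ ⟨hz, ht⟩
      exact squeeze_mem_halfBall h0 hz ht
    have h2 : ContDiff ℝ ∞ (fun p : EuclideanSpace ℝ (Fin n) × ℝ => p.2 ^ k) := contDiff_snd.pow k
    exact h2.contDiffOn.smul h1
  · intro z hz
    rw [eq_coord_smul_integral h0 hf hb hz, pow_succ', mul_smul]
    refine congrArg (fun v : F => z 0 • v) ?_
    rw [← intervalIntegral.integral_smul]
    refine intervalIntegral.integral_congr fun t ht => ?_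
    rw [uIcc_of_le zero_le_one] at ht
    simp only
    rw [hfg _ (squeeze_mem_halfBall h0 hz ht), squeeze_zero, mul_pow, smul_smul, mul_comm]

/-- Hadamard's lemma up to the boundary of a half ball. -/
theorem exists_eq_coord_smul {z₀ : EuclideanSpace ℝ (Fin n)} (h0 : z₀ 0 = 0) {r : ℝ}
    [CompleteSpace F]
    {f : EuclideanSpace ℝ (Fin n) → F} (hf : ContDiffOn ℝ ∞ f (halfBall z₀ r))
    (hb : ∀ z ∈ halfBall z₀ r, z 0 = 0 → f z = 0) :
    ∃ G : EuclideanSpace ℝ (Fin n) → F, ContDiffOn ℝ ∞ G (halfBall z₀ r) ∧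
      ∀ z ∈ halfBall z₀ r, f z = z 0 • G z := by
  have hu := uniqueDiffOn_halfBall h0 r
  obtain ⟨G, hG, hfG⟩ := exists_eq_coord_pow_smul h0 hf hb (k := 0)
    ((hf.fderivWithin hu (m := ∞) (by simp)).clm_apply contDiffOn_const)
    (fun z _ => by rw [pow_zero, one_smul])
  exact ⟨G, hG, fun z hz => by simpa using hfG z hz⟩

/-- Integration in the normal direction. -/
theorem exists_normal_primitive {z₀ : EuclideanSpace ℝ (Fin n)} (h0 : z₀ 0 = 0) {r : ℝ}
    {f : EuclideanSpace ℝ (Fin n) → ℝ} (hf : ContDiffOn ℝ ∞ f (halfBall z₀ r)) :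
    ∃ q : EuclideanSpace ℝ (Fin n) → ℝ, ContDiffOn ℝ ∞ q (halfBall z₀ r) ∧
      (∀ z ∈ halfBall z₀ r, z 0 = 0 → q z = 0) ∧
      ∀ z ∈ halfBall z₀ r,
        fderivWithin ℝ q (halfBall z₀ r) z (EuclideanSpace.single 0 1) = f z := by
  have hu := uniqueDiffOn_halfBall h0 r
  set u : EuclideanSpace ℝ (Fin n) := EuclideanSpace.single 0 1 with hudef
  have hu0 : u 0 = 1 := by simp [hudef]
  have hq : ContDiffOn ℝ ∞ (fun z => z 0 * ∫ t in (0 : ℝ)..1, f (squeeze t z)) (halfBall z₀ r) := by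
    refine ContDiffOn.mul (by fun_prop) ?_
    refine contDiffOn_integral_param (convex_halfBall z₀ r) hu (K := fun p => f (squeeze p.2 p.1)) ?_
    refine hf.comp contDiff_squeeze.contDiffOn ?_
    rintro ⟨z, t⟩ ⟨hz, ht⟩
    exact squeeze_mem_halfBall h0 hz ht
  refine ⟨_, hq, fun z _ hz0 => by simp [hz0], fun z hz => ?_⟩
  set q : EuclideanSpace ℝ (Fin n) → ℝ := fun z => z 0 * ∫ t in (0 : ℝ)..1, f (squeeze t z) with hqdef
  -- The normal line through `z`, parametrised by its first coordinate.
  let l : ℝ → EuclideanSpace ℝ (Fin n) := fun s => z + (s - z 0) • u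
  have hlc : Continuous l := by fun_prop
  have hl0 : l (z 0) = z := by simp [l]
  have hlx : ∀ s, l s 0 = s := fun s => by simp [l, hu0]
  have hz' := mem_halfBall.1 hz
  -- The interval reaches beyond `z 0`, so it is nondegenerate even when `z` is a boundary point and
  -- one-sided derivatives on it are unique.
  obtain ⟨b, hbz, hb⟩ : ∃ b, z 0 < b ∧ ∀ s ∈ Icc (0 : ℝ) b, l s ∈ halfBall z₀ r := by
    have h1 : ∀ᶠ s in 𝓝 (z 0), l s ∈ Metric.ball z₀ r := by
      refine hlc.continuousAt.eventually (Metric.isOpen_ball.mem_nhds ?_)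
      rw [hl0]; exact hz.1
    obtain ⟨δ, hδ, h2⟩ := Metric.eventually_nhds_iff.1 h1
    refine ⟨z 0 + δ / 2, by linarith, fun s hs => mem_halfBall.2 ⟨?_, by rw [hlx]; exact hs.1⟩⟩
    rcases le_or_gt s (z 0) with h | h
    · rcases eq_or_lt_of_le hz'.2 with h3 | h3
      · have : s = z 0 := le_antisymm h (by rw [← h3]; exact hs.1)
        rw [this, hl0]; exact hz'.1
      · have : l s = squeeze (s / z 0) z := by
          simp only [l, squeeze]
          rw [sub_mul, div_mul_cancel₀ _ h3.ne', one_mul]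
          module
        rw [this]
        exact (mem_halfBall.1 (squeeze_mem_halfBall h0 hz
          ⟨div_nonneg hs.1 h3.le, (div_le_one h3).2 h⟩)).1
    · exact h2 (by rw [Real.dist_eq, abs_of_pos (by linarith)]; linarith [hs.2])
  have hb0 : 0 ≤ b := hz'.2.trans hbz.le
  have hfl : ContinuousOn (fun s => f (l s)) (Icc 0 b) := hf.continuousOn.comp hlc.continuousOn hb
  let g : ℝ → ℝ := fun s => f (l (projIcc 0 b hb0 s))
  have hg : Continuous g := hfl.comp_continuous (by fun_prop) (fun s => (projIcc 0 b hb0 s).2)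
  have hgeq : ∀ s ∈ Icc 0 b, g s = f (l s) := fun s hs => by simp only [g, projIcc_of_mem _ hs]
  have hqg : ∀ s ∈ Icc 0 b, q (l s) = ∫ w in (0 : ℝ)..s, g w := by
    intro s hs
    have h1 := intervalIntegral.mul_integral_comp_mul_left (a := 0) (b := 1) (f := g) (c := s)
    rw [mul_zero, mul_one] at h1
    rw [← h1]
    simp only [hqdef, hlx]
    congr 1
    refine intervalIntegral.integral_congr fun t ht => ?_
    rw [uIcc_of_le zero_le_one] at ht
    rw [hgeq _ ⟨mul_nonneg hs.1 ht.1, (mul_le_of_le_one_right hs.1 ht.2).trans hs.2⟩]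
    congr 1
    simp only [squeeze, hlx]
    simp only [l]
    module
  have hmem : z 0 ∈ Icc 0 b := ⟨hz'.2, hbz.le⟩
  have hd1 : HasDerivWithinAt (fun s => q (l s)) (f z) (Icc 0 b) (z 0) := by
    have h1 : HasDerivAt (fun s => ∫ w in (0 : ℝ)..s, g w) (g (z 0)) (z 0) :=
      intervalIntegral.integral_hasDerivAt_right (hg.intervalIntegrable _ _)
        (hg.stronglyMeasurableAtFilter _ _) hg.continuousAt
    rw [hgeq _ hmem, hl0] at h1
    exact h1.hasDerivWithinAt.congr hqg (hqg _ hmem)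
  have hd2 : HasDerivWithinAt (fun s => q (l s)) (fderivWithin ℝ q (halfBall z₀ r) z u)
      (Icc 0 b) (z 0) := by
    have h1 : HasFDerivWithinAt q (fderivWithin ℝ q (halfBall z₀ r) z) (halfBall z₀ r) (l (z 0)) := by
      rw [hl0]
      exact (hq.differentiableOn (by simp) z hz).hasFDerivWithinAt
    have h2 : HasDerivWithinAt l u (Icc 0 b) (z 0) := by
      have := (((hasDerivAt_id (z 0)).sub_const (z 0)).smul_const u).const_add z
      simpa [l] using this.hasDerivWithinAt
    exact h1.comp_hasDerivWithinAt (z 0) h2 hb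
  -- The derivative along the line is computed once by the fundamental theorem of calculus and once
  -- by the chain rule.
  exact (uniqueDiffOn_Icc (hz'.2.trans_lt hbz) (z 0) hmem).eq_deriv _ hd2 hd1

end HalfSpace

/-! ### The flow near a given integral curve. -/

/-- A smooth vector field can be cut off outside a neighbourhood of a compact set. -/
theorem exists_cutoff_vectorField {Y : Type} [NormedAddCommGroup Y] [NormedSpace ℝ Y]
    [FiniteDimensional ℝ Y] {V : Y → Y} {Ω K : Set Y} (hΩ : IsOpen Ω) (hV : ContDiffOn ℝ ∞ V Ω)
    (hK : IsCompact K) (hKΩ : K ⊆ Ω) :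
    ∃ (W : Y → Y) (N : Set Y), ContDiff ℝ ∞ W ∧ HasCompactSupport W ∧ IsOpen N ∧ K ⊆ N ∧ N ⊆ Ω ∧
      ∀ y ∈ N, W y = V y := by
  obtain ⟨K', hK', hKK', hK'Ω⟩ := exists_compact_between hK hΩ hKΩ
  obtain ⟨χ, hχ1, hχ0, -⟩ := exists_contMDiffMap_one_nhds_of_subset_interior (n := ⊤) 𝓘(ℝ, Y)
    hK.isClosed hKK'
  have hχ : ContDiff ℝ ∞ χ := χ.contMDiff.contDiff
  obtain ⟨N, hN, hKN, hNχ⟩ := mem_nhdsSet_iff_exists.1 hχ1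
  refine ⟨fun y => χ y • V y, N ∩ interior K', ?_, ?_, hN.inter isOpen_interior,
    subset_inter hKN hKK', fun y hy => hK'Ω (interior_subset hy.2), fun y hy => ?_⟩
  · rw [contDiff_iff_contDiffAt]
    intro y
    by_cases hy : y ∈ Ω
    · exact hχ.contDiffAt.smul (hV.contDiffAt (hΩ.mem_nhds hy))
    · have hy' : y ∈ K'ᶜ := fun h => hy (hK'Ω h)
      have : (fun y => χ y • V y) =ᶠ[𝓝 y] fun _ => 0 := by
        filter_upwards [hK'.isClosed.isOpen_compl.mem_nhds hy'] with w hw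
        rw [hχ0 w hw, zero_smul]
      exact contDiffAt_const.congr_of_eventuallyEq this
  · refine HasCompactSupport.intro hK' fun y hy => ?_
    rw [hχ0 y hy, zero_smul]
  · have : χ y = 1 := hNχ hy.1
    simp only [this, one_smul]

/-- Near an integral curve of a smooth vector field on a compact time interval, the flow exists and
is continuous. -/
theorem exists_flow_near_integralCurve {Y : Type} [NormedAddCommGroup Y] [NormedSpace ℝ Y]
    [FiniteDimensional ℝ Y] {V : Y → Y} {Ω : Set Y} (hΩ : IsOpen Ω) (hV : ContDiffOn ℝ ∞ V Ω)
    {T : ℝ} (hT : 0 ≤ T) {c : ℝ → Y}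
    (hc : ∀ t ∈ Icc 0 T, HasDerivWithinAt c (V (c t)) (Icc 0 T) t)
    (hcΩ : ∀ t ∈ Icc 0 T, c t ∈ Ω) :
    ∃ (α : Y × ℝ → Y) (r : ℝ), 0 < r ∧
      (∀ y ∈ Metric.closedBall (c 0) r, α (y, 0) = y ∧ ∀ t ∈ Icc 0 T, α (y, t) ∈ Ω ∧
        HasDerivWithinAt (fun s => α (y, s)) (V (α (y, t))) (Icc 0 T) t) ∧
      ContinuousOn α (Metric.closedBall (c 0) r ×ˢ Icc 0 T) ∧ ∀ t ∈ Icc 0 T, α (c 0, t) = c t := by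
  have hcc : ContinuousOn c (Icc 0 T) := fun t ht => (hc t ht).continuousWithinAt
  obtain ⟨W, N, hW, hWs, hN, hKN, hNΩ, hWV⟩ := exists_cutoff_vectorField hΩ hV
    (isCompact_Icc.image_of_continuousOn hcc) (by rintro _ ⟨t, ht, rfl⟩; exact hcΩ t ht)
  obtain ⟨C, hC⟩ := ContDiff.lipschitzWith_of_hasCompactSupport hWs hW (by simp)
  obtain ⟨L, hL⟩ := hWs.exists_bound_of_continuous hW.continuous
  have hcN : ∀ t ∈ Icc 0 T, c t ∈ N := fun t ht => hKN ⟨t, ht, rfl⟩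
  have h0T : (0 : ℝ) ∈ Icc 0 T := ⟨le_rfl, hT⟩
  -- Since `W` is bounded by `L`, a solution moves by at most `L * T`. The radius `L * T + 1`
  -- accommodates every solution that starts in the unit ball for the whole time `T`.
  have hPL : IsPicardLindelof (fun _ => W) (⟨0, h0T⟩ : Icc (0 : ℝ) T) (c 0)
      (L.toNNReal * T.toNNReal + 1) 1 L.toNNReal C := by
    refine ⟨fun _ _ => hC.lipschitzOnWith, fun _ _ => continuousOn_const,
      fun _ _ y _ => (hL y).trans (Real.le_coe_toNNReal L), ?_⟩
    push_cast
    rw [sub_zero, sub_self, max_eq_left hT, Real.coe_toNNReal T hT]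
    linarith
  obtain ⟨α, hα, hαc⟩ := hPL.exists_forall_mem_closedBall_eq_hasDerivWithinAt_continuousOn
  have hIci : ∀ {g : ℝ → Y} {g' : Y} {t : ℝ}, t ∈ Ico 0 T → HasDerivWithinAt g g' (Icc 0 T) t →
      HasDerivWithinAt g g' (Ici t) t := fun {g g' t} ht h =>
    h.mono_of_mem_nhdsWithin (Icc_mem_nhdsGE_of_mem ht)
  have hαeq : ∀ t ∈ Icc 0 T, α (c 0, t) = c t := by
    have h1 := hα (c 0) (Metric.mem_closedBall_self zero_le_one)
    refine ODE_solution_unique_of_mem_Icc_right (v := fun _ => W) (s := fun _ => univ) (K := C)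
      (fun _ _ => hC.lipschitzOnWith) (fun t ht => (h1.2 t ht).continuousWithinAt)
      (fun t ht => hIci ht (h1.2 t ⟨ht.1, ht.2.le⟩)) (fun _ _ => mem_univ _) hcc
      (fun t ht => ?_) (fun _ _ => mem_univ _) h1.1
    have ht' : t ∈ Icc 0 T := ⟨ht.1, ht.2.le⟩
    rw [hWV _ (hcN t ht')]
    exact hIci ht (hc t ht')
  -- By compactness of the time interval, solutions that start close enough to `c 0` remain in `N`,
  -- where `W = V` and the cut-off is not felt.
  obtain ⟨r, hr, hrN⟩ : ∃ r > 0, r ≤ 1 ∧ ∀ y ∈ Metric.closedBall (c 0) r, ∀ t ∈ Icc 0 T,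
      α (y, t) ∈ N := by
    have hev : ∀ᶠ y in 𝓝 (c 0), ∀ t ∈ Icc 0 T, t ∈ Icc 0 T → α (y, t) ∈ N := by
      refine isCompact_Icc.eventually_forall_of_forall_eventually fun t ht => ?_
      have h1 : ∀ᶠ z in 𝓝[Metric.closedBall (c 0) 1 ×ˢ Icc 0 T] (c 0, t), α z ∈ N :=
        (hαc (c 0, t) ⟨Metric.mem_closedBall_self zero_le_one, ht⟩).eventually
          (hN.mem_nhds (by rw [hαeq t ht]; exact hcN t ht))
      have h2 : ∀ᶠ z : Y × ℝ in 𝓝 (c 0, t), z.1 ∈ Metric.closedBall (c 0) 1 :=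
        continuous_fst.continuousAt.eventually (Metric.closedBall_mem_nhds _ one_pos)
      filter_upwards [eventually_nhdsWithin_iff.1 h1, h2] with z hz1 hz2 hz3
      exact hz1 ⟨hz2, hz3⟩
    obtain ⟨r, hr, hr'⟩ := Metric.nhds_basis_closedBall.mem_iff.1 hev
    exact ⟨min r 1, lt_min hr one_pos, min_le_right _ _,
      fun y hy t ht =>
        hr' (Metric.closedBall_subset_closedBall (min_le_left _ _) hy) t ht ht⟩
  have hsub : Metric.closedBall (c 0) r ⊆ Metric.closedBall (c 0) 1 :=
    Metric.closedBall_subset_closedBall hrN.1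
  refine ⟨α, r, hr, fun y hy => ⟨(hα y (hsub hy)).1, fun t ht => ⟨hNΩ (hrN.2 y hy t ht), ?_⟩⟩,
    hαc.mono (prod_mono_left hsub), hαeq⟩
  have := (hα y (hsub hy)).2 t ht
  rwa [hWV _ (hrN.2 y hy t ht)] at this

/-! ### The model Hamiltonian and its rescaled equations of motion. -/

section Model

variable {E : Type} [NormedAddCommGroup E] [NormedSpace ℝ E] (ν : E →L[ℝ] ℝ) (e : E)

/-! Shortcuts for instance search. -/

noncomputable abbrev dualMetricGroup (E : Type) [NormedAddCommGroup E] [NormedSpace ℝ E] :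
    NormedAddCommGroup ((E →L[ℝ] ℝ) →L[ℝ] E) := ContinuousLinearMap.toNormedAddCommGroup

noncomputable abbrev dualMetricAddCommGroup (E : Type) [NormedAddCommGroup E] [NormedSpace ℝ E] :
    AddCommGroup ((E →L[ℝ] ℝ) →L[ℝ] E) := ContinuousLinearMap.addCommGroup

noncomputable abbrev dualMetricSpace (E : Type) [NormedAddCommGroup E] [NormedSpace ℝ E] :
    NormedSpace ℝ ((E →L[ℝ] ℝ) →L[ℝ] E) := ContinuousLinearMap.toNormedSpace

attribute [local instance] dualMetricAddCommGroup dualMetricGroup dualMetricSpace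

noncomputable abbrev dualMetricDerivGroup (E : Type) [NormedAddCommGroup E] [NormedSpace ℝ E] :
    NormedAddCommGroup (E →L[ℝ] (E →L[ℝ] ℝ) →L[ℝ] E) := ContinuousLinearMap.toNormedAddCommGroup

attribute [local instance] dualMetricDerivGroup

noncomputable abbrev dualMetricDerivSpace (E : Type) [NormedAddCommGroup E] [NormedSpace ℝ E] :
    NormedSpace ℝ (E →L[ℝ] (E →L[ℝ] ℝ) →L[ℝ] E) := ContinuousLinearMap.toNormedSpace

attribute [local instance] dualMetricDerivSpace

/-- The projection along `e` to the kernel of `ν`, if `ν e = 1`. -/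
noncomputable def tangentialProj : E →L[ℝ] E := ContinuousLinearMap.id ℝ _ - ν.smulRight e

/-- The linear map that multiplies by `a` on the line through `e` and by `b` on the kernel of `ν`,
if `ν e = 1`. -/
noncomputable def diag (a b : ℝ) : E →L[ℝ] E := a • ν.smulRight e + b • tangentialProj ν e

theorem tangentialProj_apply (v : E) : tangentialProj ν e v = v - ν v • e := by
  simp [tangentialProj]

theorem diag_apply (a b : ℝ) (v : E) :
    diag ν e a b v = (a * ν v) • e + b • tangentialProj ν e v := by
  simp [diag, smul_smul]

theorem diag_same (a : ℝ) (v : E) : diag ν e a a v = a • v := by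
  rw [diag_apply, tangentialProj_apply]; module

theorem contDiff_diag : ContDiff ℝ ∞ (fun p : ℝ × ℝ => diag ν e p.1 p.2) := by
  unfold diag; fun_prop

variable {ν e} in
theorem tangentialProj_self (he : ν e = 1) : tangentialProj ν e e = 0 := by
  simp [tangentialProj_apply, he]

variable {ν e} in
theorem apply_tangentialProj (he : ν e = 1) (v : E) : ν (tangentialProj ν e v) = 0 := by
  simp [tangentialProj_apply, he]

variable {ν e} in
theorem apply_diag (he : ν e = 1) (a b : ℝ) (v : E) : ν (diag ν e a b v) = a * ν v := by
  simp [diag_apply, apply_tangentialProj he, he]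

variable {ν e} in
theorem tangentialProj_diag (he : ν e = 1) (a b : ℝ) (v : E) :
    tangentialProj ν e (diag ν e a b v) = b • tangentialProj ν e v := by
  rw [diag_apply, map_add, map_smul, map_smul, tangentialProj_self he, smul_zero, zero_add]
  congr 1
  rw [tangentialProj_apply ν e (tangentialProj ν e v), apply_tangentialProj he, zero_smul, sub_zero]

variable {ν e} in
theorem diag_diag (he : ν e = 1) (a b c d : ℝ) (v : E) :
    diag ν e a b (diag ν e c d v) = diag ν e (a * c) (b * d) v := by
  rw [diag_apply ν e a b, apply_diag he, tangentialProj_diag he, diag_apply, smul_smul, mul_assoc]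

variable (k : E → (E →L[ℝ] ℝ) →L[ℝ] E)

/-- The covector `(ξ / 2, x η)`, where `P = (ξ, η)`. -/
noncomputable def scaledCovector (x : ℝ) (P : E →L[ℝ] ℝ) : E →L[ℝ] ℝ :=
  P.comp (diag ν e (1 / 2) x)

/-- The Hamiltonian of a metric that blows up at the boundary like a gas giant metric; `k` is a dual
metric that is smooth across the boundary. -/
noncomputable def modelHamiltonian (w : E × (E →L[ℝ] ℝ)) : ℝ :=
  1 / 2 * scaledCovector ν e (ν w.1) w.2 (k w.1 (scaledCovector ν e (ν w.1) w.2))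

/-- The derivative of `modelHamiltonian` in the covector. -/
noncomputable def modelVelocity (z : E) (P : E →L[ℝ] ℝ) : E :=
  diag ν e (1 / 2) (ν z) (k z (scaledCovector ν e (ν z) P))

/-- The derivative of `modelHamiltonian` in the point. -/
noncomputable def modelForce (z : E) (P : E →L[ℝ] ℝ) : E →L[ℝ] ℝ :=
  (1 / 2 : ℝ) • (scaledCovector ν e (ν z) P).comp
      ((ContinuousLinearMap.apply ℝ E (scaledCovector ν e (ν z) P)).comp (fderiv ℝ k z)) +
    P (tangentialProj ν e (k z (scaledCovector ν e (ν z) P))) • ν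

variable {ν e k}

/-- The covector enters the quadratic form twice. Symmetry of `k z` makes the two contributions
equal, which absorbs the factor `1 / 2`. -/
theorem hasFDerivAt_modelHamiltonian {z : E} {P : E →L[ℝ] ℝ} (hk : DifferentiableAt ℝ k z)
    (hs : ∀ P Q : E →L[ℝ] ℝ, P (k z Q) = Q (k z P)) :
    HasFDerivAt (modelHamiltonian ν e k)
      ((modelForce ν e k z P).coprod (ContinuousLinearMap.apply ℝ ℝ (modelVelocity ν e k z P)))
      (z, P) := by
  have hN : HasFDerivAt (fun w : E × (E →L[ℝ] ℝ) => ν w.1)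
      (ν.comp (ContinuousLinearMap.fst ℝ E (E →L[ℝ] ℝ))) (z, P) :=
    (ν.comp (ContinuousLinearMap.fst ℝ E (E →L[ℝ] ℝ))).hasFDerivAt
  have hD : HasFDerivAt (fun w : E × (E →L[ℝ] ℝ) => diag ν e (1 / 2) (ν w.1))
      ((ν.comp (ContinuousLinearMap.fst ℝ E (E →L[ℝ] ℝ))).smulRight (tangentialProj ν e))
      (z, P) := by
    unfold diag
    exact (hN.smul_const _).const_add _
  have hR := (hasFDerivAt_snd (𝕜 := ℝ) (p := (z, P))).clm_comp hD
  have hk' : HasFDerivAt (fun w : E × (E →L[ℝ] ℝ) => k w.1)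
      ((fderiv ℝ k z).comp (ContinuousLinearMap.fst ℝ E (E →L[ℝ] ℝ))) (z, P) :=
    HasFDerivAt.comp (g := k) (z, P) hk.hasFDerivAt hasFDerivAt_fst
  have hH := (hR.clm_apply (hk'.clm_apply hR)).const_mul (1 / 2 : ℝ)
  refine hH.congr_fderiv ?_
  refine ContinuousLinearMap.ext fun ⟨u, Q⟩ => ?_
  have h1 := hs (P.comp (diag ν e (1 / 2) (ν z))) (Q.comp (diag ν e (1 / 2) (ν z)))
  have h2 := hs (P.comp (diag ν e (1 / 2) (ν z))) (P.comp (tangentialProj ν e))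
  simp [modelForce, modelVelocity, scaledCovector] at h1 h2 ⊢
  rw [h1, h2]
  ring

/-- A trajectory of `modelHamiltonian` of energy `1 / 2` between two boundary points. -/
structure IsModelTrajectory (ν : E →L[ℝ] ℝ) (e : E) (k : E → (E →L[ℝ] ℝ) →L[ℝ] E) (B : Set E) (τ : ℝ)
    (z : ℝ → E) (P : ℝ → E →L[ℝ] ℝ) : Prop where
  pos : 0 < τ
  continuousOn_point : ContinuousOn z (Icc 0 τ)
  continuousOn_covector : ContinuousOn P (Icc 0 τ)
  mem : ∀ t ∈ Icc 0 τ, z t ∈ B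
  start_mem : ν (z 0) = 0
  end_mem : ν (z τ) = 0
  interior_mem : ∀ t ∈ Ioo 0 τ, 0 < ν (z t)
  energy : ∀ t ∈ Ioo 0 τ, modelHamiltonian ν e k (z t, P t) = 1 / 2
  deriv_point : ∀ t ∈ Ioo 0 τ, HasDerivAt z (modelVelocity ν e k (z t) (P t)) t
  deriv_covector : ∀ t ∈ Ioo 0 τ, HasDerivAt P (-modelForce ν e k (z t) (P t)) t

/-- Conservation of energy: the force paired with the velocity cancels against its negative. -/
theorem hasDerivWithinAt_modelHamiltonian {z : ℝ → E} {P : ℝ → E →L[ℝ] ℝ} {t : ℝ} {s : Set ℝ}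
    (hk : DifferentiableAt ℝ k (z t)) (hs : ∀ P Q : E →L[ℝ] ℝ, P (k (z t) Q) = Q (k (z t) P))
    (hz : HasDerivWithinAt z (modelVelocity ν e k (z t) (P t)) s t)
    (hP : HasDerivWithinAt P (-modelForce ν e k (z t) (P t)) s t) :
    HasDerivWithinAt (fun t => modelHamiltonian ν e k (z t, P t)) 0 s t := by
  have h1 := (hasFDerivAt_modelHamiltonian (ν := ν) (e := e) (P := P t) hk hs).comp_hasDerivWithinAt t
    (hz.prodMk hP)
  refine h1.congr_deriv ?_
  simp

/-- The vector field of the equations of motion in the variables `X = x / ε`, `y`, `ξ`, `θ = ε η` and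
`T = t / ε`, which is smooth up to `ε = 0`. -/
noncomputable def rescaledField (ν : E →L[ℝ] ℝ) (e : E) (k : E → (E →L[ℝ] ℝ) →L[ℝ] E)
    (p : ℝ × E × (E →L[ℝ] ℝ)) : ℝ × E × (E →L[ℝ] ℝ) :=
  (0, diag ν e 1 (p.1 ^ 2) (diag ν e (1 / 2) (ν p.2.1)
      (k (diag ν e p.1 1 p.2.1) (scaledCovector ν e (ν p.2.1) p.2.2))),
    -(((1 / 2 : ℝ) • (scaledCovector ν e (ν p.2.1) p.2.2).comp
      ((ContinuousLinearMap.apply ℝ E (scaledCovector ν e (ν p.2.1) p.2.2)).comp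
        ((fderiv ℝ k (diag ν e p.1 1 p.2.1)).comp (diag ν e p.1 1))) +
      p.2.2 (tangentialProj ν e (k (diag ν e p.1 1 p.2.1)
        (scaledCovector ν e (ν p.2.1) p.2.2))) • ν).comp (diag ν e 1 (p.1 ^ 2))))

/-- No negative power of `ε` is left in the rescaled equations. This is what allows a perturbation
argument from `ε = 0`, on both sides of the boundary. -/
theorem contDiffOn_rescaledField {B : Set E} (hB : IsOpen B) (hk : ContDiffOn ℝ ∞ k B) :
    ContDiffOn ℝ ∞ (rescaledField ν e k) {p | diag ν e p.1 1 p.2.1 ∈ B} := by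
  have hd1 : ContDiff ℝ ∞ (fun p : ℝ × E × (E →L[ℝ] ℝ) => diag ν e p.1 1) :=
    (contDiff_diag ν e).comp (contDiff_fst.prodMk contDiff_const)
  have hd2 : ContDiff ℝ ∞ (fun p : ℝ × E × (E →L[ℝ] ℝ) => diag ν e 1 (p.1 ^ 2)) :=
    (contDiff_diag ν e).comp (contDiff_const.prodMk (contDiff_fst.pow 2))
  have hν : ContDiff ℝ ∞ (fun p : ℝ × E × (E →L[ℝ] ℝ) => ν p.2.1) := by fun_prop
  have hd3 : ContDiff ℝ ∞ (fun p : ℝ × E × (E →L[ℝ] ℝ) => diag ν e (1 / 2) (ν p.2.1)) :=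
    (contDiff_diag ν e).comp (contDiff_const.prodMk hν)
  have hP : ContDiff ℝ ∞ (fun p : ℝ × E × (E →L[ℝ] ℝ) => p.2.2) := by fun_prop
  have hR : ContDiff ℝ ∞ (fun p : ℝ × E × (E →L[ℝ] ℝ) => scaledCovector ν e (ν p.2.1) p.2.2) :=
    hP.clm_comp hd3
  have hz : ContDiff ℝ ∞ (fun p : ℝ × E × (E →L[ℝ] ℝ) => diag ν e p.1 1 p.2.1) :=
    hd1.clm_apply (by fun_prop)
  have hkz : ContDiffOn ℝ ∞ (fun p : ℝ × E × (E →L[ℝ] ℝ) => k (diag ν e p.1 1 p.2.1))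
      {p | diag ν e p.1 1 p.2.1 ∈ B} := hk.comp hz.contDiffOn (fun p hp => hp)
  have hk'z : ContDiffOn ℝ ∞ (fun p : ℝ × E × (E →L[ℝ] ℝ) => fderiv ℝ k (diag ν e p.1 1 p.2.1))
      {p | diag ν e p.1 1 p.2.1 ∈ B} :=
    (hk.fderiv_of_isOpen hB (m := ∞) (by simp)).comp hz.contDiffOn (fun p hp => hp)
  have hkR := hkz.clm_apply hR.contDiffOn
  refine contDiffOn_const.prodMk (ContDiffOn.prodMk
    (hd2.contDiffOn.clm_apply (hd3.contDiffOn.clm_apply hkR)) (ContDiffOn.neg ?_))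
  refine ContDiffOn.clm_comp (ContDiffOn.add ?_ ?_) hd2.contDiffOn
  · refine ContDiffOn.const_smul _ (hR.contDiffOn.clm_comp (ContDiffOn.clm_comp ?_
      (hk'z.clm_comp hd1.contDiffOn)))
    exact ((ContinuousLinearMap.apply ℝ E).contDiff.comp hR).contDiffOn
  · exact (hP.contDiffOn.clm_apply ((tangentialProj ν e).contDiff.comp_contDiffOn hkR)).smul
      contDiffOn_const

end Model

/-! ### First return to zero under a perturbation. -/

/-- A perturbation of a function that starts at zero with positive slope and ends negative has a
first zero, bounded away from the start. -/
theorem exists_first_zero {X X' : ℝ × ℝ → ℝ} {r T : ℝ} (hr : 0 < r) (hT : 0 < T)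
    (hX : ContinuousOn X (Icc 0 r ×ˢ Icc 0 T)) (hX' : ContinuousOn X' (Icc 0 r ×ˢ Icc 0 T))
    (hd : ∀ ε ∈ Icc 0 r, ∀ t ∈ Icc 0 T,
      HasDerivWithinAt (fun s => X (ε, s)) (X' (ε, t)) (Icc 0 T) t)
    (h0 : ∀ ε ∈ Icc 0 r, X (ε, 0) = 0) (h1 : 0 < X' (0, 0)) (h2 : X (0, T) < 0) :
    ∃ δ ε₀, 0 < δ ∧ 0 < ε₀ ∧ ε₀ ≤ r ∧ ∀ ε ∈ Icc 0 ε₀, ∃ τ ∈ Icc δ T, X (ε, τ) = 0 ∧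
      ∀ t ∈ Ioo 0 τ, 0 < X (ε, t) := by
  have hr0 : (0 : ℝ) ∈ Icc 0 r := ⟨le_rfl, hr.le⟩
  have e1 : ∀ᶠ p in 𝓝[Icc 0 r ×ˢ Icc 0 T] ((0, 0) : ℝ × ℝ), 0 < X' p :=
    (hX' (0, 0) ⟨hr0, le_rfl, hT.le⟩).eventually (lt_mem_nhds h1)
  have e2 : ∀ᶠ p in 𝓝[Icc 0 r ×ˢ Icc 0 T] ((0, T) : ℝ × ℝ), X p < 0 :=
    (hX (0, T) ⟨hr0, hT.le, le_rfl⟩).eventually (gt_mem_nhds h2)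
  obtain ⟨η₁, hη₁, H1⟩ := Metric.mem_nhdsWithin_iff.1 e1
  obtain ⟨η₂, hη₂, H2⟩ := Metric.mem_nhdsWithin_iff.1 e2
  set δ := min (η₁ / 2) T with hδ
  have hδ0 : 0 < δ := lt_min (by linarith) hT
  have hδη : δ < η₁ := lt_of_le_of_lt (min_le_left _ _) (by linarith)
  have hδT : δ ≤ T := min_le_right _ _
  set ε₀ := min (min (η₁ / 2) (η₂ / 2)) r with hε₀
  have hε₀0 : 0 < ε₀ := lt_min (lt_min (by linarith) (by linarith)) hr
  have hε₀1 : ε₀ < η₁ :=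
    lt_of_le_of_lt ((min_le_left _ _).trans (min_le_left _ _)) (by linarith)
  have hε₀2 : ε₀ < η₂ :=
    lt_of_le_of_lt ((min_le_left _ _).trans (min_le_right _ _)) (by linarith)
  refine ⟨δ, ε₀, hδ0, hε₀0, min_le_right _ _, fun ε hε => ?_⟩
  have hεr : ε ∈ Icc 0 r := ⟨hε.1, hε.2.trans (min_le_right _ _)⟩
  have hXc : ContinuousOn (fun t => X (ε, t)) (Icc 0 T) :=
    hX.comp (by fun_prop) (fun t ht => ⟨hεr, ht⟩)
  -- The derivative is positive near `(0, 0)`, so one `δ` works for all small `ε`. This keeps the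
  -- zeros found below away from the trivial one at `t = 0`.
  have hmono : StrictMonoOn (fun t => X (ε, t)) (Icc 0 δ) := by
    refine strictMonoOn_of_deriv_pos (convex_Icc 0 δ)
      (hXc.mono (Icc_subset_Icc_right hδT)) fun t ht => ?_
    rw [interior_Icc] at ht
    have htT : t ∈ Icc 0 T := ⟨ht.1.le, ht.2.le.trans hδT⟩
    rw [((hd ε hεr t htT).hasDerivAt (Icc_mem_nhds ht.1 (ht.2.trans_le hδT))).deriv]
    refine H1 ⟨?_, hεr, htT⟩
    rw [Metric.mem_ball, Prod.dist_eq, Real.dist_eq, Real.dist_eq, sub_zero, sub_zero,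
      abs_of_nonneg hε.1, abs_of_pos ht.1]
    exact max_lt (hε.2.trans_lt hε₀1) (ht.2.trans hδη)
  have hpos : ∀ t ∈ Ioc 0 δ, 0 < X (ε, t) := by
    intro t ht
    have := hmono ⟨le_rfl, hδ0.le⟩ ⟨ht.1.le, ht.2⟩ ht.1
    simpa [h0 ε hεr] using this
  have hneg : X (ε, T) < 0 := by
    refine H2 ⟨?_, hεr, hT.le, le_rfl⟩
    rw [Metric.mem_ball, Prod.dist_eq, Real.dist_eq, Real.dist_eq, sub_zero, sub_self, abs_zero,
      abs_of_nonneg hε.1]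
    exact max_lt (hε.2.trans_lt hε₀2) hη₂
  -- The first zero is the least time after `δ` at which the function is not positive; such times
  -- exist because the value at `T` is negative.
  set S := Icc δ T ∩ (fun t => X (ε, t)) ⁻¹' Iic 0 with hS
  have hSc : IsCompact S := by
    have hcl : IsClosed S := (hXc.mono (Icc_subset_Icc_left hδ0.le)).preimage_isClosed_of_isClosed
      isClosed_Icc isClosed_Iic
    exact isCompact_Icc.of_isClosed_subset hcl inter_subset_left
  have hSne : S.Nonempty := ⟨T, ⟨hδT, le_rfl⟩, hneg.le⟩
  have hτ : sInf S ∈ S := hSc.sInf_mem hSne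
  set τ := sInf S
  have hτpos : ∀ t ∈ Ioo 0 τ, 0 < X (ε, t) := by
    intro t ht
    rcases le_or_gt t δ with h | h
    · exact hpos t ⟨ht.1, h⟩
    · by_contra hcon
      have : t ∈ S := ⟨⟨h.le, ht.2.le.trans hτ.1.2⟩, not_lt.1 hcon⟩
      exact absurd (csInf_le hSc.bddBelow this) (not_le.2 ht.2)
  refine ⟨τ, hτ.1, le_antisymm hτ.2 ?_, hτpos⟩
  have hτ0 : 0 < τ := hδ0.trans_le hτ.1.1
  have hcl : τ ∈ closure (Ioo 0 τ) := by
    rw [closure_Ioo hτ0.ne]; exact ⟨hτ0.le, le_rfl⟩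
  have hcw : ContinuousWithinAt (fun t => X (ε, t)) (Ioo 0 τ) τ :=
    (hXc τ ⟨hτ0.le, hτ.1.2⟩).mono fun t ht => ⟨ht.1.le, ht.2.le.trans hτ.1.2⟩
  have : (𝓝[Ioo 0 τ] τ).NeBot := mem_closure_iff_nhdsWithin_neBot.1 hcl
  exact ge_of_tendsto hcw (eventually_nhdsWithin_of_forall fun t ht => (hτpos t ht).le)

/-! ### Undoing the rescaling. -/

section Model

variable {E : Type} [NormedAddCommGroup E] [NormedSpace ℝ E] {ν : E →L[ℝ] ℝ} {e : E}

attribute [local instance] dualMetricAddCommGroup dualMetricGroup dualMetricSpace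
  dualMetricDerivGroup dualMetricDerivSpace

variable {k : E → (E →L[ℝ] ℝ) →L[ℝ] E}

/-- The product `x η` is unchanged when `x` is multiplied and `η` divided by `ε`. Hence the energy
does not see the rescaling. -/
theorem scaledCovector_comp_diag (he : ν e = 1) {ε : ℝ} (hε : ε ≠ 0) (x : ℝ) (P : E →L[ℝ] ℝ) :
    scaledCovector ν e (ε * x) (P.comp (diag ν e 1 ε⁻¹)) = scaledCovector ν e x P := by
  ext v
  simp only [scaledCovector, ContinuousLinearMap.comp_apply, diag_diag he]
  rw [one_mul, inv_mul_cancel_left₀ hε]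

/-- Together with `modelForce_rescale`, this is the chain rule for `x = ε X`, `η = θ / ε`, `t = ε
T`; the factor `ε⁻¹` comes from the change of time. -/
theorem modelVelocity_rescale (he : ν e = 1) {ε : ℝ} (hε : ε ≠ 0) (Z : E) (P : E →L[ℝ] ℝ) :
    modelVelocity ν e k (diag ν e ε 1 Z) (P.comp (diag ν e 1 ε⁻¹)) =
      diag ν e ε 1 (ε⁻¹ • (rescaledField ν e k (ε, Z, P)).2.1) := by
  simp only [modelVelocity, rescaledField, apply_diag he, scaledCovector_comp_diag he hε]
  rw [map_smul, diag_diag he, diag_diag he, ← diag_same ν e, diag_diag he]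
  congr 2 <;> field_simp

theorem modelForce_rescale (he : ν e = 1) {ε : ℝ} (hε : ε ≠ 0) (Z : E) (P : E →L[ℝ] ℝ) :
    -modelForce ν e k (diag ν e ε 1 Z) (P.comp (diag ν e 1 ε⁻¹)) =
      (ε⁻¹ • (rescaledField ν e k (ε, Z, P)).2.2).comp (diag ν e 1 ε⁻¹) := by
  ext v
  -- The three rescalings around the derivative of `k` combine to the scalar `ε`, equally in normal
  -- and tangential directions.
  have h1 : diag ν e ε 1 (diag ν e 1 (ε ^ 2) (diag ν e 1 ε⁻¹ v)) = ε • v := by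
    rw [diag_diag he, diag_diag he, ← diag_same ν e]
    congr 1
    congr 1 <;> field_simp
  have h3 : ∀ u : E, diag ν e 1 ε⁻¹ (tangentialProj ν e u) = ε⁻¹ • tangentialProj ν e u := by
    intro u
    rw [diag_apply, apply_tangentialProj he, tangentialProj_apply ν e (tangentialProj ν e u),
      apply_tangentialProj he]
    simp
  simp only [modelForce, rescaledField, apply_diag he, scaledCovector_comp_diag he hε,
    ContinuousLinearMap.comp_apply, neg_apply, add_apply,
    smul_apply, ContinuousLinearMap.apply_apply, h1, h3, map_smul, smul_eq_mul]
  field_simp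

theorem modelHamiltonian_rescale (he : ν e = 1) {ε : ℝ} (hε : ε ≠ 0) (Z : E) (P : E →L[ℝ] ℝ) :
    modelHamiltonian ν e k (diag ν e ε 1 Z, P.comp (diag ν e 1 ε⁻¹)) =
      1 / 2 * scaledCovector ν e (ν Z) P (k (diag ν e ε 1 Z) (scaledCovector ν e (ν Z) P)) := by
  simp only [modelHamiltonian, apply_diag he, scaledCovector_comp_diag he hε]

/-- An integral curve of the rescaled vector field gives a trajectory. -/
theorem isModelTrajectory_of_rescaled (he : ν e = 1) {B : Set E} (hB : IsOpen B)
    (hk : ContDiffOn ℝ ∞ k B)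
    (hs : ∀ z ∈ B, ∀ P Q : E →L[ℝ] ℝ, P (k z Q) = Q (k z P)) {ε τ : ℝ} (hε : 0 < ε) (hτ : 0 < τ)
    {Z : ℝ → E} {P : ℝ → E →L[ℝ] ℝ}
    (hd : ∀ t ∈ Icc 0 τ, HasDerivWithinAt Z (rescaledField ν e k (ε, Z t, P t)).2.1 (Icc 0 τ) t ∧
      HasDerivWithinAt P (rescaledField ν e k (ε, Z t, P t)).2.2 (Icc 0 τ) t)
    (hmem : ∀ t ∈ Icc 0 τ, diag ν e ε 1 (Z t) ∈ B) (h0 : ν (Z 0) = 0) (h1 : ν (Z τ) = 0)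
    (hpos : ∀ t ∈ Ioo 0 τ, 0 < ν (Z t))
    (hH : scaledCovector ν e 0 (P 0) (k (diag ν e ε 1 (Z 0)) (scaledCovector ν e 0 (P 0))) = 1) :
    IsModelTrajectory ν e k B (ε * τ) (fun t => diag ν e ε 1 (Z (t / ε)))
      (fun t => (P (t / ε)).comp (diag ν e 1 ε⁻¹)) := by
  have hmaps : MapsTo (fun t => t / ε) (Icc 0 (ε * τ)) (Icc 0 τ) := fun t ht =>
    ⟨div_nonneg ht.1 hε.le, (div_le_iff₀' hε).2 ht.2⟩
  have hmaps' : ∀ t ∈ Ioo 0 (ε * τ), t / ε ∈ Ioo 0 τ := fun t ht =>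
    ⟨div_pos ht.1 hε, (div_lt_iff₀' hε).2 ht.2⟩
  have hlin : ∀ t, HasDerivWithinAt (fun t => t / ε) ε⁻¹ (Icc 0 (ε * τ)) t := fun t => by
    simpa [div_eq_mul_inv] using ((hasDerivAt_id t).mul_const ε⁻¹).hasDerivWithinAt
  have hdz : ∀ t ∈ Icc 0 (ε * τ), HasDerivWithinAt (fun t => diag ν e ε 1 (Z (t / ε)))
      (modelVelocity ν e k (diag ν e ε 1 (Z (t / ε))) ((P (t / ε)).comp (diag ν e 1 ε⁻¹)))
      (Icc 0 (ε * τ)) t := by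
    intro t ht
    rw [modelVelocity_rescale he hε.ne']
    exact (diag ν e ε 1).hasFDerivAt.comp_hasDerivWithinAt t
      ((hd _ (hmaps ht)).1.scomp t (hlin t) hmaps)
  have hdP : ∀ t ∈ Icc 0 (ε * τ), HasDerivWithinAt (fun t => (P (t / ε)).comp (diag ν e 1 ε⁻¹))
      (-modelForce ν e k (diag ν e ε 1 (Z (t / ε))) ((P (t / ε)).comp (diag ν e 1 ε⁻¹)))
      (Icc 0 (ε * τ)) t := by
    intro t ht
    rw [modelForce_rescale he hε.ne']
    have h1 := HasDerivWithinAt.scomp (g₁ := P) t (hd _ (hmaps ht)).2 (hlin t) hmaps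
    exact ((ContinuousLinearMap.compL ℝ E E ℝ).flip (diag ν e 1 ε⁻¹)).hasFDerivAt.comp_hasDerivWithinAt
      t h1
  have hετ : 0 < ε * τ := mul_pos hε hτ
  -- The energy is constant on the closed time interval, so it may be evaluated at the boundary
  -- point where the motion starts.
  have hE : ∀ t ∈ Icc 0 (ε * τ), modelHamiltonian ν e k
      (diag ν e ε 1 (Z (t / ε)), (P (t / ε)).comp (diag ν e 1 ε⁻¹)) = 1 / 2 := by
    intro t ht
    have hder : ∀ t ∈ Icc 0 (ε * τ), HasDerivWithinAt (fun t => modelHamiltonian ν e k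
        (diag ν e ε 1 (Z (t / ε)), (P (t / ε)).comp (diag ν e 1 ε⁻¹))) 0 (Icc 0 (ε * τ)) t := by
      intro t ht
      have hm := hmem _ (hmaps ht)
      exact hasDerivWithinAt_modelHamiltonian
        ((hk.contDiffAt (hB.mem_nhds hm)).differentiableAt (by simp)) (hs _ hm) (hdz t ht) (hdP t ht)
    rw [constant_of_has_deriv_right_zero (fun t ht => (hder t ht).continuousWithinAt)
      (fun t ht => (hder t ⟨ht.1, ht.2.le⟩).mono_of_mem_nhdsWithin (Icc_mem_nhdsGE_of_mem ht)) t ht]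
    rw [modelHamiltonian_rescale he hε.ne', zero_div, h0, hH, mul_one]
  refine ⟨hετ, fun t ht => (hdz t ht).continuousWithinAt, fun t ht => (hdP t ht).continuousWithinAt,
    fun t ht => hmem _ (hmaps ht), ?_, ?_, fun t ht => ?_, fun t ht => hE t (Ioo_subset_Icc_self ht),
    fun t ht => (hdz t (Ioo_subset_Icc_self ht)).hasDerivAt (Icc_mem_nhds ht.1 ht.2),
    fun t ht => (hdP t (Ioo_subset_Icc_self ht)).hasDerivAt (Icc_mem_nhds ht.1 ht.2)⟩
  · rw [zero_div, apply_diag he, h0, mul_zero]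
  · rw [mul_div_cancel_left₀ _ hε.ne', apply_diag he, h1, mul_zero]
  · rw [apply_diag he]
    exact mul_pos hε (hpos _ (hmaps' t ht))

end Model

/-! ### The oscillator limit: short trajectories detect tangential forms at the boundary. -/

section Model

variable {E : Type} [NormedAddCommGroup E] [NormedSpace ℝ E] {ν : E →L[ℝ] ℝ} {e : E}

attribute [local instance] dualMetricAddCommGroup dualMetricGroup dualMetricSpace
  dualMetricDerivGroup dualMetricDerivSpace

variable {k : E → (E →L[ℝ] ℝ) →L[ℝ] E}

/-- Splits a covector into its normal part `ξ ν` and a tangential part `θ`; on these the scaling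
acts by `1 / 2` and `x`. -/
theorem scaledCovector_smul_add {θ : E →L[ℝ] ℝ} (he : ν e = 1) (hθ : θ e = 0) (x ξ : ℝ) :
    scaledCovector ν e x (ξ • ν + θ) = (ξ / 2) • ν + x • θ := by
  ext v
  simp only [scaledCovector, ContinuousLinearMap.comp_apply, add_apply, smul_apply, apply_diag he,
    smul_eq_mul]
  simp only [diag_apply, map_add, map_smul, hθ, tangentialProj_apply, map_sub, smul_eq_mul]
  ring

/-- The rescaled vector field at `ε = 0` is that of a harmonic oscillator. -/
theorem rescaledField_zero {z₁ : E} {θ : E →L[ℝ] ℝ} (he : ν e = 1) (hz₁ : ν z₁ = 0) (hθ : θ e = 0)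
    (hs : ∀ P Q : E →L[ℝ] ℝ, P (k z₁ Q) = Q (k z₁ P)) (x ξ : ℝ) :
    rescaledField ν e k (0, z₁ + x • e, ξ • ν + θ) =
      (0, (ν (k z₁ ν) / 4 * ξ + θ (k z₁ ν) / 2 * x) • e,
        -(θ (k z₁ ν) / 2 * ξ + θ (k z₁ θ) * x) • ν) := by
  have h1 : diag ν e 0 1 (z₁ + x • e) = z₁ := by
    simp [diag_apply, tangentialProj_apply, he, hz₁]
  have h2 : ν (z₁ + x • e) = x := by simp [hz₁, he]
  have h3 : diag ν e 0 1 e = 0 := by simp [diag_apply, tangentialProj_self he]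
  have h4 : ∀ v, diag ν e 1 (0 ^ 2) v = ν v • e := by
    intro v; simp [diag_apply]
  simp only [rescaledField, h1, h2, scaledCovector_smul_add he hθ]
  refine Prod.ext rfl (Prod.ext ?_ ?_)
  · simp only [h4, apply_diag he, map_add, map_smul, smul_eq_mul, hs ν θ]
    congr 1; ring
  · ext v
    simp only [neg_apply, ContinuousLinearMap.comp_apply, add_apply, smul_apply, h3, h4, map_zero,
      tangentialProj_apply, map_sub, map_add, map_smul, smul_eq_mul,
      he, hθ]
    simp
    ring

/-- The integral that arises in the limit `ε → 0` is positive. -/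
theorem oscillator_integral_pos {κ b : ℝ} (hκ : 0 < κ) (m : ℕ) :
    0 < ∫ t in (0 : ℝ)..(Real.pi / κ),
      Real.sin (κ * t) ^ (m + 1) * (b * Real.cos (κ * t) + κ * Real.sin (κ * t)) := by
  have hsplit : ∀ t, Real.sin (κ * t) ^ (m + 1) * (b * Real.cos (κ * t) + κ * Real.sin (κ * t)) =
      b * (Real.sin (κ * t) ^ (m + 1) * Real.cos (κ * t)) + κ * Real.sin (κ * t) ^ (m + 2) :=
    fun t => by ring
  simp only [hsplit]
  rw [intervalIntegral.integral_add (by apply Continuous.intervalIntegrable; fun_prop)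
    (by apply Continuous.intervalIntegrable; fun_prop)]
  have h1 : ∫ t in (0 : ℝ)..(Real.pi / κ), b * (Real.sin (κ * t) ^ (m + 1) * Real.cos (κ * t)) = 0 := by
    have hd : ∀ t ∈ uIcc 0 (Real.pi / κ), HasDerivAt
        (fun t => b / (κ * (m + 2)) * Real.sin (κ * t) ^ (m + 2))
        (b * (Real.sin (κ * t) ^ (m + 1) * Real.cos (κ * t))) t := by
      intro t _
      have h := (((Real.hasDerivAt_sin (κ * t)).comp t ((hasDerivAt_id t).const_mul κ)).pow
        (m + 2)).const_mul (b / (κ * (m + 2)))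
      refine h.congr_deriv ?_
      have : (m : ℝ) + 2 ≠ 0 := by positivity
      simp
      field_simp
    rw [intervalIntegral.integral_eq_sub_of_hasDerivAt hd
      (by apply Continuous.intervalIntegrable; fun_prop), mul_div_cancel₀ _ hκ.ne']
    simp
  rw [h1, zero_add]
  refine intervalIntegral.intervalIntegral_pos_of_pos_on
    (by apply Continuous.intervalIntegrable; fun_prop) (fun t ht => ?_) (by positivity)
  have : 0 < Real.sin (κ * t) := Real.sin_pos_of_pos_of_lt_pi (mul_pos hκ ht.1)
    (by rw [mul_comm]; exact (lt_div_iff₀ hκ).1 ht.2)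
  positivity

variable [FiniteDimensional ℝ E]

/-- If the integrals of the tangential form `x ^ m w` along all short trajectories vanish, then `w`
vanishes tangentially on the boundary. -/
theorem tangential_eq_zero_of_integral_eq_zero (he : ν e = 1) {B : Set E} (hB : IsOpen B)
    (hBr : ∀ z ∈ B, z + (|ν z| - ν z) • e ∈ B)
    (hk : ContDiffOn ℝ ∞ k B) (hs : ∀ z ∈ B, ∀ P Q : E →L[ℝ] ℝ, P (k z Q) = Q (k z P))
    {z₁ : E} (hz₁B : z₁ ∈ B) (hz₁ : ν z₁ = 0)
    (hp : ∀ P : E →L[ℝ] ℝ, P ≠ 0 → 0 < P (k z₁ P))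
    {w : E → E →L[ℝ] ℝ} (hw : ContinuousOn w (B ∩ {z | 0 ≤ ν z})) (m : ℕ)
    (hI : ∀ τ z P, IsModelTrajectory ν e k B τ z P → ∫ t in (0 : ℝ)..τ,
      ν (z t) ^ m * w (z t) (tangentialProj ν e (modelVelocity ν e k (z t) (P t))) = 0) :
    (w z₁).comp (tangentialProj ν e) = 0 := by
  by_contra hne
  -- The tested form itself serves as tangential momentum, so the limit integrand pairs `θ` with the
  -- velocity that it induces.
  set θ : E →L[ℝ] ℝ := (w z₁).comp (tangentialProj ν e) with hθdef
  have hθ : θ e = 0 := by simp [hθdef, tangentialProj_self he]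
  have hs₁ := hs z₁ hz₁B
  set a : ℝ := ν (k z₁ ν) / 4 with ha
  set b : ℝ := θ (k z₁ ν) / 2 with hb
  set c : ℝ := θ (k z₁ θ) with hc
  have hν0 : ν ≠ 0 := fun h => by simp [h] at he
  have ha0 : 0 < a := by have := hp ν hν0; positivity
  -- Strict Cauchy–Schwarz for `k z₁`. Completing the square, `(a c - b²) / a` is the value of the
  -- quadratic form on `θ - (b / 2a) ν`. If this covector vanished, evaluation on `e` would give `b
  -- = 0` and then `θ = 0`.
  have hdisc : 0 < a * c - b ^ 2 := by
    have hψ : θ - (b / (2 * a)) • ν ≠ 0 := by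
      intro h
      have h1 : (θ - (b / (2 * a)) • ν) e = 0 := by rw [h]; rfl
      simp only [sub_apply, smul_apply, hθ, he, smul_eq_mul, mul_one, zero_sub, neg_eq_zero] at h1
      rw [h1, zero_smul, sub_zero] at h
      exact hne h
    have h1 := hp _ hψ
    simp only [map_sub, map_smul, sub_apply, smul_apply, smul_eq_mul] at h1
    rw [hs₁ ν θ, ← hc, show θ (k z₁ ν) = 2 * b by rw [hb]; ring,
      show ν (k z₁ ν) = 4 * a by rw [ha]; ring] at h1
    have h2 : c - b / (2 * a) * (2 * b) - b / (2 * a) * (2 * b - b / (2 * a) * (4 * a)) =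
      (a * c - b ^ 2) / a := by field_simp; ring
    rw [h2] at h1
    exact (div_pos_iff_of_pos_right ha0).1 h1
  set κ : ℝ := √(a * c - b ^ 2) with hκ
  have hκ0 : 0 < κ := Real.sqrt_pos.2 hdisc
  have hκ2 : κ ^ 2 = a * c - b ^ 2 := Real.sq_sqrt hdisc.le
  -- At `x = 0` the energy is `a ξ² / 2`, so unit speed means `a ξ₀² = 1`; the positive root points
  -- into the manifold.
  set ξ₀ : ℝ := (√a)⁻¹ with hξ₀
  have hξ0 : 0 < ξ₀ := by positivity
  have hξ2 : a * ξ₀ ^ 2 = 1 := by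
    rw [hξ₀, inv_pow, Real.sq_sqrt ha0.le, mul_inv_cancel₀ ha0.ne']
  -- Three quarters of a period: the limiting `X` has already crossed zero at `π / κ` and is
  -- negative at `T`.
  set T : ℝ := 3 / 2 * Real.pi / κ with hTdef
  have hT : 0 < T := by positivity
  -- the limiting trajectory
  let xs : ℝ → ℝ := fun t => a * ξ₀ / κ * Real.sin (κ * t)
  let ξs : ℝ → ℝ := fun t => ξ₀ * Real.cos (κ * t) - ξ₀ * b / κ * Real.sin (κ * t)
  have hsin : ∀ t, HasDerivAt (fun t => Real.sin (κ * t)) (κ * Real.cos (κ * t)) t := fun t => by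
    have := (Real.hasDerivAt_sin (κ * t)).comp t ((hasDerivAt_id t).const_mul κ)
    refine this.congr_deriv ?_
    simp [mul_comm]
  have hcos : ∀ t, HasDerivAt (fun t => Real.cos (κ * t)) (-(κ * Real.sin (κ * t))) t := fun t => by
    have := (Real.hasDerivAt_cos (κ * t)).comp t ((hasDerivAt_id t).const_mul κ)
    refine this.congr_deriv ?_
    simp [mul_comm]
  have hxs : ∀ t, HasDerivAt xs (a * ξs t + b * xs t) t := fun t => by
    refine ((hsin t).const_mul (a * ξ₀ / κ)).congr_deriv ?_
    simp only [xs, ξs]; field_simp; ring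
  have hξs : ∀ t, HasDerivAt ξs (-(b * ξs t + c * xs t)) t := fun t => by
    refine (((hcos t).const_mul ξ₀).sub ((hsin t).const_mul (ξ₀ * b / κ))).congr_deriv ?_
    simp only [xs, ξs]
    field_simp
    linear_combination (-Real.sin (κ * t)) * hκ2
  let c₀ : ℝ → ℝ × E × (E →L[ℝ] ℝ) := fun t => (0, z₁ + xs t • e, ξs t • ν + θ)
  have hfield : ∀ t, rescaledField ν e k (c₀ t) =
      (0, (a * ξs t + b * xs t) • e, -(b * ξs t + c * xs t) • ν) := fun t =>
    rescaledField_zero he hz₁ hθ hs₁ _ _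
  have hc₀ : ∀ t ∈ Icc 0 T, HasDerivWithinAt c₀ (rescaledField ν e k (c₀ t)) (Icc 0 T) t := by
    intro t _
    rw [hfield]
    exact ((hasDerivAt_const t (0 : ℝ)).prodMk
      (((hxs t).smul_const e |>.const_add z₁).prodMk
        ((hξs t).smul_const ν |>.add_const θ))).hasDerivWithinAt
  have hdz : Continuous (fun p : ℝ × E × (E →L[ℝ] ℝ) => diag ν e p.1 1 p.2.1) :=
    (((contDiff_diag ν e).continuous.comp (continuous_fst.prodMk continuous_const)).clm_apply
      (by fun_prop))
  have hc₀z : ∀ t, diag ν e (c₀ t).1 1 (c₀ t).2.1 = z₁ := fun t => by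
    simp [c₀, diag_apply, tangentialProj_apply, he, hz₁]
  obtain ⟨α, r, hr, hα, hαc, hαeq⟩ := exists_flow_near_integralCurve (hB.preimage hdz)
    (contDiffOn_rescaledField (ν := ν) (e := e) hB hk) hT.le hc₀
    (fun t _ => by rw [mem_preimage, hc₀z]; exact hz₁B)
  have hc₀0 : c₀ 0 = (0, z₁, ξ₀ • ν + θ) := by simp [c₀, xs, ξs]
  -- In rescaled variables only the component `ε` of the initial point varies. Continuity of the
  -- flow in its initial point therefore contains continuity in `ε`.
  let pt : ℝ → ℝ × E × (E →L[ℝ] ℝ) := fun ε => (ε, z₁, ξ₀ • ν + θ)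
  have hpt : ∀ ε ∈ Icc 0 r, pt ε ∈ Metric.closedBall (c₀ 0) r := by
    intro ε hε
    rw [hc₀0, Metric.mem_closedBall, Prod.dist_eq]
    simp [pt, abs_of_nonneg hε.1, hε.2, hr.le]
  have hptc : Continuous pt := by fun_prop
  have hmono : ∀ {t : ℝ}, t ∈ Ico 0 T → Icc 0 T ∈ 𝓝[≥] t := fun ht => Icc_mem_nhdsGE_of_mem ht
  let Φ : ℝ × ℝ → ℝ × E × (E →L[ℝ] ℝ) := fun p => α (pt p.1, p.2)
  have hΦc : ContinuousOn Φ (Icc 0 r ×ˢ Icc 0 T) :=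
    hαc.comp (by fun_prop) (fun p hp => ⟨hpt _ hp.1, hp.2⟩)
  have hΦd : ∀ ε ∈ Icc 0 r, ∀ t ∈ Icc 0 T, HasDerivWithinAt (fun s => Φ (ε, s))
      (rescaledField ν e k (Φ (ε, t))) (Icc 0 T) t := fun ε hε t ht =>
    ((hα _ (hpt ε hε)).2 t ht).2
  -- The first component of the rescaled field is zero, so `ε` stays constant along the flow.
  have hΦ1 : ∀ ε ∈ Icc 0 r, ∀ t ∈ Icc 0 T, (Φ (ε, t)).1 = ε := by
    intro ε hε t ht
    have h1 : ∀ t ∈ Icc 0 T, HasDerivWithinAt (fun s => (Φ (ε, s)).1) 0 (Icc 0 T) t := fun t ht =>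
      (ContinuousLinearMap.fst ℝ ℝ (E × (E →L[ℝ] ℝ))).hasFDerivAt.comp_hasDerivWithinAt t
        (hΦd ε hε t ht)
    rw [constant_of_has_deriv_right_zero (fun t ht => (h1 t ht).continuousWithinAt)
      (fun t ht => (h1 t ⟨ht.1, ht.2.le⟩).mono_of_mem_nhdsWithin (hmono ht)) t ht]
    have := (hα _ (hpt ε hε)).1
    simp only [Φ, this, pt]
  have hΦB : ∀ ε ∈ Icc 0 r, ∀ t ∈ Icc 0 T, diag ν e (Φ (ε, t)).1 1 (Φ (ε, t)).2.1 ∈ B :=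
    fun ε hε t ht => ((hα _ (hpt ε hε)).2 t ht).1
  have hΦeq : ∀ t ∈ Icc 0 T, Φ (0, t) = c₀ t := fun t ht => by
    rw [← hαeq t ht, hc₀0]
  have hΦ0 : ∀ ε ∈ Icc 0 r, Φ (ε, 0) = (ε, z₁, ξ₀ • ν + θ) := fun ε hε => (hα _ (hpt ε hε)).1
  have hVc : ContinuousOn (fun p => rescaledField ν e k (Φ p)) (Icc 0 r ×ˢ Icc 0 T) :=
    (contDiffOn_rescaledField (ν := ν) (e := e) hB hk).continuousOn.comp hΦc
      (fun p hp => hΦB p.1 hp.1 p.2 hp.2)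
  have h0r : (0 : ℝ) ∈ Icc 0 r := ⟨le_rfl, hr.le⟩
  have h0T : (0 : ℝ) ∈ Icc 0 T := ⟨le_rfl, hT.le⟩
  have hTT : T ∈ Icc 0 T := ⟨hT.le, le_rfl⟩
  have hκT : κ * T = 3 / 2 * Real.pi := by rw [hTdef]; field_simp
  have hνc₀ : ∀ t, ν (c₀ t).2.1 = xs t := fun t => by simp [c₀, hz₁, he]
  obtain ⟨δ, ε₀, hδ, hε₀, hε₀r, hexit⟩ := exists_first_zero
    (X := fun p => ν (Φ p).2.1) (X' := fun p => ν (rescaledField ν e k (Φ p)).2.1) hr hT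
    (ν.continuous.comp_continuousOn hΦc.snd.fst) (ν.continuous.comp_continuousOn hVc.snd.fst)
    (fun ε hε t ht => (ν.comp ((ContinuousLinearMap.fst ℝ E (E →L[ℝ] ℝ)).comp
      (ContinuousLinearMap.snd ℝ ℝ (E × (E →L[ℝ] ℝ))))).hasFDerivAt.comp_hasDerivWithinAt t
        (hΦd ε hε t ht))
    (fun ε hε => by rw [hΦ0 ε hε]; exact hz₁)
    (by
      rw [hΦeq 0 h0T, hfield]
      simp [xs, ξs, he]
      positivity)
    (by
      rw [hΦeq T hTT, hνc₀]
      simp only [xs, hκT]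
      rw [show 3 / 2 * Real.pi = Real.pi / 2 + Real.pi by ring, Real.sin_add_pi, Real.sin_pi_div_two,
        mul_neg_one]
      have : 0 < a * ξ₀ / κ := by positivity
      linarith)
  -- the rescaled integrand
  let abs₀ : E → E := fun z => z + (|ν z| - ν z) • e
  have habs₀ : Continuous abs₀ := by fun_prop
  let zz : ℝ × ℝ → E := fun p => diag ν e (Φ p).1 1 (Φ p).2.1
  let j : ℝ × ℝ → ℝ := fun p => ν (Φ p).2.1 ^ (m + 1) *
    w (abs₀ (zz p)) (tangentialProj ν e (k (zz p) (scaledCovector ν e (ν (Φ p).2.1) (Φ p).2.2)))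
  have hzzc : ContinuousOn zz (Icc 0 r ×ˢ Icc 0 T) := hdz.comp_continuousOn hΦc
  have hzzB : ∀ p ∈ Icc 0 r ×ˢ Icc 0 T, zz p ∈ B := fun p hp => hΦB p.1 hp.1 p.2 hp.2
  have hνΦ : ContinuousOn (fun p => ν (Φ p).2.1) (Icc 0 r ×ˢ Icc 0 T) :=
    ν.continuous.comp_continuousOn hΦc.snd.fst
  have hj : ContinuousOn j (Icc 0 r ×ˢ Icc 0 T) := by
    -- The form `w` is controlled only where `0 ≤ ν z`, while the flow may continue to the other
    -- side after the exit time. Composition with the reflection `abs₀` gives a continuous integrand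
    -- on the whole rectangle, unchanged up to the exit.
    have h1 : ContinuousOn (fun p => w (abs₀ (zz p))) (Icc 0 r ×ˢ Icc 0 T) := by
      refine hw.comp (habs₀.comp_continuousOn hzzc) fun p hp => ⟨hBr _ (hzzB p hp), ?_⟩
      change 0 ≤ ν (abs₀ (zz p))
      simp [abs₀, he]
    have h2 : ContinuousOn (fun p => diag ν e (1 / 2) (ν (Φ p).2.1)) (Icc 0 r ×ˢ Icc 0 T) :=
      (contDiff_diag ν e).continuous.comp_continuousOn (continuousOn_const.prodMk hνΦ)
    have h3 : ContinuousOn (fun p => scaledCovector ν e (ν (Φ p).2.1) (Φ p).2.2)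
        (Icc 0 r ×ˢ Icc 0 T) := hΦc.snd.snd.clm_comp h2
    have h4 : ContinuousOn (fun p => k (zz p)) (Icc 0 r ×ˢ Icc 0 T) :=
      hk.continuousOn.comp hzzc hzzB
    exact (hνΦ.pow _).mul (h1.clm_apply
      ((tangentialProj ν e).continuous.comp_continuousOn (h4.clm_apply h3)))
  have hzero : ∀ ε ∈ Ioc 0 ε₀, ∃ τ ∈ Icc δ T, ν (Φ (ε, τ)).2.1 = 0 ∧
      ∫ t in (0 : ℝ)..τ, j (ε, t) = 0 := by
    intro ε hε
    obtain ⟨τ, hτ, hτ0, hτpos⟩ := hexit ε ⟨hε.1.le, hε.2⟩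
    refine ⟨τ, hτ, hτ0, ?_⟩
    have hεr : ε ∈ Icc 0 r := ⟨hε.1.le, hε.2.trans hε₀r⟩
    have hτ' : 0 < τ := hδ.trans_le hτ.1
    have hsub : Icc 0 τ ⊆ Icc 0 T := Icc_subset_Icc_right hτ.2
    have hΦε : ∀ t ∈ Icc 0 τ, Φ (ε, t) = (ε, (Φ (ε, t)).2.1, (Φ (ε, t)).2.2) := fun t ht =>
      Prod.ext (hΦ1 ε hεr t (hsub ht)) rfl
    have htraj := isModelTrajectory_of_rescaled he hB hk hs hε.1 hτ'
      (Z := fun t => (Φ (ε, t)).2.1) (P := fun t => (Φ (ε, t)).2.2)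
      (fun t ht => by
        rw [← hΦε t ht]
        have h1 := (hΦd ε hεr t (hsub ht)).mono hsub
        exact ⟨((ContinuousLinearMap.fst ℝ E (E →L[ℝ] ℝ)).comp
          (ContinuousLinearMap.snd ℝ ℝ (E × (E →L[ℝ] ℝ)))).hasFDerivAt.comp_hasDerivWithinAt t h1,
          ((ContinuousLinearMap.snd ℝ E (E →L[ℝ] ℝ)).comp
          (ContinuousLinearMap.snd ℝ ℝ (E × (E →L[ℝ] ℝ)))).hasFDerivAt.comp_hasDerivWithinAt t h1⟩)
      (fun t ht => by
        have := hΦB ε hεr t (hsub ht)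
        rwa [hΦ1 ε hεr t (hsub ht)] at this)
      (by rw [hΦ0 ε hεr]; exact hz₁) hτ0 hτpos
      (by
        rw [hΦ0 ε hεr]
        simp only
        have h1 : diag ν e ε 1 z₁ = z₁ := by simp [diag_apply, tangentialProj_apply, hz₁]
        rw [h1, scaledCovector_smul_add he hθ]
        simp only [zero_smul, add_zero, map_smul, smul_apply, smul_eq_mul]
        rw [show ν (k z₁ ν) = 4 * a by rw [ha]; ring, ← hξ2]
        ring)
    have h0 := hI _ _ _ htraj
    -- Substitution `t = ε T`. The weight `x ^ m` and the factor `x` in the tangential velocity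
    -- together give `(ε X) ^ (m + 1)`.
    have hcv := intervalIntegral.integral_comp_div (a := 0) (b := ε * τ) (c := ε)
      (f := fun t => ε ^ (m + 1) * j (ε, t)) hε.1.ne'
    rw [zero_div, mul_div_cancel_left₀ _ hε.1.ne'] at hcv
    have heq : ∫ t in (0 : ℝ)..(ε * τ), ε ^ (m + 1) * j (ε, t / ε) = 0 := by
      refine Eq.trans ?_ h0
      refine intervalIntegral.integral_congr fun t ht => ?_
      rw [uIcc_of_le (mul_pos hε.1 hτ').le] at ht
      have htε : t / ε ∈ Icc 0 τ := ⟨div_nonneg ht.1 hε.1.le, (div_le_iff₀' hε.1).2 ht.2⟩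
      have hx0 : 0 ≤ ν (Φ (ε, t / ε)).2.1 := by
        rcases eq_or_lt_of_le htε.1 with h | h
        · rw [← h, hΦ0 ε hεr]; exact hz₁.ge
        rcases eq_or_lt_of_le htε.2 with h' | h'
        · rw [h', hτ0]
        · exact (hτpos _ ⟨h, h'⟩).le
      have hzz : zz (ε, t / ε) = diag ν e ε 1 (Φ (ε, t / ε)).2.1 := by
        simp only [zz]; rw [hΦ1 ε hεr _ (hsub htε)]
      have hab : abs₀ (zz (ε, t / ε)) = zz (ε, t / ε) := by
        simp only [abs₀]
        rw [abs_of_nonneg, sub_self, zero_smul, add_zero]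
        rw [hzz, apply_diag he]
        exact mul_nonneg hε.1.le hx0
      rw [hzz] at hab
      simp only [j, hzz, hab]
      rw [modelVelocity, apply_diag he, scaledCovector_comp_diag he hε.1.ne', tangentialProj_diag he,
        map_smul, smul_eq_mul]
      ring
    rw [heq, intervalIntegral.integral_const_mul] at hcv
    have h5 := (smul_eq_zero.1 hcv.symm).resolve_left hε.1.ne'
    exact (mul_eq_zero.1 h5).resolve_left (pow_ne_zero _ hε.1.ne')
  -- Normalising the interval to `[0, 1]` gives joint continuity in `ε` and the upper limit `τ`.
  have hJ : ContinuousOn (fun p : ℝ × ℝ => ∫ s in (0 : ℝ)..1, p.2 * j (p.1, p.2 * s))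
      (Icc 0 r ×ˢ Icc 0 T) := by
    refine continuousOn_integral_param (K := fun q : (ℝ × ℝ) × ℝ => q.1.2 * j (q.1.1, q.1.2 * q.2)) ?_
    refine ContinuousOn.mul (by fun_prop) (hj.comp (by fun_prop) ?_)
    rintro ⟨⟨ε, τ⟩, s⟩ ⟨⟨hε, hτ⟩, hs⟩
    exact ⟨hε, mul_nonneg hτ.1 hs.1, (mul_le_of_le_one_right hτ.1 hs.2).trans hτ.2⟩
  have hJeq : ∀ ε τ : ℝ, ∫ s in (0 : ℝ)..1, τ * j (ε, τ * s) = ∫ t in (0 : ℝ)..τ, j (ε, t) := by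
    intro ε τ
    rw [intervalIntegral.integral_const_mul]
    have := intervalIntegral.mul_integral_comp_mul_left (a := 0) (b := 1) (f := fun t => j (ε, t))
      (c := τ)
    rwa [mul_zero, mul_one] at this
  let εs : ℕ → ℝ := fun i => ε₀ / (i + 1)
  have hεs : ∀ i, εs i ∈ Ioc 0 ε₀ := fun i => ⟨by positivity, div_le_self hε₀.le (by simp)⟩
  have hεlim : Tendsto εs atTop (𝓝 0) := by
    have := tendsto_one_div_add_atTop_nhds_zero_nat (𝕜 := ℝ).const_mul ε₀
    simpa [εs, div_eq_mul_inv] using this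
  choose τs hτs hτs0 hτsJ using fun i => hzero (εs i) (hεs i)
  -- The exit times lie in `[δ, T]`, so a subsequence converges to a positive limit. As `X` vanishes
  -- there in the limit and `κ τ'` lies in `(0, 3π / 2]`, this limit must be `π / κ`.
  obtain ⟨τ', hτ', φ, hφ, hφlim⟩ := isCompact_Icc.tendsto_subseq hτs
  have hτ'T : τ' ∈ Icc 0 T := ⟨hδ.le.trans hτ'.1, hτ'.2⟩
  have hlim : Tendsto (fun i => (εs (φ i), τs (φ i))) atTop (𝓝[Icc 0 r ×ˢ Icc 0 T] (0, τ')) := by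
    refine tendsto_nhdsWithin_iff.2 ⟨(hεlim.comp hφ.tendsto_atTop).prodMk_nhds hφlim,
      Eventually.of_forall fun i => ⟨⟨(hεs _).1.le, (hεs _).2.trans hε₀r⟩,
        hδ.le.trans (hτs _).1, (hτs _).2⟩⟩
  have hx' : xs τ' = 0 := by
    have h1 := (hνΦ (0, τ') ⟨h0r, hτ'T⟩).tendsto.comp hlim
    have h2 : (fun i => ν (Φ (εs (φ i), τs (φ i))).2.1) = fun _ => 0 := funext fun i => hτs0 _
    have h3 := tendsto_nhds_unique h1 (by
      simp only [Function.comp_def]; rw [h2]; exact tendsto_const_nhds)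
    rwa [hΦeq τ' hτ'T, hνc₀] at h3
  have hJ' : ∫ t in (0 : ℝ)..τ', j (0, t) = 0 := by
    have h1 := (hJ (0, τ') ⟨h0r, hτ'T⟩).tendsto.comp hlim
    have h3 := tendsto_nhds_unique h1 (by
      simp only [Function.comp_def, hJeq, hτsJ]; exact tendsto_const_nhds)
    simpa only [hJeq] using h3
  have hτπ : τ' = Real.pi / κ := by
    have h1 : Real.sin (κ * τ') = 0 :=
      (mul_eq_zero.1 hx').resolve_left (by positivity)
    have h2 : 0 < κ * τ' := mul_pos hκ0 (hδ.trans_le hτ'.1)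
    have h3 : κ * τ' ≤ 3 / 2 * Real.pi := by rw [← hκT]; exact mul_le_mul_of_nonneg_left hτ'.2 hκ0.le
    have h4 : Real.sin (κ * τ' - Real.pi) = 0 := by rw [Real.sin_sub_pi, h1, neg_zero]
    have h5 := (Real.sin_eq_zero_iff_of_lt_of_lt (by linarith) (by linarith [Real.pi_pos])).1 h4
    rw [eq_div_iff hκ0.ne', mul_comm]
    linarith
  have hjval : ∀ t ∈ Icc 0 τ', j (0, t) = (a * ξ₀ / κ) ^ (m + 1) * ξ₀ *
      (Real.sin (κ * t) ^ (m + 1) * (b * Real.cos (κ * t) + κ * Real.sin (κ * t))) := by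
    intro t ht
    have htT : t ∈ Icc 0 T := ⟨ht.1, ht.2.trans hτ'.2⟩
    have h1 : zz (0, t) = z₁ := by simp only [zz]; rw [hΦeq t htT, hc₀z]
    have h2 : abs₀ z₁ = z₁ := by simp [abs₀, hz₁]
    simp only [j, h1, h2]
    rw [hΦeq t htT, hνc₀, ← ContinuousLinearMap.comp_apply, ← hθdef]
    simp only [c₀]
    rw [scaledCovector_smul_add he hθ]
    simp only [map_add, map_smul, smul_eq_mul]
    rw [← hc, show θ (k z₁ ν) = 2 * b by rw [hb]; ring]
    -- This quantity is `b ξ + c X`, that is, minus the derivative of the limiting `ξ`.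
    have h3 : ξs t / 2 * (2 * b) + xs t * c =
        ξ₀ * (b * Real.cos (κ * t) + κ * Real.sin (κ * t)) := by
      simp only [xs, ξs]
      field_simp
      linear_combination (-Real.sin (κ * t)) * hκ2
    rw [h3]
    simp only [xs]
    rw [mul_pow]
    ring
  rw [intervalIntegral.integral_congr (g := fun t => (a * ξ₀ / κ) ^ (m + 1) * ξ₀ *
      (Real.sin (κ * t) ^ (m + 1) * (b * Real.cos (κ * t) + κ * Real.sin (κ * t))))
      (fun t ht => hjval t (by rwa [uIcc_of_le hτ'T.1] at ht)),
    intervalIntegral.integral_const_mul, hτπ] at hJ'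
  have := oscillator_integral_pos (b := b) hκ0 m
  have h2 : 0 < (a * ξ₀ / κ) ^ (m + 1) * ξ₀ := by positivity
  exact absurd hJ' (mul_pos h2 this).ne'

end Model

/-! ### Charts of the maximal atlas: coordinate frames, boundary points, smoothness in coordinates.
-/

section Coordinates

set_option linter.unusedSectionVars false

variable {n : ℕ} [NeZero n] {N : Type*} [TopologicalSpace N] [ChartedSpace (EuclideanHalfSpace n) N]
  [IsManifold (𝓡∂ n) ∞ N] {e e' : OpenPartialHomeomorph N (EuclideanHalfSpace n)} {p : N}

theorem mem_maximalAtlas_one (he : e ∈ IsManifold.maximalAtlas (𝓡∂ n) ∞ N) :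
    e ∈ IsManifold.maximalAtlas (𝓡∂ n) 1 N :=
  IsManifold.maximalAtlas_subset_of_le (by simp) he

theorem mdifferentiable_of_mem_maximalAtlas (he : e ∈ IsManifold.maximalAtlas (𝓡∂ n) ∞ N) :
    e.MDifferentiable (𝓡∂ n) (𝓡∂ n) :=
  ⟨fun _ hx => (mdifferentiableAt_of_mem_maximalAtlas
      (mem_maximalAtlas_one he) hx).mdifferentiableWithinAt,
    fun _ hx => (mdifferentiableAt_symm_of_mem_maximalAtlas
      (mem_maximalAtlas_one he) hx).mdifferentiableWithinAt⟩

theorem coordCovector_eq_mfderiv (he : e ∈ IsManifold.maximalAtlas (𝓡∂ n) ∞ N) (hp : p ∈ e.source) :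
    coordCovector e p = mfderiv (𝓡∂ n) (𝓡∂ n) e p := by
  have h1 := (mdifferentiableAt_of_mem_maximalAtlas (mem_maximalAtlas_one he) hp).hasMFDerivAt
  have h2 := (𝓡∂ n).hasMFDerivAt (x := e p)
  have := (h2.comp p h1).mfderiv
  exact this

/-- The coordinate differentials of a chart are a basis of the cotangent space. -/
theorem isInvertible_coordCovector (he : e ∈ IsManifold.maximalAtlas (𝓡∂ n) ∞ N)
    (hp : p ∈ e.source) : (coordCovector e p).IsInvertible := by
  have hm := mdifferentiable_of_mem_maximalAtlas he
  rw [coordCovector_eq_mfderiv he hp]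
  exact ⟨hm.mfderiv hp, rfl⟩

theorem coordCovector_comp_coordVector (he : e ∈ IsManifold.maximalAtlas (𝓡∂ n) ∞ N)
    (hp : p ∈ e.source) : (coordCovector e p).comp (coordVector e p) = .id ℝ _ :=
  (isInvertible_coordCovector he hp).self_comp_inverse

theorem coordVector_comp_coordCovector (he : e ∈ IsManifold.maximalAtlas (𝓡∂ n) ∞ N)
    (hp : p ∈ e.source) : (coordVector e p).comp (coordCovector e p) = .id ℝ _ :=
  (isInvertible_coordCovector he hp).inverse_comp_self

theorem coordCovector_coordVector (he : e ∈ IsManifold.maximalAtlas (𝓡∂ n) ∞ N)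
    (hp : p ∈ e.source) (v : EuclideanSpace ℝ (Fin n)) :
    coordCovector e p (coordVector e p v) = v :=
  congrArg (fun L => L v) (coordCovector_comp_coordVector he hp)

theorem coordVector_coordCovector (he : e ∈ IsManifold.maximalAtlas (𝓡∂ n) ∞ N)
    (hp : p ∈ e.source) (v : TangentSpace (𝓡∂ n) p) :
    coordVector e p (coordCovector e p v) = v :=
  congrArg (fun L => L v) (coordVector_comp_coordCovector he hp)

/-- In every chart the boundary is where the first coordinate vanishes. -/
theorem mem_boundary_iff_coord (he : e ∈ IsManifold.maximalAtlas (𝓡∂ n) ∞ N) (hp : p ∈ e.source) :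
    p ∈ (𝓡∂ n).boundary N ↔ (e.extend (𝓡∂ n) p) 0 = 0 := by
  have hm := mdifferentiable_of_mem_maximalAtlas he
  -- A differentiable map with surjective derivative takes interior points to interior points. This
  -- is applied to the chart and to its inverse.
  have h1 : (𝓡∂ n).IsInteriorPoint p ↔ (𝓡∂ n).IsInteriorPoint (e p) := by
    refine ⟨fun h => (hm.mdifferentiableAt hp).isInteriorPoint_of_surjective_mfderiv
      (hm.mfderiv hp).surjective h, fun h => ?_⟩
    have := (hm.symm.mdifferentiableAt (e.map_source hp)).isInteriorPoint_of_surjective_mfderiv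
      (hm.symm.mfderiv (e.map_source hp)).surjective h
    rwa [e.left_inv hp] at this
  have h2 : (𝓡∂ n).IsInteriorPoint (e p) ↔ (e p).1 0 ≠ 0 := by
    rw [ModelWithCorners.isInteriorPoint_iff]
    have hI := interior_range_modelWithCornersEuclideanHalfSpace n
    simp only [chartAt_self_eq, extChartAt,  OpenPartialHomeomorph.extend, mfld_simps]
    rw [hI]
    exact ⟨fun h => ne_of_gt h, fun h => lt_of_le_of_ne (e p).2 (Ne.symm h)⟩
  have h3 : p ∈ (𝓡∂ n).boundary N ↔ ¬ (𝓡∂ n).IsInteriorPoint p := by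
    rw [← ModelWithCorners.compl_interior]; rfl
  rw [h3, h1, h2, not_not]
  rfl

theorem mem_interior_iff_coord (he : e ∈ IsManifold.maximalAtlas (𝓡∂ n) ∞ N) (hp : p ∈ e.source) :
    p ∈ (𝓡∂ n).interior N ↔ 0 < (e.extend (𝓡∂ n) p) 0 := by
  have h := mem_boundary_iff_coord he hp
  rw [← ModelWithCorners.compl_interior, mem_compl_iff] at h
  have h0 : 0 ≤ (e.extend (𝓡∂ n) p) 0 := (e p).2
  rw [← not_iff_not, h]
  constructor
  · intro h; rw [h]; exact lt_irrefl _
  · intro h; exact le_antisymm (not_lt.1 h) h0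

/-- Identifies the trivialisation of the tangent bundle with the coordinate frame, so that
smoothness of bundle sections can be read off from components. -/
theorem symmL_eq_coordVector {p₀ : N} (hp : p ∈ (chartAt (EuclideanHalfSpace n) p₀).source) :
    Trivialization.symmL ℝ (trivializationAt (EuclideanSpace ℝ (Fin n))
      (TangentSpace (𝓡∂ n) : N → Type _) p₀) p =
      coordVector (chartAt (EuclideanHalfSpace n) p₀) p := by
  set T := trivializationAt (EuclideanSpace ℝ (Fin n)) (TangentSpace (𝓡∂ n) : N → Type _) p₀
  have h1 : T.continuousLinearMapAt ℝ p = coordCovector (chartAt (EuclideanHalfSpace n) p₀) p :=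
    TangentBundle.continuousLinearMapAt_trivializationAt hp
  have hb : p ∈ T.baseSet := hp
  symm
  rw [coordVector, ← h1]
  apply ContinuousLinearMap.inverse_eq
  · exact ContinuousLinearMap.ext fun v => T.continuousLinearMapAt_symmL (R := ℝ) hb v
  · exact ContinuousLinearMap.ext fun v => T.symmL_continuousLinearMapAt (R := ℝ) hb v

/-- The transition matrix between the coordinate frames of two charts is smooth. -/
theorem contMDiffAt_transition (he : e ∈ IsManifold.maximalAtlas (𝓡∂ n) ∞ N) (hp : p ∈ e.source) :
    ContMDiffAt (𝓡∂ n) 𝓘(ℝ, EuclideanSpace ℝ (Fin n) →L[ℝ] EuclideanSpace ℝ (Fin n)) ∞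
      (fun x : N => (coordCovector e x).comp (coordVector (chartAt (EuclideanHalfSpace n) p) x)) p := by
  have h := (e.contMDiffAt_extend he hp).mfderiv_const (m := ∞) (by simp)
  refine h.congr_of_eventuallyEq ?_
  filter_upwards [(chartAt (EuclideanHalfSpace n) p).open_source.mem_nhds (mem_chart_source _ p)]
    with x hx
  have h2 := TangentBundle.continuousLinearMapAt_model_space (𝕜 := ℝ) (e.extend (𝓡∂ n) p)
    (e.extend (𝓡∂ n) x)
  simp only [inTangentCoordinates, ContinuousLinearMap.inCoordinates]
  rw [h2]
  exact congrArg (fun L => (coordCovector e x).comp L) (symmL_eq_coordVector hx).symm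

/-- This matrix is the inverse of the smooth one in `contMDiffAt_transition`, and inversion is
smooth at an invertible linear map. -/
theorem contMDiffAt_transition_inverse (he : e ∈ IsManifold.maximalAtlas (𝓡∂ n) ∞ N)
    (hp : p ∈ e.source) :
    ContMDiffAt (𝓡∂ n) 𝓘(ℝ, EuclideanSpace ℝ (Fin n) →L[ℝ] EuclideanSpace ℝ (Fin n)) ∞
      (fun x : N => (coordCovector (chartAt (EuclideanHalfSpace n) p) x).comp (coordVector e x)) p := by
  have hc : chartAt (EuclideanHalfSpace n) p ∈ IsManifold.maximalAtlas (𝓡∂ n) ∞ N :=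
    IsManifold.chart_mem_maximalAtlas p
  have hinv : ∀ x ∈ e.source, x ∈ (chartAt (EuclideanHalfSpace n) p).source →
      ((coordCovector e x).comp (coordVector (chartAt (EuclideanHalfSpace n) p) x)).comp
        ((coordCovector (chartAt (EuclideanHalfSpace n) p) x).comp (coordVector e x)) = .id ℝ _ ∧
      ((coordCovector (chartAt (EuclideanHalfSpace n) p) x).comp (coordVector e x)).comp
        ((coordCovector e x).comp (coordVector (chartAt (EuclideanHalfSpace n) p) x)) = .id ℝ _ := by
    intro x hx hx'
    constructor <;> refine ContinuousLinearMap.ext fun v => ?_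
    · change coordCovector e x (coordVector _ x (coordCovector _ x _)) = v
      rw [coordVector_coordCovector hc hx']
      exact coordCovector_coordVector he hx v
    · change coordCovector _ x (coordVector e x (coordCovector e x _)) = v
      rw [coordVector_coordCovector he hx]
      exact coordCovector_coordVector hc hx' v
  have hp' := mem_chart_source (EuclideanHalfSpace n) p
  have hi : ((coordCovector e p).comp
      (coordVector (chartAt (EuclideanHalfSpace n) p) p)).IsInvertible :=
    .of_inverse (hinv p hp hp').1 (hinv p hp hp').2
  refine (hi.contDiffAt_map_inverse.contMDiffAt.comp p
    (contMDiffAt_transition he hp)).congr_of_eventuallyEq ?_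
  filter_upwards [e.open_source.mem_nhds hp,
    (chartAt (EuclideanHalfSpace n) p).open_source.mem_nhds hp'] with x hx hx'
  exact (ContinuousLinearMap.inverse_eq (hinv x hx hx').1 (hinv x hx hx').2).symm

theorem inCoordinates_oneForm {p₀ x : N} (hx : x ∈ (chartAt (EuclideanHalfSpace n) p₀).source)
    (φ : TangentSpace (𝓡∂ n) x →L[ℝ] ℝ) :
    ContinuousLinearMap.inCoordinates (EuclideanSpace ℝ (Fin n))
      (TangentSpace (𝓡∂ n) : N → Type _) ℝ (Bundle.Trivial N ℝ) p₀ x p₀ x φ =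
      φ.comp (coordVector (chartAt (EuclideanHalfSpace n) p₀) x) := by
  rw [ContinuousLinearMap.inCoordinates, symmL_eq_coordVector hx]
  refine ContinuousLinearMap.ext fun v => ?_
  exact congrArg (fun L : ℝ →L[ℝ] ℝ =>
    L (φ (coordVector (chartAt (EuclideanHalfSpace n) p₀) x v)))
    (Bundle.Trivial.continuousLinearMapAt_trivialization ℝ N ℝ x)

/-- A 1-form is smooth iff its components in a chart are. -/
theorem contMDiffAt_oneForm_iff (he : e ∈ IsManifold.maximalAtlas (𝓡∂ n) ∞ N) (hp : p ∈ e.source)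
    (u : OneForm n N) :
    ContMDiffAt (𝓡∂ n) ((𝓡∂ n).prod 𝓘(ℝ, EuclideanSpace ℝ (Fin n) →L[ℝ] ℝ)) ∞
      (fun x => TotalSpace.mk' (EuclideanSpace ℝ (Fin n) →L[ℝ] ℝ)
        (E := fun p : N => TangentSpace (𝓡∂ n) p →L[ℝ] ℝ) x (u x)) p ↔
    ContMDiffAt (𝓡∂ n) 𝓘(ℝ, EuclideanSpace ℝ (Fin n) →L[ℝ] ℝ) ∞
      (fun x => (u x).comp (coordVector e x)) p := by
  rw [contMDiffAt_hom_bundle]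
  have hT := contMDiffAt_transition he hp
  have hs := (chartAt (EuclideanHalfSpace n) p).open_source.mem_nhds (mem_chart_source _ p)
  have hes := e.open_source.mem_nhds hp
  have h1 : (fun x => ContinuousLinearMap.inCoordinates (EuclideanSpace ℝ (Fin n))
      (TangentSpace (𝓡∂ n) : N → Type _) ℝ (Bundle.Trivial N ℝ) p x p x (u x)) =ᶠ[𝓝 p]
      fun x => (u x).comp (coordVector (chartAt (EuclideanHalfSpace n) p) x) := by
    filter_upwards [hs] with x hx
    exact inCoordinates_oneForm hx (u x)
  constructor
  · rintro ⟨-, h⟩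
    replace h := h.congr_of_eventuallyEq h1.symm
    refine (h.clm_comp (contMDiffAt_transition_inverse he hp)).congr_of_eventuallyEq ?_
    filter_upwards [hs] with x hx
    refine ContinuousLinearMap.ext fun v => ?_
    change u x _ = u x (coordVector _ x (coordCovector _ x _))
    rw [coordVector_coordCovector (IsManifold.chart_mem_maximalAtlas p) hx]
  · intro h
    refine ⟨contMDiffAt_id, ?_⟩
    refine ContMDiffAt.congr_of_eventuallyEq ?_ h1
    have := h.clm_comp hT
    refine this.congr_of_eventuallyEq ?_
    filter_upwards [hes] with x hx
    refine ContinuousLinearMap.ext fun v => ?_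
    change u x _ = u x (coordVector e x (coordCovector e x _))
    rw [coordVector_coordCovector he hx]

/-- Continuity of a curve in the cotangent bundle, from the canonical coordinates of a chart. -/
theorem continuousWithinAt_cotangent_curve {s : Set ℝ} {t₀ : ℝ} {γ : ℝ → N}
    {ζ : ∀ t, TangentSpace (𝓡∂ n) (γ t) →L[ℝ] ℝ}
    (he : e ∈ IsManifold.maximalAtlas (𝓡∂ n) ∞ N) (hp : γ t₀ ∈ e.source)
    (hγ : ContinuousWithinAt γ s t₀)
    (hζ : ContinuousWithinAt (fun t => (ζ t).comp (coordVector e (γ t))) s t₀) :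
    ContinuousWithinAt (fun t => TotalSpace.mk' (EuclideanSpace ℝ (Fin n) →L[ℝ] ℝ)
      (E := fun p : N => TangentSpace (𝓡∂ n) p →L[ℝ] ℝ) (γ t) (ζ t)) s t₀ := by
  rw [continuousWithinAt_hom_bundle]
  refine ⟨hγ, ?_⟩
  have hT := (contMDiffAt_transition he hp).continuousAt.comp_continuousWithinAt hγ
  have h2 := hζ.clm_comp hT
  have hs := hγ.tendsto.eventually
    ((chartAt (EuclideanHalfSpace n) (γ t₀)).open_source.mem_nhds (mem_chart_source _ (γ t₀)))
  have hes := hγ.tendsto.eventually (e.open_source.mem_nhds hp)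
  have key : ∀ t, γ t ∈ (chartAt (EuclideanHalfSpace n) (γ t₀)).source → γ t ∈ e.source →
      ContinuousLinearMap.inCoordinates (EuclideanSpace ℝ (Fin n))
      (TangentSpace (𝓡∂ n) : N → Type _) ℝ (Bundle.Trivial N ℝ) (γ t₀) (γ t) (γ t₀) (γ t) (ζ t) =
      ((ζ t).comp (coordVector e (γ t))).comp ((coordCovector e (γ t)).comp
        (coordVector (chartAt (EuclideanHalfSpace n) (γ t₀)) (γ t))) := by
    intro t hx hx'
    refine (inCoordinates_oneForm hx (ζ t)).trans (ContinuousLinearMap.ext fun v => ?_)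
    change ζ t _ = ζ t (coordVector e (γ t) (coordCovector e (γ t) _))
    rw [coordVector_coordCovector he hx']
  refine h2.congr_of_eventuallyEq ?_ ?_
  · filter_upwards [hs, hes] with t h h' using key t h h'
  · exact key t₀ (mem_chart_source _ _) hp

theorem range_model : range (𝓡∂ n) = {z : EuclideanSpace ℝ (Fin n) | 0 ≤ z 0} :=
  range_modelWithCornersEuclideanHalfSpace n

theorem contDiffWithinAt_of_contMDiffAt {F : Type*} [NormedAddCommGroup F] [NormedSpace ℝ F]
    {g : N → F} (he : e ∈ IsManifold.maximalAtlas (𝓡∂ n) ∞ N) (hp : p ∈ e.source)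
    (hg : ContMDiffAt (𝓡∂ n) 𝓘(ℝ, F) ∞ g p) :
    ContDiffWithinAt ℝ ∞ (fun z => g ((e.extend (𝓡∂ n)).symm z)) (range (𝓡∂ n))
      (e.extend (𝓡∂ n) p) := by
  rw [← contMDiffWithinAt_univ, contMDiffWithinAt_iff_source_of_mem_maximalAtlas he hp,
    preimage_univ, univ_inter, contMDiffWithinAt_iff_contDiffWithinAt] at hg
  exact hg

theorem contMDiffAt_of_contDiffWithinAt {F : Type*} [NormedAddCommGroup F] [NormedSpace ℝ F]
    {g : EuclideanSpace ℝ (Fin n) → F} (he : e ∈ IsManifold.maximalAtlas (𝓡∂ n) ∞ N)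
    (hp : p ∈ e.source) (hg : ContDiffWithinAt ℝ ∞ g (range (𝓡∂ n)) (e.extend (𝓡∂ n) p)) :
    ContMDiffAt (𝓡∂ n) 𝓘(ℝ, F) ∞ (fun x => g (e.extend (𝓡∂ n) x)) p :=
  by
  rw [← contMDiffWithinAt_univ]
  exact hg.contMDiffWithinAt.comp p (e.contMDiffAt_extend he hp).contMDiffWithinAt
    (fun x _ => mem_range_self _)

/-- At a boundary point the coordinate expression has only a derivative within the half space. That
determines `dq`, because the chart takes values in the half space. -/
theorem differential_eq_comp {q : N → ℝ} {qe : EuclideanSpace ℝ (Fin n) → ℝ}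
    {L : EuclideanSpace ℝ (Fin n) →L[ℝ] ℝ} (he : e ∈ IsManifold.maximalAtlas (𝓡∂ n) ∞ N)
    (hp : p ∈ e.source) (hL : HasFDerivWithinAt qe L (range (𝓡∂ n)) (e.extend (𝓡∂ n) p))
    (hq : q =ᶠ[𝓝 p] fun x => qe (e.extend (𝓡∂ n) x)) :
    differential n q p = L.comp (coordCovector e p) := by
  have h1 : HasMFDerivAt (𝓡∂ n) 𝓘(ℝ, EuclideanSpace ℝ (Fin n)) (e.extend (𝓡∂ n)) p
      (coordCovector e p) :=
    ((e.contMDiffAt_extend he hp).mdifferentiableAt (by simp)).hasMFDerivAt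
  have h2 := hL.hasMFDerivWithinAt.comp p h1.hasMFDerivWithinAt (s := univ)
    (fun x _ => mem_range_self _)
  rw [hasMFDerivWithinAt_univ] at h2
  exact (h2.congr_of_eventuallyEq hq).mfderiv

end Coordinates

/-! ### Components of a Riemannian metric in a chart. -/

section MetricCoefficients

set_option linter.unusedSectionVars false

variable {n : ℕ} [NeZero n] {N : Type*} [TopologicalSpace N] [ChartedSpace (EuclideanHalfSpace n) N]
  [IsManifold (𝓡∂ n) ∞ N] {e : OpenPartialHomeomorph N (EuclideanHalfSpace n)} {p : N}

/-- The components of a metric in a chart. -/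
noncomputable def metricCoeff (g : ContMDiffRiemannianMetric (𝓡∂ n) ∞ (EuclideanSpace ℝ (Fin n))
    (fun p : N => TangentSpace (𝓡∂ n) p)) (e : OpenPartialHomeomorph N (EuclideanHalfSpace n))
    (x : N) : EuclideanSpace ℝ (Fin n) →L[ℝ] EuclideanSpace ℝ (Fin n) →L[ℝ] ℝ :=
  (ContinuousLinearMap.precomp ℝ (coordVector e x)).comp ((g.inner x).comp (coordVector e x))

theorem contMDiffAt_metricCoeff_chartAt (g : ContMDiffRiemannianMetric (𝓡∂ n) ∞
    (EuclideanSpace ℝ (Fin n)) (fun p : N => TangentSpace (𝓡∂ n) p)) (p : N) :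
    ContMDiffAt (𝓡∂ n) 𝓘(ℝ, EuclideanSpace ℝ (Fin n) →L[ℝ] EuclideanSpace ℝ (Fin n) →L[ℝ] ℝ) ∞
      (metricCoeff g (chartAt (EuclideanHalfSpace n) p)) p := by
  have h := ((contMDiffAt_hom_bundle _).1 (g.contMDiff p)).2
  refine h.congr_of_eventuallyEq ?_
  filter_upwards [(chartAt (EuclideanHalfSpace n) p).open_source.mem_nhds (mem_chart_source _ p)]
    with x hx
  refine ContinuousLinearMap.ext fun v => ?_
  rw [ContinuousLinearMap.inCoordinates, symmL_eq_coordVector hx]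
  simp only [ContinuousLinearMap.comp_apply]
  rw [Trivialization.continuousLinearMapAt_apply, Trivialization.coe_linearMapAt_of_mem _
    (by rw [hom_trivializationAt_baseSet]; exact ⟨hx, mem_univ _⟩)]
  exact (inCoordinates_oneForm hx (g.inner x
    (coordVector (chartAt (EuclideanHalfSpace n) p) x v))).symm

/-- Reduces to the preferred chart, where the components are the bundle section in a trivialisation,
by the tensor transformation law. -/
theorem contMDiffAt_metricCoeff (g : ContMDiffRiemannianMetric (𝓡∂ n) ∞
    (EuclideanSpace ℝ (Fin n)) (fun p : N => TangentSpace (𝓡∂ n) p))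
    (he : e ∈ IsManifold.maximalAtlas (𝓡∂ n) ∞ N) (hp : p ∈ e.source) :
    ContMDiffAt (𝓡∂ n) 𝓘(ℝ, EuclideanSpace ℝ (Fin n) →L[ℝ] EuclideanSpace ℝ (Fin n) →L[ℝ] ℝ) ∞
      (metricCoeff g e) p := by
  have hT := contMDiffAt_transition_inverse he hp
  have h2 := (contMDiffAt_metricCoeff_chartAt g p).clm_comp hT
  have h3 := hT.clm_precomp (F₃ := ℝ)
  have h4 := h3.clm_comp h2
  refine h4.congr_of_eventuallyEq ?_
  filter_upwards [(chartAt (EuclideanHalfSpace n) p).open_source.mem_nhds (mem_chart_source _ p)]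
    with x hx
  have hc := coordVector_coordCovector (IsManifold.chart_mem_maximalAtlas p) hx
  refine ContinuousLinearMap.ext fun v => ContinuousLinearMap.ext fun w => ?_
  exact (congrArg₂ (fun a b => g.inner x a b) (hc (coordVector e x v)) (hc (coordVector e x w))).symm

end MetricCoefficients

/-! ### The charts `(√s, y)` compared with the charts `(s, y)`. -/

section RootChart

set_option linter.unusedSectionVars false

variable {n : ℕ} [NeZero n]

/-- The first coordinate. -/
noncomputable abbrev coordZero (n : ℕ) [NeZero n] : EuclideanSpace ℝ (Fin n) →L[ℝ] ℝ :=
  EuclideanSpace.proj (𝕜 := ℝ) (0 : Fin n)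

/-- The first vector of the standard basis. -/
noncomputable abbrev basisZero (n : ℕ) [NeZero n] : EuclideanSpace ℝ (Fin n) :=
  EuclideanSpace.single 0 1

theorem coordZero_basisZero : coordZero n (basisZero n) = 1 := by simp

theorem hasFDerivAt_squareMap (z : EuclideanSpace ℝ (Fin n)) :
    HasFDerivAt squareMap (diag (coordZero n) (basisZero n) (2 * z 0) 1) z := by
  have h0 : squareMap (n := n) = fun z => z + (coordZero n z ^ 2 - coordZero n z) • basisZero n := by
    funext z
    ext i
    by_cases hi : i = 0
    · subst hi; simp
    · simp [squareMap_of_ne _ hi, hi]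
  rw [h0]
  have h1 : HasFDerivAt (fun z => coordZero n z) (coordZero n) z := (coordZero n).hasFDerivAt
  refine ((hasFDerivAt_id z).add (((h1.pow 2).sub h1).smul_const (basisZero n))).congr_fderiv ?_
  ext v i
  simp [diag_apply, tangentialProj_apply]
  split_ifs <;> ring

variable {M : Type*} [TopologicalSpace M] [ChartedSpace (EuclideanHalfSpace n) M]

theorem rootChart_source (p : RootManifold M) :
    (chartAt (EuclideanHalfSpace n) p).source =
      RootManifold.toBase ⁻¹' (chartAt (EuclideanHalfSpace n) p.toBase).source := by
  change ((RootManifold.toBase.toOpenPartialHomeomorph.trans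
    (chartAt (EuclideanHalfSpace n) (RootManifold.toBase p))).trans
      (squareHomeomorph n).symm.toOpenPartialHomeomorph).source = _
  ext x
  simp

theorem squareMap_rootChart (p x : RootManifold M) :
    squareMap ((chartAt (EuclideanHalfSpace n) p).extend (𝓡∂ n) x) =
      (chartAt (EuclideanHalfSpace n) p.toBase).extend (𝓡∂ n) x.toBase :=
  squareMap_rootMap (chartAt (EuclideanHalfSpace n) p.toBase x.toBase).2

/-- The sign of the first coordinate has to be assumed because `squareMap` forgets it. -/
theorem mem_rootChart_target (p : RootManifold M) {z : EuclideanSpace ℝ (Fin n)} (hz : 0 ≤ z 0)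
    (hz' : squareMap z ∈ ((chartAt (EuclideanHalfSpace n) p.toBase).extend (𝓡∂ n)).target) :
    z ∈ ((chartAt (EuclideanHalfSpace n) p).extend (𝓡∂ n)).target := by
  set e₀ := chartAt (EuclideanHalfSpace n) p.toBase
  set x : RootManifold M := RootManifold.toBase.symm ((e₀.extend (𝓡∂ n)).symm (squareMap z)) with hx
  have hs : x ∈ (chartAt (EuclideanHalfSpace n) p).source := by
    rw [rootChart_source, mem_preimage, hx, Homeomorph.apply_symm_apply]
    have := (e₀.extend (𝓡∂ n)).map_target hz'
    rwa [e₀.extend_source] at this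
  have h1 : (chartAt (EuclideanHalfSpace n) p).extend (𝓡∂ n) x = z := by
    have h2 := squareMap_rootChart (n := n) p x
    rw [hx, Homeomorph.apply_symm_apply, (e₀.extend (𝓡∂ n)).right_inv hz'] at h2
    have h3 : 0 ≤ ((chartAt (EuclideanHalfSpace n) p).extend (𝓡∂ n) x) 0 :=
      (chartAt (EuclideanHalfSpace n) p x).2
    rw [← rootMap_squareMap hz, ← h2, rootMap_squareMap h3]
  rw [← h1]
  apply PartialEquiv.map_source
  rwa [OpenPartialHomeomorph.extend_source]

theorem toBase_rootChart_symm (p : RootManifold M) {z : EuclideanSpace ℝ (Fin n)}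
    (hz : z ∈ ((chartAt (EuclideanHalfSpace n) p).extend (𝓡∂ n)).target) :
    (((chartAt (EuclideanHalfSpace n) p).extend (𝓡∂ n)).symm z).toBase =
      ((chartAt (EuclideanHalfSpace n) p.toBase).extend (𝓡∂ n)).symm (squareMap z) := by
  set x := ((chartAt (EuclideanHalfSpace n) p).extend (𝓡∂ n)).symm z with hx
  have hs : x ∈ (chartAt (EuclideanHalfSpace n) p).source := by
    rw [← OpenPartialHomeomorph.extend_source (I := 𝓡∂ n)]
    exact PartialEquiv.map_target _ hz
  have h1 : (chartAt (EuclideanHalfSpace n) p).extend (𝓡∂ n) x = z := PartialEquiv.right_inv _ hz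
  rw [← h1, squareMap_rootChart, PartialEquiv.left_inv]
  rw [OpenPartialHomeomorph.extend_source]
  rw [rootChart_source] at hs
  exact hs

variable [IsManifold (𝓡∂ n) ∞ M]

/-- The identity is smooth from the second smooth structure to the original one. -/
theorem contMDiff_toBase :
    ContMDiff (𝓡∂ n) (𝓡∂ n) ∞ (RootManifold.toBase : RootManifold M → M) := by
  intro p
  have hp := mem_chart_source (EuclideanHalfSpace n) p
  rw [contMDiffAt_iff_of_mem_maximalAtlas (IsManifold.chart_mem_maximalAtlas p)
    (IsManifold.chart_mem_maximalAtlas p.toBase) hp (mem_chart_source _ _)]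
  refine ⟨RootManifold.toBase.continuous.continuousAt, ?_⟩
  refine contDiff_squareMap.contDiffWithinAt.congr_of_eventuallyEq ?_ ?_
  · filter_upwards [OpenPartialHomeomorph.extend_target_mem_nhdsWithin (I := 𝓡∂ n) _ hp] with z hz
    rw [Function.comp_apply, Function.comp_apply, ← squareMap_rootChart, PartialEquiv.right_inv _ hz]
  · rw [Function.comp_apply, Function.comp_apply, ← squareMap_rootChart, PartialEquiv.left_inv]
    rwa [OpenPartialHomeomorph.extend_source]

theorem coordCovector_mfderiv_toBase (p : RootManifold M) {x : RootManifold M}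
    (hx : x ∈ (chartAt (EuclideanHalfSpace n) p).source) (v : TangentSpace (𝓡∂ n) x) :
    coordCovector (chartAt (EuclideanHalfSpace n) p.toBase) x.toBase
        (mfderiv (𝓡∂ n) (𝓡∂ n) RootManifold.toBase x v) =
      diag (coordZero n) (basisZero n)
        (2 * ((chartAt (EuclideanHalfSpace n) p).extend (𝓡∂ n) x) 0) 1
        (coordCovector (chartAt (EuclideanHalfSpace n) p) x v) := by
  have hx' : x.toBase ∈ (chartAt (EuclideanHalfSpace n) p.toBase).source := by
    rw [rootChart_source] at hx; exact hx
  have h0 : HasMFDerivAt (𝓡∂ n) (𝓡∂ n) RootManifold.toBase x _ :=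
    ((contMDiff_toBase x).mdifferentiableAt (by simp)).hasMFDerivAt
  have h1 : HasMFDerivAt (𝓡∂ n) 𝓘(ℝ, EuclideanSpace ℝ (Fin n))
      ((chartAt (EuclideanHalfSpace n) p.toBase).extend (𝓡∂ n)) x.toBase
      (coordCovector (chartAt (EuclideanHalfSpace n) p.toBase) x.toBase) :=
    ((OpenPartialHomeomorph.contMDiffAt_extend (n := ∞) (IsManifold.chart_mem_maximalAtlas _) hx').mdifferentiableAt
      (by simp)).hasMFDerivAt
  have h2 : HasMFDerivAt (𝓡∂ n) 𝓘(ℝ, EuclideanSpace ℝ (Fin n))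
      ((chartAt (EuclideanHalfSpace n) p).extend (𝓡∂ n)) x
      (coordCovector (chartAt (EuclideanHalfSpace n) p) x) :=
    ((OpenPartialHomeomorph.contMDiffAt_extend (n := ∞) (IsManifold.chart_mem_maximalAtlas _) hx).mdifferentiableAt
      (by simp)).hasMFDerivAt
  have h3 := h1.comp x h0
  have h4 := (hasFDerivAt_squareMap
    ((chartAt (EuclideanHalfSpace n) p).extend (𝓡∂ n) x)).hasMFDerivAt.comp x h2
  -- One map is factored in two ways; uniqueness of its derivative gives the formula.
  have h5 : squareMap ∘ (chartAt (EuclideanHalfSpace n) p).extend (𝓡∂ n) =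
      ((chartAt (EuclideanHalfSpace n) p.toBase).extend (𝓡∂ n)) ∘ RootManifold.toBase :=
    funext fun x => squareMap_rootChart p x
  rw [h5] at h4
  exact congrArg (fun L => L v) (hasMFDerivAt_unique h3 h4)

end RootChart

/-! ### The dual metric, extended evenly across the boundary. -/

section DualMetric

variable {n : ℕ} [NeZero n] {M : Type*} [TopologicalSpace M]
    [ChartedSpace (EuclideanHalfSpace n) M] [IsManifold (𝓡∂ n) ∞ M] (G : GasGiant n M)

attribute [local instance] dualMetricAddCommGroup dualMetricGroup dualMetricSpace
  dualMetricDerivGroup dualMetricDerivSpace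

/-- A positive definite bilinear form is invertible. -/
theorem isInvertible_of_pos {E : Type*} [NormedAddCommGroup E] [NormedSpace ℝ E]
    [FiniteDimensional ℝ E] {B : E →L[ℝ] E →L[ℝ] ℝ} (hB : ∀ v ≠ 0, 0 < B v v) :
    B.IsInvertible := by
  have hinj : Function.Injective B := by
    rw [injective_iff_map_eq_zero]
    intro v hv
    by_contra h
    have := hB v h
    rw [hv] at this
    simp at this
  have hd : Module.finrank ℝ E = Module.finrank ℝ (E →L[ℝ] ℝ) := by
    rw [← Subspace.dual_finrank_eq (K := ℝ) (V := E)]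
    exact (LinearMap.toContinuousLinearMap (𝕜 := ℝ) (E := E) (F' := ℝ)).finrank_eq
  let L : E ≃ₗ[ℝ] (E →L[ℝ] ℝ) := LinearEquiv.ofInjectiveOfFinrankEq B.toLinearMap hinj hd
  exact ⟨L.toContinuousLinearEquiv, by ext v w; rfl⟩

theorem metricCoeff_apply {N : Type*} [TopologicalSpace N] [ChartedSpace (EuclideanHalfSpace n) N]
    [IsManifold (𝓡∂ n) ∞ N] (g : ContMDiffRiemannianMetric (𝓡∂ n) ∞
    (EuclideanSpace ℝ (Fin n)) (fun p : N => TangentSpace (𝓡∂ n) p))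
    (e : OpenPartialHomeomorph N (EuclideanHalfSpace n)) (x : N) (v w : EuclideanSpace ℝ (Fin n)) :
    metricCoeff g e x v w = g.inner x (coordVector e x v) (coordVector e x w) := rfl

theorem metricCoeff_pos {N : Type*} [TopologicalSpace N] [ChartedSpace (EuclideanHalfSpace n) N]
    [IsManifold (𝓡∂ n) ∞ N] (g : ContMDiffRiemannianMetric (𝓡∂ n) ∞
    (EuclideanSpace ℝ (Fin n)) (fun p : N => TangentSpace (𝓡∂ n) p))
    {e : OpenPartialHomeomorph N (EuclideanHalfSpace n)}
    (he : e ∈ IsManifold.maximalAtlas (𝓡∂ n) ∞ N) {x : N} (hx : x ∈ e.source)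
    {v : EuclideanSpace ℝ (Fin n)} (hv : v ≠ 0) : 0 < metricCoeff g e x v v := by
  rw [metricCoeff_apply]
  refine g.pos x _ fun h => hv ?_
  rw [← coordCovector_coordVector he hx v, h, map_zero]

/-- The dual metric `a g⁻¹` in coordinates `(x, y)`, for a metric `g` given in the coordinates
`(x ^ 2, y)`. -/
noncomputable def rootDualMetric (p : RootManifold M) (a : EuclideanSpace ℝ (Fin n) → ℝ)
    (z : EuclideanSpace ℝ (Fin n)) :
    (EuclideanSpace ℝ (Fin n) →L[ℝ] ℝ) →L[ℝ] EuclideanSpace ℝ (Fin n) :=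
  a (squareMap z) • (metricCoeff G.gbar (chartAt (EuclideanHalfSpace n) p.toBase)
    (((chartAt (EuclideanHalfSpace n) p.toBase).extend (𝓡∂ n)).symm (squareMap z))).inverse

theorem rootDualMetric_symm (p : RootManifold M) {a : EuclideanSpace ℝ (Fin n) → ℝ}
    {z : EuclideanSpace ℝ (Fin n)}
    (hz : squareMap z ∈ ((chartAt (EuclideanHalfSpace n) p.toBase).extend (𝓡∂ n)).target)
    (P Q : EuclideanSpace ℝ (Fin n) →L[ℝ] ℝ) :
    P (rootDualMetric G p a z Q) = Q (rootDualMetric G p a z P) := by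
  set e₀ := chartAt (EuclideanHalfSpace n) p.toBase
  set x := (e₀.extend (𝓡∂ n)).symm (squareMap z) with hxdef
  have hx : x ∈ e₀.source := by
    rw [← e₀.extend_source (I := 𝓡∂ n)]
    exact PartialEquiv.map_target _ hz
  have hB : (metricCoeff G.gbar e₀ x).IsInvertible := isInvertible_of_pos fun v hv =>
    metricCoeff_pos G.gbar (IsManifold.chart_mem_maximalAtlas _) hx hv
  have key : ∀ u v, metricCoeff G.gbar e₀ x u = P → metricCoeff G.gbar e₀ x v = Q → P v = Q u := by
    rintro u v rfl rfl
    rw [metricCoeff_apply, metricCoeff_apply, G.gbar.symm]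
  change P (a (squareMap z) • _) = Q (a (squareMap z) • _)
  rw [map_smul, map_smul]
  exact congrArg _ (key _ _ (hB.self_apply_inverse P) (hB.self_apply_inverse Q))

theorem rootDualMetric_pos (p : RootManifold M) {a : EuclideanSpace ℝ (Fin n) → ℝ}
    {z : EuclideanSpace ℝ (Fin n)}
    (hz : squareMap z ∈ ((chartAt (EuclideanHalfSpace n) p.toBase).extend (𝓡∂ n)).target)
    (ha : 0 < a (squareMap z)) {P : EuclideanSpace ℝ (Fin n) →L[ℝ] ℝ} (hP : P ≠ 0) :
    0 < P (rootDualMetric G p a z P) := by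
  set e₀ := chartAt (EuclideanHalfSpace n) p.toBase
  set x := (e₀.extend (𝓡∂ n)).symm (squareMap z) with hxdef
  have hx : x ∈ e₀.source := by
    rw [← e₀.extend_source (I := 𝓡∂ n)]
    exact PartialEquiv.map_target _ hz
  have hpos : ∀ v ≠ 0, 0 < metricCoeff G.gbar e₀ x v v := fun v hv =>
    metricCoeff_pos G.gbar (IsManifold.chart_mem_maximalAtlas _) hx hv
  have hB := isInvertible_of_pos hpos
  have h1 := hB.self_apply_inverse P
  change 0 < P (a (squareMap z) • _)
  rw [map_smul, smul_eq_mul]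
  refine mul_pos ha ?_
  change 0 < P ((metricCoeff G.gbar e₀ x).inverse P)
  have h2 : (metricCoeff G.gbar e₀ x).inverse P ≠ 0 := fun h => hP (by rw [← h1, h, map_zero])
  have h3 := hpos _ h2
  rwa [h1] at h3

/-- The dependence on `x` is through `x ^ 2` only. Therefore `B` may contain points with negative
first coordinate although `D` lies in the half space. -/
theorem contDiffOn_rootDualMetric (p : RootManifold M) {a : EuclideanSpace ℝ (Fin n) → ℝ}
    {B D : Set (EuclideanSpace ℝ (Fin n))} (ha : ContDiffOn ℝ ∞ a D) (hBD : MapsTo squareMap B D)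
    (hD : D ⊆ ((chartAt (EuclideanHalfSpace n) p.toBase).extend (𝓡∂ n)).target) :
    ContDiffOn ℝ ∞ (rootDualMetric G p a) B := by
  set e₀ := chartAt (EuclideanHalfSpace n) p.toBase
  have h1 : ContDiffOn ℝ ∞ (fun w => (metricCoeff G.gbar e₀
      ((e₀.extend (𝓡∂ n)).symm w)).inverse) D := by
    intro w hw
    set x := (e₀.extend (𝓡∂ n)).symm w with hxdef
    have hx : x ∈ e₀.source := by
      rw [← e₀.extend_source (I := 𝓡∂ n)]
      exact PartialEquiv.map_target _ (hD hw)
    have he := IsManifold.chart_mem_maximalAtlas (I := 𝓡∂ n) (n := ∞) p.toBase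
    have h2 := contDiffWithinAt_of_contMDiffAt he hx (contMDiffAt_metricCoeff G.gbar he hx)
    rw [hxdef, PartialEquiv.right_inv _ (hD hw)] at h2
    have hB : (metricCoeff G.gbar e₀ x).IsInvertible := isInvertible_of_pos fun v hv =>
      metricCoeff_pos G.gbar he hx hv
    exact (hB.contDiffAt_map_inverse.comp_contDiffWithinAt w h2).mono
      (hD.trans (e₀.extend_target_subset_range))
  exact (ha.comp contDiff_squareMap.contDiffOn hBD).smul
    (h1.comp contDiff_squareMap.contDiffOn hBD)

end DualMetric

/-! ### The gas giant metric and its geodesic velocity in the coordinates `(x, y)`. -/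

section Sharp

variable {n : ℕ} [NeZero n] {M : Type*} [TopologicalSpace M]
    [ChartedSpace (EuclideanHalfSpace n) M] [IsManifold (𝓡∂ n) ∞ M] (G : GasGiant n M)

/-- In these charts the identity map is `(x, y) ↦ (x ^ 2, y)`, with differential `diag (2x) 1`. -/
theorem metric_eq_metricCoeff {p x : RootManifold M}
    (hx : x ∈ (chartAt (EuclideanHalfSpace n) p).source) (v w : TangentSpace (𝓡∂ n) x) :
    G.metric x v w = (G.ρ x.toBase)⁻¹ *
      metricCoeff G.gbar (chartAt (EuclideanHalfSpace n) p.toBase) x.toBase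
        (diag (coordZero n) (basisZero n)
          (2 * ((chartAt (EuclideanHalfSpace n) p).extend (𝓡∂ n) x) 0) 1
          (coordCovector (chartAt (EuclideanHalfSpace n) p) x v))
        (diag (coordZero n) (basisZero n)
          (2 * ((chartAt (EuclideanHalfSpace n) p).extend (𝓡∂ n) x) 0) 1
          (coordCovector (chartAt (EuclideanHalfSpace n) p) x w)) := by
  have hx' : x.toBase ∈ (chartAt (EuclideanHalfSpace n) p.toBase).source := by
    rw [rootChart_source] at hx; exact hx
  rw [metric_apply, metricCoeff_apply, ← coordCovector_mfderiv_toBase p hx,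
    ← coordCovector_mfderiv_toBase p hx,
    coordVector_coordCovector (IsManifold.chart_mem_maximalAtlas _) hx',
    coordVector_coordCovector (IsManifold.chart_mem_maximalAtlas _) hx']

theorem isInvertible_metric {p x : RootManifold M}
    (hx : x ∈ (chartAt (EuclideanHalfSpace n) p).source)
    (h0 : ((chartAt (EuclideanHalfSpace n) p).extend (𝓡∂ n) x) 0 ≠ 0)
    (hρ : 0 < G.ρ x.toBase) : (G.metric x).IsInvertible := by
  have hx' : x.toBase ∈ (chartAt (EuclideanHalfSpace n) p.toBase).source := by
    rw [rootChart_source] at hx; exact hx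
  have he := IsManifold.chart_mem_maximalAtlas (I := 𝓡∂ n) (n := ∞) p
  have hpos : ∀ v : TangentSpace (𝓡∂ n) x, v ≠ 0 → 0 < G.metric x v v := by
    intro v hv
    rw [metric_eq_metricCoeff G hx]
    refine mul_pos (inv_pos.2 hρ)
      (metricCoeff_pos G.gbar (IsManifold.chart_mem_maximalAtlas _) hx' fun h => hv ?_)
    have h1 := congrArg (diag (coordZero n) (basisZero n)
      (2 * ((chartAt (EuclideanHalfSpace n) p).extend (𝓡∂ n) x) 0)⁻¹ 1) h
    rw [diag_diag coordZero_basisZero, inv_mul_cancel₀ (by simpa using h0), mul_one, diag_same,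
      one_smul, map_zero] at h1
    rw [← coordVector_coordCovector he hx v, h1, map_zero]
  exact isInvertible_of_pos (E := EuclideanSpace ℝ (Fin n)) (B := G.metric x) hpos

/-- The velocity of a geodesic in the coordinates `(x, y)`. -/
theorem coordCovector_sharp {p x : RootManifold M} {a : EuclideanSpace ℝ (Fin n) → ℝ}
    (hx : x ∈ (chartAt (EuclideanHalfSpace n) p).source)
    (h0 : ((chartAt (EuclideanHalfSpace n) p).extend (𝓡∂ n) x) 0 ≠ 0)
    (hρ : 0 < G.ρ x.toBase)
    (ha : G.ρ x.toBase = ((chartAt (EuclideanHalfSpace n) p).extend (𝓡∂ n) x) 0 ^ 2 *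
      a (squareMap ((chartAt (EuclideanHalfSpace n) p).extend (𝓡∂ n) x)))
    (ζ : TangentSpace (𝓡∂ n) x →L[ℝ] ℝ) :
    coordCovector (chartAt (EuclideanHalfSpace n) p) x (G.sharp x ζ) =
      modelVelocity (coordZero n) (basisZero n) (rootDualMetric G p a)
        ((chartAt (EuclideanHalfSpace n) p).extend (𝓡∂ n) x)
        (ζ.comp (coordVector (chartAt (EuclideanHalfSpace n) p) x)) := by
  have hx' : x.toBase ∈ (chartAt (EuclideanHalfSpace n) p.toBase).source := by
    rw [rootChart_source] at hx; exact hx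
  have he := IsManifold.chart_mem_maximalAtlas (I := 𝓡∂ n) (n := ∞) p
  set ê := chartAt (EuclideanHalfSpace n) p with hê
  set z := ê.extend (𝓡∂ n) x with hz
  set V := modelVelocity (coordZero n) (basisZero n) (rootDualMetric G p a) z
        (ζ.comp (coordVector ê x)) with hV
  have hB : (metricCoeff G.gbar (chartAt (EuclideanHalfSpace n) p.toBase) x.toBase).IsInvertible :=
    isInvertible_of_pos fun v hv =>
      metricCoeff_pos G.gbar (IsManifold.chart_mem_maximalAtlas _) hx' hv
  have hk : ∀ R, rootDualMetric G p a z R = a (squareMap z) •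
      (metricCoeff G.gbar (chartAt (EuclideanHalfSpace n) p.toBase) x.toBase).inverse R := by
    intro R
    have h1 : ((chartAt (EuclideanHalfSpace n) p.toBase).extend (𝓡∂ n)).symm (squareMap z) =
        x.toBase := by
      rw [hz, hê, squareMap_rootChart, PartialEquiv.left_inv]
      rwa [OpenPartialHomeomorph.extend_source]
    rw [rootDualMetric, h1]
    rfl
  -- By invertibility of `g` it suffices to lower the index of the candidate. Each side contributes
  -- a product of `diag (2x) 1` and `diag (1 / 2) x`, which is the scalar `x`, and the resulting `x²
  -- a` cancels `ρ`.
  have hm : G.metric x (coordVector ê x V) = ζ := by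
    refine ContinuousLinearMap.ext fun w => ?_
    have hw := coordVector_coordCovector he hx w
    rw [metric_eq_metricCoeff G hx, coordCovector_coordVector he hx, hV, modelVelocity,
      diag_diag coordZero_basisZero, hk]
    change (G.ρ x.toBase)⁻¹ * metricCoeff G.gbar _ _ (diag _ _ (2 * z 0 * (1 / 2)) (1 * z 0) _) _ = _
    rw [show 2 * z 0 * (1 / 2) = z 0 by ring, one_mul, diag_same, map_smul, map_smul,
      hB.self_apply_inverse]
    change (G.ρ x.toBase)⁻¹ * (z 0 * (a (squareMap z) * (ζ (coordVector ê x
      (diag (coordZero n) (basisZero n) (1 / 2) (z 0) (diag (coordZero n) (basisZero n) (2 * z 0) 1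
        (coordCovector ê x w))))))) = _
    rw [diag_diag coordZero_basisZero, mul_one, show 1 / 2 * (2 * z 0) = z 0 by ring, diag_same,
      map_smul, map_smul, hw, smul_eq_mul, ha]
    have h3 : z 0 ^ 2 * a (squareMap z) ≠ 0 := by rw [← ha]; exact hρ.ne'
    field_simp
    have h4 : a (squareMap z) ≠ 0 := right_ne_zero_of_mul h3
    field_simp
  have hs : G.sharp x ζ = coordVector ê x V := by
    rw [sharp, ← hm]
    exact (isInvertible_metric G hx h0 hρ).inverse_apply_self _
  rw [hs, coordCovector_coordVector he hx]

end Sharp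

/-! ### Model trajectories are maximal geodesics. -/

section Geodesics

variable {n : ℕ} [NeZero n] {M : Type*} [TopologicalSpace M]
    [ChartedSpace (EuclideanHalfSpace n) M] [IsManifold (𝓡∂ n) ∞ M] (G : GasGiant n M)

attribute [local instance] dualMetricAddCommGroup dualMetricGroup dualMetricSpace
  dualMetricDerivGroup dualMetricDerivSpace

/-- A 1-form in the coordinates of a chart. -/
noncomputable def OneForm.inChart {N : Type*} [TopologicalSpace N]
    [ChartedSpace (EuclideanHalfSpace n) N] (f : OneForm n N)
    (e : OpenPartialHomeomorph N (EuclideanHalfSpace n)) (z : EuclideanSpace ℝ (Fin n)) :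
    EuclideanSpace ℝ (Fin n) →L[ℝ] ℝ :=
  (f ((e.extend (𝓡∂ n)).symm z)).comp (coordVector e _)

/-- The hypotheses under which the rescaled dual metric describes the gas giant metric in the
coordinates `(x, y)` on the set `B`. -/
structure IsModelChart (p : RootManifold M) (a : EuclideanSpace ℝ (Fin n) → ℝ)
    (B : Set (EuclideanSpace ℝ (Fin n))) : Prop where
  isOpen : IsOpen B
  mem_target : ∀ z ∈ B,
    squareMap z ∈ ((chartAt (EuclideanHalfSpace n) p.toBase).extend (𝓡∂ n)).target
  contDiffOn : ContDiffOn ℝ ∞ (rootDualMetric G p a) B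
  ρ_eq : ∀ z ∈ B, 0 ≤ z 0 →
    G.ρ (((chartAt (EuclideanHalfSpace n) p).extend (𝓡∂ n)).symm z).toBase =
      z 0 ^ 2 * a (squareMap z)

variable {G} {p : RootManifold M} {a : EuclideanSpace ℝ (Fin n) → ℝ}
  {B : Set (EuclideanSpace ℝ (Fin n))}

theorem IsModelChart.mem_rootChart (h : IsModelChart G p a B) {z : EuclideanSpace ℝ (Fin n)}
    (hz : z ∈ B) (h0 : 0 ≤ z 0) :
    z ∈ ((chartAt (EuclideanHalfSpace n) p).extend (𝓡∂ n)).target :=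
  mem_rootChart_target p h0 (h.mem_target z hz)

theorem IsModelChart.symm_mem_source (h : IsModelChart G p a B) {z : EuclideanSpace ℝ (Fin n)}
    (hz : z ∈ B) (h0 : 0 ≤ z 0) : ((chartAt (EuclideanHalfSpace n) p).extend (𝓡∂ n)).symm z ∈
      (chartAt (EuclideanHalfSpace n) p).source := by
  rw [← OpenPartialHomeomorph.extend_source (I := 𝓡∂ n)]
  exact PartialEquiv.map_target _ (h.mem_rootChart hz h0)

theorem IsModelChart.right_inv (h : IsModelChart G p a B) {z : EuclideanSpace ℝ (Fin n)}
    (hz : z ∈ B) (h0 : 0 ≤ z 0) : (chartAt (EuclideanHalfSpace n) p).extend (𝓡∂ n)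
      (((chartAt (EuclideanHalfSpace n) p).extend (𝓡∂ n)).symm z) = z :=
  PartialEquiv.right_inv _ (h.mem_rootChart hz h0)

theorem ρ_toBase_pos_iff (x : RootManifold M) :
    0 < G.ρ x.toBase ↔ x ∈ (𝓡∂ n).interior (RootManifold M) := by
  have hx := mem_chart_source (EuclideanHalfSpace n) x
  rw [mem_interior_iff_coord (IsManifold.chart_mem_maximalAtlas x) hx]
  have h1 := G.ρ_eq_zero_iff x.toBase
  rw [mem_boundary_iff_coord (IsManifold.chart_mem_maximalAtlas _) (mem_chart_source _ _),
    ← squareMap_rootChart, squareMap_zero] at h1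
  have h2 := G.ρ_nonneg x.toBase
  have h3 : 0 ≤ ((chartAt (EuclideanHalfSpace n) x).extend (𝓡∂ n) x) 0 :=
    (chartAt (EuclideanHalfSpace n) x x).2
  rw [lt_iff_le_and_ne, lt_iff_le_and_ne, ne_comm, ne_comm (a := (0 : ℝ)), ne_eq, ne_eq, h1,
    pow_eq_zero_iff two_ne_zero]
  tauto

theorem IsModelChart.coordCovector_sharp (h : IsModelChart G p a B)
    {z : EuclideanSpace ℝ (Fin n)} (hz : z ∈ B) (h0 : 0 < z 0)
    (ζ : TangentSpace (𝓡∂ n) (((chartAt (EuclideanHalfSpace n) p).extend (𝓡∂ n)).symm z) →L[ℝ] ℝ) :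
    coordCovector (chartAt (EuclideanHalfSpace n) p) _ (G.sharp _ ζ) =
      modelVelocity (coordZero n) (basisZero n) (rootDualMetric G p a) z
        (ζ.comp (coordVector (chartAt (EuclideanHalfSpace n) p) _)) := by
  have hs := h.symm_mem_source hz h0.le
  have hr := h.right_inv hz h0.le
  have hρ : 0 < G.ρ (((chartAt (EuclideanHalfSpace n) p).extend (𝓡∂ n)).symm z).toBase := by
    rw [ρ_toBase_pos_iff, mem_interior_iff_coord (IsManifold.chart_mem_maximalAtlas p) hs, hr]
    exact h0
  have := GasGiant.coordCovector_sharp G (a := a) hs (by rw [hr]; exact h0.ne') hρ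
    (by rw [hr]; exact h.ρ_eq z hz h0.le) ζ
  rwa [hr] at this

theorem apply_modelVelocity {E : Type} [NormedAddCommGroup E] [NormedSpace ℝ E] (ν : E →L[ℝ] ℝ)
    (e : E) (k : E → (E →L[ℝ] ℝ) →L[ℝ] E) (z : E) (P : E →L[ℝ] ℝ) :
    1 / 2 * P (modelVelocity ν e k z P) = modelHamiltonian ν e k (z, P) := rfl

theorem IsModelChart.apply_sharp (h : IsModelChart G p a B)
    {z : EuclideanSpace ℝ (Fin n)} (hz : z ∈ B) (h0 : 0 < z 0)
    (η ζ : TangentSpace (𝓡∂ n) (((chartAt (EuclideanHalfSpace n) p).extend (𝓡∂ n)).symm z) →L[ℝ] ℝ) :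
    η (G.sharp _ ζ) = η (coordVector (chartAt (EuclideanHalfSpace n) p) _
      (modelVelocity (coordZero n) (basisZero n) (rootDualMetric G p a) z
        (ζ.comp (coordVector (chartAt (EuclideanHalfSpace n) p) _)))) := by
  rw [← h.coordCovector_sharp hz h0, coordVector_coordCovector
    (IsManifold.chart_mem_maximalAtlas p) (h.symm_mem_source hz h0.le)]

theorem IsModelChart.chartHamiltonian_eq (h : IsModelChart G p a B)
    {z : EuclideanSpace ℝ (Fin n)} (hz : z ∈ B) (h0 : 0 < z 0)
    (P : EuclideanSpace ℝ (Fin n) →L[ℝ] ℝ) :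
    G.chartHamiltonian (chartAt (EuclideanHalfSpace n) p) (z, P) =
      modelHamiltonian (coordZero n) (basisZero n) (rootDualMetric G p a) (z, P) := by
  have he := IsManifold.chart_mem_maximalAtlas (I := 𝓡∂ n) (n := ∞) p
  have hs := h.symm_mem_source hz h0.le
  rw [← apply_modelVelocity, chartHamiltonian, hamiltonian, h.apply_sharp hz h0]
  have h1 : (P.comp (coordCovector (chartAt (EuclideanHalfSpace n) p)
      (((chartAt (EuclideanHalfSpace n) p).extend (𝓡∂ n)).symm z))).comp
      (coordVector (chartAt (EuclideanHalfSpace n) p) _) = P := by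
    rw [ContinuousLinearMap.comp_assoc, coordCovector_comp_coordVector he hs]
    exact P.comp_id
  rw [h1, ContinuousLinearMap.comp_apply, coordCovector_coordVector he hs]

/-- Trajectories of the model Hamiltonian are geodesics of the gas giant. -/
theorem IsModelChart.exists_maximalGeodesic (h : IsModelChart G p a B) {τ : ℝ}
    {z : ℝ → EuclideanSpace ℝ (Fin n)} {P : ℝ → EuclideanSpace ℝ (Fin n) →L[ℝ] ℝ}
    (ht : IsModelTrajectory (coordZero n) (basisZero n) (rootDualMetric G p a) B τ z P) :
    ∃ c : G.MaximalGeodesic, ∀ f : OneForm n (RootManifold M), G.xray f c =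
      ∫ t in (0 : ℝ)..τ, f.inChart (chartAt (EuclideanHalfSpace n) p) (z t)
        (modelVelocity (coordZero n) (basisZero n) (rootDualMetric G p a) (z t) (P t)) := by
  have he := IsManifold.chart_mem_maximalAtlas (I := 𝓡∂ n) (n := ∞) p
  set ê := chartAt (EuclideanHalfSpace n) p with hê
  have hpos : ∀ t ∈ Icc 0 τ, 0 ≤ z t 0 := by
    intro t ht'
    rcases eq_or_lt_of_le ht'.1 with h1 | h1
    · rw [← h1]; exact ht.start_mem.ge
    rcases eq_or_lt_of_le ht'.2 with h2 | h2
    · rw [h2]; exact ht.end_mem.ge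
    exact (ht.interior_mem t ⟨h1, h2⟩).le
  have hipos : ∀ t ∈ Ioo 0 τ, 0 < z t 0 := fun t ht' => ht.interior_mem t ht'
  let γ : ℝ → RootManifold M := fun t => (ê.extend (𝓡∂ n)).symm (z t)
  let ζ : ∀ t, TangentSpace (𝓡∂ n) (γ t) →L[ℝ] ℝ := fun t => (P t).comp (coordCovector ê (γ t))
  have hγs : ∀ t ∈ Icc 0 τ, γ t ∈ ê.source := fun t ht' =>
    h.symm_mem_source (ht.mem t ht') (hpos t ht')
  have hγz : ∀ t ∈ Icc 0 τ, ê.extend (𝓡∂ n) (γ t) = z t := fun t ht' =>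
    h.right_inv (ht.mem t ht') (hpos t ht')
  have hζP : ∀ t ∈ Icc 0 τ, (ζ t).comp (coordVector ê (γ t)) = P t := by
    intro t ht'
    rw [ContinuousLinearMap.comp_assoc, coordCovector_comp_coordVector he (hγs t ht')]
    exact (P t).comp_id
  have h0 : (0 : ℝ) ∈ Icc 0 τ := ⟨le_rfl, ht.pos.le⟩
  have h1 : τ ∈ Icc 0 τ := ⟨ht.pos.le, le_rfl⟩
  refine ⟨⟨τ, ht.pos, γ, ζ, ?_, ?_, ?_, ?_, ?_, ?_⟩, ?_⟩
  · intro t ht'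
    refine continuousWithinAt_cotangent_curve he (hγs t ht') ?_ ?_
    · exact (OpenPartialHomeomorph.continuousAt_extend_symm' ê
        (h.mem_rootChart (ht.mem t ht') (hpos t ht'))).comp_continuousWithinAt
        (ht.continuousOn_point t ht')
    · exact (ht.continuousOn_covector t ht').congr hζP (hζP t ht')
  · rw [mem_boundary_iff_coord he (hγs 0 h0), hγz 0 h0]
    exact ht.start_mem
  · rw [mem_boundary_iff_coord he (hγs τ h1), hγz τ h1]
    exact ht.end_mem
  · intro t ht'
    rw [mem_interior_iff_coord he (hγs t (Ioo_subset_Icc_self ht')),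
      hγz t (Ioo_subset_Icc_self ht')]
    exact hipos t ht'
  · intro t ht'
    have ht'' := Ioo_subset_Icc_self ht'
    have h2 := h.apply_sharp (ht.mem t ht'') (hipos t ht') (ζ t) (ζ t)
    have h3 := hζP t ht''
    have h4 := ht.energy t ht'
    rw [← apply_modelVelocity] at h4
    have h5 : (ζ t) (coordVector ê (γ t) (modelVelocity (coordZero n) (basisZero n)
        (rootDualMetric G p a) (z t) (P t))) = P t (modelVelocity (coordZero n) (basisZero n)
        (rootDualMetric G p a) (z t) (P t)) :=
      DFunLike.congr_fun h3 _
    refine h2.trans ?_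
    rw [show (ζ t).comp (coordVector (chartAt (EuclideanHalfSpace n) p)
      (((chartAt (EuclideanHalfSpace n) p).extend (𝓡∂ n)).symm (z t))) = P t from h3]
    refine h5.trans ?_
    linarith
  · intro t ht'
    have ht'' := Ioo_subset_Icc_self ht'
    have hev : ∀ᶠ s in 𝓝 t, s ∈ Icc 0 τ :=
      mem_of_superset (isOpen_Ioo.mem_nhds ht') Ioo_subset_Icc_self
    refine ⟨ê, he, hγs t ht'', _, _, (ht.deriv_point t ht').congr_of_eventuallyEq
      (hev.mono hγz), (ht.deriv_covector t ht').congr_of_eventuallyEq (hev.mono hζP), ?_⟩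
    rw [hγz t ht'', hζP t ht'', neg_neg]
    have hk : DifferentiableAt ℝ (rootDualMetric G p a) (z t) :=
      (h.contDiffOn.contDiffAt (h.isOpen.mem_nhds (ht.mem t ht''))).differentiableAt (by simp)
    refine (hasFDerivAt_modelHamiltonian hk
      (rootDualMetric_symm G p (h.mem_target _ (ht.mem t ht'')))).congr_of_eventuallyEq ?_
    -- The two Hamiltonians are compared only for positive `x`, but this is an open condition and
    -- holds near the current interior point, so the derivatives agree.
    have hB : ∀ᶠ w : EuclideanSpace ℝ (Fin n) × (EuclideanSpace ℝ (Fin n) →L[ℝ] ℝ) in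
        𝓝 (z t, P t), w.1 ∈ B ∧ 0 < coordZero n w.1 := by
      refine (continuousAt_fst.eventually (h.isOpen.mem_nhds (ht.mem t ht''))).and ?_
      exact ((coordZero n).continuous.comp continuous_fst).continuousAt.eventually
        (lt_mem_nhds (hipos t ht'))
    filter_upwards [hB] with w hw
    exact h.chartHamiltonian_eq hw.1 hw.2 w.2
  · intro f
    rw [xray]
    simp only
    -- The velocity `ζ♯` is not meaningful over the boundary; the two end times form a null set and
    -- are discarded.
    rw [intervalIntegral.integral_of_le ht.pos.le, intervalIntegral.integral_of_le ht.pos.le,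
      MeasureTheory.integral_Ioc_eq_integral_Ioo, MeasureTheory.integral_Ioc_eq_integral_Ioo]
    refine MeasureTheory.setIntegral_congr_fun measurableSet_Ioo fun t ht' => ?_
    have ht'' := Ioo_subset_Icc_self ht'
    have h2 := h.apply_sharp (ht.mem t ht'') (hipos t ht') (f (γ t)) (ζ t)
    rw [show (ζ t).comp (coordVector (chartAt (EuclideanHalfSpace n) p)
      (((chartAt (EuclideanHalfSpace n) p).extend (𝓡∂ n)).symm (z t))) = P t from hζP t ht''] at h2
    exact h2

end Geodesics

/-! ### Existence of model charts at boundary points. -/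

section ModelChart

variable {n : ℕ} [NeZero n]

theorem exists_halfBall_subset_target {N : Type*} [TopologicalSpace N]
    [ChartedSpace (EuclideanHalfSpace n) N] {e : OpenPartialHomeomorph N (EuclideanHalfSpace n)}
    {p : N} (hp : p ∈ e.source) :
    ∃ r > 0, halfBall (e.extend (𝓡∂ n) p) r ⊆ (e.extend (𝓡∂ n)).target := by
  have h := e.extend_target_mem_nhdsWithin (I := 𝓡∂ n) hp
  rw [range_model, Metric.mem_nhdsWithin_iff] at h
  exact h

theorem halfBall_mem_nhdsWithin {z₀ z : EuclideanSpace ℝ (Fin n)} {r : ℝ} (hz : z ∈ halfBall z₀ r) :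
    halfBall z₀ r ∈ 𝓝[range (𝓡∂ n)] z := by
  rw [range_model, halfBall, inter_comm]
  exact inter_mem self_mem_nhdsWithin
    (mem_nhdsWithin_of_mem_nhds (Metric.isOpen_ball.mem_nhds (mem_halfBall.1 hz).1))

theorem contDiffWithinAt_range_iff {F : Type*} [NormedAddCommGroup F] [NormedSpace ℝ F]
    {z₀ z : EuclideanSpace ℝ (Fin n)} {r : ℝ} (hz : z ∈ halfBall z₀ r)
    {g : EuclideanSpace ℝ (Fin n) → F} :
    ContDiffWithinAt ℝ ∞ g (range (𝓡∂ n)) z ↔ ContDiffWithinAt ℝ ∞ g (halfBall z₀ r) z := by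
  have hsub : halfBall z₀ r ⊆ range (𝓡∂ n) := by
    rw [range_model]; exact fun w hw => (mem_halfBall.1 hw).2
  exact ⟨fun h => h.mono hsub, fun h => h.mono_of_mem_nhdsWithin (halfBall_mem_nhdsWithin hz)⟩

/-- A smooth function on the manifold is smooth in coordinates. -/
theorem contDiffOn_halfBall_of_contMDiffAt {N : Type*} [TopologicalSpace N]
    [ChartedSpace (EuclideanHalfSpace n) N] [IsManifold (𝓡∂ n) ∞ N]
    {F : Type*} [NormedAddCommGroup F] [NormedSpace ℝ F]
    {e : OpenPartialHomeomorph N (EuclideanHalfSpace n)}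
    (he : e ∈ IsManifold.maximalAtlas (𝓡∂ n) ∞ N) {g : N → F}
    {z₀ : EuclideanSpace ℝ (Fin n)} {r : ℝ} (hr : halfBall z₀ r ⊆ (e.extend (𝓡∂ n)).target)
    (hg : ∀ z ∈ halfBall z₀ r, ContMDiffAt (𝓡∂ n) 𝓘(ℝ, F) ∞ g ((e.extend (𝓡∂ n)).symm z)) :
    ContDiffOn ℝ ∞ (fun z => g ((e.extend (𝓡∂ n)).symm z)) (halfBall z₀ r) := by
  intro z hz
  have hs : (e.extend (𝓡∂ n)).symm z ∈ e.source := by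
    rw [← e.extend_source (I := 𝓡∂ n)]
    exact PartialEquiv.map_target _ (hr hz)
  have h := contDiffWithinAt_of_contMDiffAt he hs (hg z hz)
  rw [PartialEquiv.right_inv _ (hr hz)] at h
  exact (contDiffWithinAt_range_iff hz).1 h

/-- For positive first coordinate one divides; at the boundary the sign passes to the limit along
the inward normal. -/
theorem nonneg_of_coord_mul_nonneg {z₀ : EuclideanSpace ℝ (Fin n)} {r : ℝ}
    {a : EuclideanSpace ℝ (Fin n) → ℝ} (ha : ContinuousOn a (halfBall z₀ r))
    (h : ∀ z ∈ halfBall z₀ r, 0 ≤ z 0 * a z) : ∀ z ∈ halfBall z₀ r, 0 ≤ a z := by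
  intro z hz
  rw [mem_halfBall] at hz
  rcases hz.2.lt_or_eq with h0 | h0
  · exact nonneg_of_mul_nonneg_right (h z (mem_halfBall.2 hz)) h0
  have hl : Tendsto (fun t : ℝ => z + t • basisZero n) (𝓝[>] 0) (𝓝[halfBall z₀ r] z) := by
    have h1 : Tendsto (fun t : ℝ => z + t • basisZero n) (𝓝 0) (𝓝 z) := by
      have : Continuous (fun t : ℝ => z + t • basisZero n) := by fun_prop
      simpa using this.tendsto 0
    refine tendsto_nhdsWithin_iff.2 ⟨h1.mono_left nhdsWithin_le_nhds, ?_⟩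
    filter_upwards [(h1.eventually (Metric.isOpen_ball.mem_nhds
      (Metric.mem_ball.2 hz.1))).filter_mono nhdsWithin_le_nhds, self_mem_nhdsWithin] with t ht ht'
    have ht' : 0 < t := ht'
    exact mem_halfBall.2 ⟨Metric.mem_ball.1 ht, by simp [← h0, ht'.le]⟩
  refine ge_of_tendsto ((ha z (mem_halfBall.2 hz)).tendsto.comp hl) ?_
  filter_upwards [hl.eventually self_mem_nhdsWithin, self_mem_nhdsWithin] with t ht ht'
  have ht' : 0 < t := ht'
  have := h _ ht
  refine nonneg_of_mul_nonneg_right this ?_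
  simp [← h0, ht']

variable {M : Type*} [TopologicalSpace M]
    [ChartedSpace (EuclideanHalfSpace n) M] [IsManifold (𝓡∂ n) ∞ M] (G : GasGiant n M)

/-- In a chart, a boundary defining function is a positive multiple of the first coordinate. -/
theorem exists_ρ_eq_coord_mul {p : M} (hp : p ∈ (𝓡∂ n).boundary M) :
    ∃ r > 0, ∃ a : EuclideanSpace ℝ (Fin n) → ℝ,
      halfBall ((chartAt (EuclideanHalfSpace n) p).extend (𝓡∂ n) p) r ⊆
        ((chartAt (EuclideanHalfSpace n) p).extend (𝓡∂ n)).target ∧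
      ContDiffOn ℝ ∞ a (halfBall ((chartAt (EuclideanHalfSpace n) p).extend (𝓡∂ n) p) r) ∧
      ∀ z ∈ halfBall ((chartAt (EuclideanHalfSpace n) p).extend (𝓡∂ n) p) r, 0 < a z ∧
        G.ρ (((chartAt (EuclideanHalfSpace n) p).extend (𝓡∂ n)).symm z) = z 0 * a z := by
  have he := IsManifold.chart_mem_maximalAtlas (I := 𝓡∂ n) (n := ∞) p
  have hps := mem_chart_source (EuclideanHalfSpace n) p
  set e := chartAt (EuclideanHalfSpace n) p
  set z₀ := e.extend (𝓡∂ n) p with hz₀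
  obtain ⟨r, hr, hrt⟩ := exists_halfBall_subset_target hps
  have h0 : z₀ 0 = 0 := (mem_boundary_iff_coord he hps).1 hp
  have hs : ∀ z ∈ halfBall z₀ r, (e.extend (𝓡∂ n)).symm z ∈ e.source := fun z hz => by
    rw [← e.extend_source (I := 𝓡∂ n)]
    exact PartialEquiv.map_target _ (hrt hz)
  have hri : ∀ z ∈ halfBall z₀ r, e.extend (𝓡∂ n) ((e.extend (𝓡∂ n)).symm z) = z := fun z hz =>
    PartialEquiv.right_inv _ (hrt hz)
  have hρ := contDiffOn_halfBall_of_contMDiffAt he hrt (fun z _ => G.contMDiff_ρ _)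
  have hb : ∀ z ∈ halfBall z₀ r, (z 0 = 0 ↔ G.ρ ((e.extend (𝓡∂ n)).symm z) = 0) := by
    intro z hz
    rw [G.ρ_eq_zero_iff, mem_boundary_iff_coord he (hs z hz), hri z hz]
  obtain ⟨a, ha, hρa⟩ := exists_eq_coord_smul h0 hρ fun z hz hz0 => (hb z hz).1 hz0
  refine ⟨r, hr, a, hrt, ha, fun z hz => ⟨?_, hρa z hz⟩⟩
  have hnn := nonneg_of_coord_mul_nonneg ha.continuousOn
    (fun z hz => by rw [← smul_eq_mul, ← hρa z hz]; exact G.ρ_nonneg _) z hz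
  refine lt_of_le_of_ne hnn fun hz' => ?_
  -- If `a` vanished at a boundary point, the differential of `ρ = s a` would vanish there. At an
  -- interior point `ρ` itself would vanish.
  by_cases hz0 : z 0 = 0
  · have h1 : HasFDerivWithinAt (fun w => w 0 * a w)
        (z 0 • fderivWithin ℝ a (halfBall z₀ r) z + a z • coordZero n) (halfBall z₀ r) z :=
      (coordZero n).hasFDerivWithinAt.mul
        ((ha.differentiableOn (by simp)) z hz).hasFDerivWithinAt
    rw [hz0, ← hz', zero_smul, zero_smul, add_zero] at h1
    have h2 : HasFDerivWithinAt (fun w => G.ρ ((e.extend (𝓡∂ n)).symm w))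
        (0 : EuclideanSpace ℝ (Fin n) →L[ℝ] ℝ) (range (𝓡∂ n)) z :=
      (h1.congr (fun w hw => hρa w hw) (hρa z hz)).mono_of_mem_nhdsWithin
        (halfBall_mem_nhdsWithin hz)
    have h3 : G.ρ =ᶠ[𝓝 ((e.extend (𝓡∂ n)).symm z)]
        fun x => G.ρ ((e.extend (𝓡∂ n)).symm (e.extend (𝓡∂ n) x)) := by
      filter_upwards [e.open_source.mem_nhds (hs z hz)] with x hx
      rw [e.extend_left_inv hx]
    rw [← hri z hz] at h2
    have h4 := differential_eq_comp he (hs z hz) h2 h3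
    refine G.mfderiv_ρ_ne_zero _ ?_ (h4.trans (ContinuousLinearMap.zero_comp _))
    rw [mem_boundary_iff_coord he (hs z hz), hri z hz, hz0]
  · exact hz0 ((hb z hz).2 (by rw [hρa z hz, ← hz', smul_zero]))

theorem squareMap_eq_self {z : EuclideanSpace ℝ (Fin n)} (hz : z 0 = 0) : squareMap z = z := by
  ext i
  by_cases hi : i = 0
  · subst hi; simp [hz]
  · rw [squareMap_of_ne _ hi]

theorem mem_boundary_toBase_iff (p : RootManifold M) :
    p.toBase ∈ (𝓡∂ n).boundary M ↔ p ∈ (𝓡∂ n).boundary (RootManifold M) := by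
  rw [mem_boundary_iff_coord (IsManifold.chart_mem_maximalAtlas _) (mem_chart_source _ p.toBase),
    mem_boundary_iff_coord (IsManifold.chart_mem_maximalAtlas _) (mem_chart_source _ p),
    ← squareMap_rootChart, squareMap_zero, pow_eq_zero_iff two_ne_zero]

/-- A full ball is available, negative first coordinates included, because `squareMap` sends a small
ball into the half ball on which `ρ = s a`. -/
theorem exists_isModelChart {p : RootManifold M} (hp : p ∈ (𝓡∂ n).boundary (RootManifold M)) :
    ∃ r > 0, ∃ a : EuclideanSpace ℝ (Fin n) → ℝ,
      IsModelChart G p a (Metric.ball ((chartAt (EuclideanHalfSpace n) p).extend (𝓡∂ n) p) r) ∧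
      ∀ z ∈ Metric.ball ((chartAt (EuclideanHalfSpace n) p).extend (𝓡∂ n) p) r,
        0 < a (squareMap z) ∧ ContDiffAt ℝ ∞ (fun z => a (squareMap z)) z := by
  have h0 := (mem_boundary_iff_coord (IsManifold.chart_mem_maximalAtlas p)
    (mem_chart_source _ p)).1 hp
  obtain ⟨r₀, hr₀, a, hrt, ha, hρa⟩ := exists_ρ_eq_coord_mul G ((mem_boundary_toBase_iff p).2 hp)
  rw [← squareMap_rootChart, squareMap_eq_self h0] at hrt ha hρa
  set z₀ := (chartAt (EuclideanHalfSpace n) p).extend (𝓡∂ n) p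
  obtain ⟨r, hr, hrr⟩ := Metric.nhds_basis_ball.mem_iff.1
    (contDiff_squareMap.continuous.continuousAt.preimage_mem_nhds
      (by rw [squareMap_eq_self h0]; exact Metric.ball_mem_nhds z₀ hr₀))
  have hmaps : MapsTo squareMap (Metric.ball z₀ r) (halfBall z₀ r₀) := fun z hz =>
    mem_halfBall.2 ⟨Metric.mem_ball.1 (hrr hz), by rw [squareMap_zero]; exact sq_nonneg _⟩
  refine ⟨r, hr, a, ⟨Metric.isOpen_ball, fun z hz => hrt (hmaps hz),
    contDiffOn_rootDualMetric G p ha hmaps hrt, fun z hz hz0 => ?_⟩, fun z hz =>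
    ⟨(hρa _ (hmaps hz)).1, (ha.comp contDiff_squareMap.contDiffOn hmaps).contDiffAt
      (Metric.isOpen_ball.mem_nhds hz)⟩⟩
  rw [toBase_rootChart_symm p (mem_rootChart_target p hz0 (hrt (hmaps hz))),
    (hρa _ (hmaps hz)).2, squareMap_zero]

end ModelChart

/-! ### Calculus of smooth 1-forms at a point. -/

section SmoothForms

set_option linter.unusedSectionVars false

variable {n : ℕ} [NeZero n] {N : Type*} [TopologicalSpace N] [ChartedSpace (EuclideanHalfSpace n) N]
  [IsManifold (𝓡∂ n) ∞ N] {e : OpenPartialHomeomorph N (EuclideanHalfSpace n)} {p : N}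

/-- Smoothness of a 1-form at a point. -/
def OneForm.SmoothAt (u : OneForm n N) (p : N) : Prop :=
  ContMDiffAt (𝓡∂ n) ((𝓡∂ n).prod 𝓘(ℝ, EuclideanSpace ℝ (Fin n) →L[ℝ] ℝ)) ∞
    (fun x => TotalSpace.mk' (EuclideanSpace ℝ (Fin n) →L[ℝ] ℝ)
      (E := fun p : N => TangentSpace (𝓡∂ n) p →L[ℝ] ℝ) x (u x)) p

theorem OneForm.smoothAt_iff (he : e ∈ IsManifold.maximalAtlas (𝓡∂ n) ∞ N) (hp : p ∈ e.source)
    {u : OneForm n N} : u.SmoothAt p ↔ ContMDiffAt (𝓡∂ n) 𝓘(ℝ, EuclideanSpace ℝ (Fin n) →L[ℝ] ℝ) ∞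
      (fun x => (u x).comp (coordVector e x)) p := contMDiffAt_oneForm_iff he hp u

theorem OneForm.SmoothAt.add {u v : OneForm n N} (hu : u.SmoothAt p) (hv : v.SmoothAt p) :
    OneForm.SmoothAt (fun x => u x + v x) p := by
  rw [OneForm.smoothAt_iff (IsManifold.chart_mem_maximalAtlas p) (mem_chart_source _ p)] at *
  refine (ContMDiffAt.add hu hv).congr_of_eventuallyEq (Eventually.of_forall fun x => ?_)
  exact ContinuousLinearMap.add_comp _ _ _

theorem OneForm.SmoothAt.sub {u v : OneForm n N} (hu : u.SmoothAt p) (hv : v.SmoothAt p) :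
    OneForm.SmoothAt (fun x => u x - v x) p := by
  rw [OneForm.smoothAt_iff (IsManifold.chart_mem_maximalAtlas p) (mem_chart_source _ p)] at *
  refine (ContMDiffAt.sub hu hv).congr_of_eventuallyEq (Eventually.of_forall fun x => ?_)
  exact ContinuousLinearMap.sub_comp _ _ _

theorem OneForm.SmoothAt.smul {g : N → ℝ} {u : OneForm n N}
    (hg : ContMDiffAt (𝓡∂ n) 𝓘(ℝ, ℝ) ∞ g p) (hu : u.SmoothAt p) :
    OneForm.SmoothAt (fun x => g x • u x) p := by
  rw [OneForm.smoothAt_iff (IsManifold.chart_mem_maximalAtlas p) (mem_chart_source _ p)] at *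
  refine (ContMDiffAt.smul hg hu).congr_of_eventuallyEq (Eventually.of_forall fun x => ?_)
  exact ContinuousLinearMap.smul_comp _ _ _

theorem OneForm.SmoothAt.congr {u v : OneForm n N} (hu : u.SmoothAt p)
    (h : ∀ᶠ x in 𝓝 p, v x = u x) : v.SmoothAt p := by
  refine ContMDiffAt.congr_of_eventuallyEq hu ?_
  filter_upwards [h] with x hx
  rw [hx]

theorem smoothAt_differential {h : N → ℝ} (hh : ContMDiffAt (𝓡∂ n) 𝓘(ℝ, ℝ) ∞ h p) :
    (differential n h).SmoothAt p := by
  rw [OneForm.smoothAt_iff (IsManifold.chart_mem_maximalAtlas p) (mem_chart_source _ p)]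
  refine (hh.mfderiv_const (m := ∞) (by simp)).congr_of_eventuallyEq ?_
  filter_upwards [(chartAt (EuclideanHalfSpace n) p).open_source.mem_nhds (mem_chart_source _ p)]
    with x hx
  have h2 := TangentBundle.continuousLinearMapAt_model_space (𝕜 := ℝ) (h p) (h x)
  simp only [inTangentCoordinates, ContinuousLinearMap.inCoordinates]
  rw [h2]
  exact congrArg (fun L => (mfderiv (𝓡∂ n) 𝓘(ℝ, ℝ) h x).comp L) (symmL_eq_coordVector hx).symm

theorem differential_sub {g h : N → ℝ} (hg : ContMDiffAt (𝓡∂ n) 𝓘(ℝ, ℝ) ∞ g p)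
    (hh : ContMDiffAt (𝓡∂ n) 𝓘(ℝ, ℝ) ∞ h p) :
    differential n (fun x => g x - h x) p = differential n g p - differential n h p :=
  mfderiv_sub (hg.mdifferentiableAt (by simp)) (hh.mdifferentiableAt (by simp))

theorem differential_mul {g h : N → ℝ} (hg : ContMDiffAt (𝓡∂ n) 𝓘(ℝ, ℝ) ∞ g p)
    (hh : ContMDiffAt (𝓡∂ n) 𝓘(ℝ, ℝ) ∞ h p) :
    differential n (fun x => g x * h x) p = g p • differential n h p + h p • differential n g p :=
  ((hg.mdifferentiableAt (by simp)).hasMFDerivAt.mul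
    (hh.mdifferentiableAt (by simp)).hasMFDerivAt).mfderiv

theorem differential_congr {g h : N → ℝ} (hgh : g =ᶠ[𝓝 p] h) :
    differential n g p = differential n h p := by
  rw [differential, hgh.mfderiv_eq]
  rfl

/-- What holds near a boundary point holds on a half ball in a chart. -/
theorem exists_halfBall_of_eventually (hp : p ∈ e.source) {Q : N → Prop} (hQ : ∀ᶠ x in 𝓝 p, Q x) :
    ∃ r > 0, halfBall (e.extend (𝓡∂ n) p) r ⊆ (e.extend (𝓡∂ n)).target ∧
      ∀ z ∈ halfBall (e.extend (𝓡∂ n) p) r, Q ((e.extend (𝓡∂ n)).symm z) := by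
  have h := e.extend_target_mem_nhdsWithin (I := 𝓡∂ n) hp
  have h2 : ∀ᶠ z in 𝓝[range (𝓡∂ n)] (e.extend (𝓡∂ n) p), Q ((e.extend (𝓡∂ n)).symm z) := by
    have hc := (e.continuousAt_extend_symm (I := 𝓡∂ n) hp).tendsto
    rw [e.extend_left_inv hp] at hc
    exact (hc.eventually hQ).filter_mono nhdsWithin_le_nhds
  have h3 := inter_mem h h2
  rw [range_model, Metric.mem_nhdsWithin_iff] at h3
  obtain ⟨r, hr, hr'⟩ := h3
  exact ⟨r, hr, fun z hz => (hr' hz).1, fun z hz => (hr' hz).2⟩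

theorem eventually_mem_halfBall (hp : p ∈ e.source) {r : ℝ} (hr : 0 < r) :
    ∀ᶠ x in 𝓝 p, x ∈ e.source ∧ e.extend (𝓡∂ n) x ∈ halfBall (e.extend (𝓡∂ n) p) r := by
  filter_upwards [e.open_source.mem_nhds hp, (e.continuousAt_extend (I := 𝓡∂ n) hp).preimage_mem_nhds
    (Metric.ball_mem_nhds _ hr)] with x hx hx'
  exact ⟨hx, mem_halfBall.2 ⟨Metric.mem_ball.1 hx', (e x).2⟩⟩

theorem contMDiffAt_of_contDiffOn_halfBall {F : Type*} [NormedAddCommGroup F] [NormedSpace ℝ F]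
    {g : EuclideanSpace ℝ (Fin n) → F} (he : e ∈ IsManifold.maximalAtlas (𝓡∂ n) ∞ N)
    (hp : p ∈ e.source) {z₀ : EuclideanSpace ℝ (Fin n)} {r : ℝ} (hg : ContDiffOn ℝ ∞ g (halfBall z₀ r))
    (hpr : e.extend (𝓡∂ n) p ∈ halfBall z₀ r) :
    ContMDiffAt (𝓡∂ n) 𝓘(ℝ, F) ∞ (fun x => g (e.extend (𝓡∂ n) x)) p :=
  contMDiffAt_of_contDiffWithinAt he hp ((contDiffWithinAt_range_iff hpr).2 (hg _ hpr))

end SmoothForms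

/-! ### The boundary defining function `√ρ`. -/

section BoundaryDefining

variable {n : ℕ} [NeZero n] {M : Type*} [TopologicalSpace M]
    [ChartedSpace (EuclideanHalfSpace n) M] [IsManifold (𝓡∂ n) ∞ M] (G : GasGiant n M)
    {p : RootManifold M}

theorem x_eq_zero_iff (p : RootManifold M) : G.x p = 0 ↔ p ∈ (𝓡∂ n).boundary (RootManifold M) := by
  rw [x, Real.sqrt_eq_zero (G.ρ_nonneg _), G.ρ_eq_zero_iff, mem_boundary_toBase_iff]

/-- Near the boundary, `√ρ` is a positive smooth multiple of the first coordinate. -/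
theorem exists_x_eq_coord_mul (hp : p ∈ (𝓡∂ n).boundary (RootManifold M)) :
    ∃ μ : RootManifold M → ℝ, ∀ᶠ x in 𝓝 p, ContMDiffAt (𝓡∂ n) 𝓘(ℝ, ℝ) ∞ μ x ∧ 0 < μ x ∧
      G.x x = ((chartAt (EuclideanHalfSpace n) p).extend (𝓡∂ n) x) 0 * μ x := by
  obtain ⟨r, hr, a, hm, ha⟩ := exists_isModelChart G hp
  have he := IsManifold.chart_mem_maximalAtlas (I := 𝓡∂ n) (n := ∞) p
  refine ⟨fun x => √(a (squareMap ((chartAt (EuclideanHalfSpace n) p).extend (𝓡∂ n) x))), ?_⟩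
  filter_upwards [eventually_mem_halfBall (mem_chart_source (EuclideanHalfSpace n) p) hr] with x hx
  have hb : (chartAt (EuclideanHalfSpace n) p).extend (𝓡∂ n) x ∈
    Metric.ball ((chartAt (EuclideanHalfSpace n) p).extend (𝓡∂ n) p) r :=
    Metric.mem_ball.2 (mem_halfBall.1 hx.2).1
  obtain ⟨ha1, ha2⟩ := ha _ hb
  refine ⟨contMDiffAt_of_contDiffWithinAt (g := fun z => √(a (squareMap z))) he hx.1
    (ha2.sqrt ha1.ne').contDiffWithinAt, Real.sqrt_pos.2 ha1, ?_⟩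
  have h0 := (mem_halfBall.1 hx.2).2
  have h1 := hm.ρ_eq _ hb h0
  rw [OpenPartialHomeomorph.extend_left_inv _ hx.1] at h1
  rw [GasGiant.x, h1, Real.sqrt_mul (sq_nonneg _), Real.sqrt_sq h0]

/-- At the boundary `√ρ` is the coordinate `x` times a smooth positive function; in the interior the
square root is smooth because `ρ` is nonzero. -/
theorem contMDiff_x : ContMDiff (𝓡∂ n) 𝓘(ℝ, ℝ) ∞ G.x := by
  intro p
  by_cases hp : p ∈ (𝓡∂ n).boundary (RootManifold M)
  · obtain ⟨μ, hμ⟩ := exists_x_eq_coord_mul G hp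
    have h1 : ContMDiffAt (𝓡∂ n) 𝓘(ℝ, ℝ) ∞
        (fun x : RootManifold M => ((chartAt (EuclideanHalfSpace n) p).extend (𝓡∂ n) x) 0) p :=
      contMDiffAt_of_contDiffWithinAt (g := fun z => z 0) (IsManifold.chart_mem_maximalAtlas p)
        (mem_chart_source _ p) (by fun_prop)
    exact (h1.mul hμ.self_of_nhds.1).congr_of_eventuallyEq (hμ.mono fun x hx => hx.2.2)
  · have h0 : G.ρ p.toBase ≠ 0 := by rwa [ne_eq, G.ρ_eq_zero_iff, mem_boundary_toBase_iff]
    have h1 := (G.contMDiff_ρ.comp contMDiff_toBase) p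
    exact (Real.contDiffAt_sqrt h0).contMDiffAt.comp p h1

/-- Hadamard's lemma at the boundary. -/
theorem exists_eq_x_mul (hp : p ∈ (𝓡∂ n).boundary (RootManifold M)) {h : RootManifold M → ℝ}
    (hh : ∀ᶠ x in 𝓝 p, ContMDiffAt (𝓡∂ n) 𝓘(ℝ, ℝ) ∞ h x)
    (h0 : ∀ᶠ x in 𝓝 p, x ∈ (𝓡∂ n).boundary (RootManifold M) → h x = 0) :
    ∃ H : RootManifold M → ℝ, ∀ᶠ x in 𝓝 p, ContMDiffAt (𝓡∂ n) 𝓘(ℝ, ℝ) ∞ H x ∧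
      h x = G.x x * H x := by
  have he := IsManifold.chart_mem_maximalAtlas (I := 𝓡∂ n) (n := ∞) p
  have hps := mem_chart_source (EuclideanHalfSpace n) p
  set e := chartAt (EuclideanHalfSpace n) p
  obtain ⟨μ, hμ⟩ := exists_x_eq_coord_mul G hp
  obtain ⟨r, hr, hrt, hQ⟩ := exists_halfBall_of_eventually hps (hh.and h0)
  obtain ⟨H, hH, hhH⟩ := exists_eq_coord_smul ((mem_boundary_iff_coord he hps).1 hp)
    (contDiffOn_halfBall_of_contMDiffAt he hrt fun z hz => (hQ z hz).1) (fun z hz hz0 => by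
      refine (hQ z hz).2 ?_
      rw [mem_boundary_iff_coord he, PartialEquiv.right_inv _ (hrt hz), hz0]
      rw [← e.extend_source (I := 𝓡∂ n)]
      exact PartialEquiv.map_target _ (hrt hz))
  refine ⟨fun x => H (e.extend (𝓡∂ n) x) / μ x, ?_⟩
  filter_upwards [eventually_mem_halfBall hps hr, hμ] with x hx hμx
  refine ⟨(contMDiffAt_of_contDiffOn_halfBall he hx.1 hH hx.2).div₀ hμx.1 hμx.2.1.ne', ?_⟩
  have h1 := hhH _ hx.2
  rw [e.extend_left_inv hx.1] at h1
  rw [h1, hμx.2.2, smul_eq_mul]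
  have := hμx.2.1.ne'
  field_simp
  exact mul_comm _ _

end BoundaryDefining

/-! ### Flatness in the normal gauge of a model chart. -/

section LocalFlatness

variable {n : ℕ} [NeZero n]

attribute [local instance] dualMetricAddCommGroup dualMetricGroup dualMetricSpace
  dualMetricDerivGroup dualMetricDerivSpace

theorem reflect_mem_ball {z₁ z : EuclideanSpace ℝ (Fin n)} {r : ℝ} (h0 : z₁ 0 = 0)
    (hz : z ∈ Metric.ball z₁ r) :
    z + (|coordZero n z| - coordZero n z) • basisZero n ∈ Metric.ball z₁ r := by
  rw [Metric.mem_ball] at hz ⊢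
  refine lt_of_eq_of_lt ?_ hz
  rw [EuclideanSpace.dist_eq, EuclideanSpace.dist_eq]
  congr 1
  refine Finset.sum_congr rfl fun i _ => ?_
  by_cases hi : i = 0
  · subst hi
    simp [h0]
  · simp [hi]

variable {M : Type*} [TopologicalSpace M]
    [ChartedSpace (EuclideanHalfSpace n) M] [IsManifold (𝓡∂ n) ∞ M] {G : GasGiant n M}
    {p : RootManifold M}

/-- The part from `f` vanishes because the trajectory is a maximal geodesic. The part from `dq`
vanishes by the fundamental theorem of calculus, since `q` is zero at both ends. -/
theorem integral_normal_form_eq_zero {f : OneForm n (RootManifold M)}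
    (hI : ∀ c : G.MaximalGeodesic, G.xray f c = 0)
    {z₀ : EuclideanSpace ℝ (Fin n)} {r : ℝ} {a : EuclideanSpace ℝ (Fin n) → ℝ}
    {B : Set (EuclideanSpace ℝ (Fin n))}
    (hm : IsModelChart G p a B) (hB : B ⊆ Metric.ball z₀ r)
    (hf : ContinuousOn (f.inChart (chartAt (EuclideanHalfSpace n) p)) (halfBall z₀ r))
    {q : EuclideanSpace ℝ (Fin n) → ℝ} (hq : ContDiffOn ℝ ∞ q (halfBall z₀ r))
    (hu : UniqueDiffOn ℝ (halfBall z₀ r))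
    (hq0 : ∀ z ∈ halfBall z₀ r, z 0 = 0 → q z = 0) {τ : ℝ}
    {z : ℝ → EuclideanSpace ℝ (Fin n)} {P : ℝ → EuclideanSpace ℝ (Fin n) →L[ℝ] ℝ}
    (ht : IsModelTrajectory (coordZero n) (basisZero n) (rootDualMetric G p a) B τ z P) :
    ∫ t in (0 : ℝ)..τ, (f.inChart (chartAt (EuclideanHalfSpace n) p) (z t) -
      fderivWithin ℝ q (halfBall z₀ r) (z t))
      (modelVelocity (coordZero n) (basisZero n) (rootDualMetric G p a) (z t) (P t)) = 0 := by
  have hpos : ∀ t ∈ Icc 0 τ, 0 ≤ z t 0 := by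
    intro t ht'
    rcases eq_or_lt_of_le ht'.1 with h1 | h1
    · rw [← h1]; exact ht.start_mem.ge
    rcases eq_or_lt_of_le ht'.2 with h2 | h2
    · rw [h2]; exact ht.end_mem.ge
    exact (ht.interior_mem t ⟨h1, h2⟩).le
  have hD : ∀ t ∈ Icc 0 τ, z t ∈ halfBall z₀ r := fun t ht' =>
    mem_halfBall.2 ⟨Metric.mem_ball.1 (hB (ht.mem t ht')), hpos t ht'⟩
  have hdiag : Continuous (fun s : ℝ => diag (coordZero n) (basisZero n) (1 / 2) s) :=
    (contDiff_diag (coordZero n) (basisZero n)).continuous.comp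
      (by fun_prop : Continuous fun s : ℝ => ((1 / 2 : ℝ), s))
  have hdz : ContinuousOn (fun t => diag (coordZero n) (basisZero n) (1 / 2) (coordZero n (z t)))
      (Icc 0 τ) :=
    hdiag.comp_continuousOn ((coordZero n).continuous.comp_continuousOn ht.continuousOn_point)
  have hk : ContinuousOn (fun t => rootDualMetric G p a (z t)) (Icc 0 τ) :=
    hm.contDiffOn.continuousOn.comp ht.continuousOn_point ht.mem
  have hV : ContinuousOn (fun t => modelVelocity (coordZero n) (basisZero n)
      (rootDualMetric G p a) (z t) (P t)) (Icc 0 τ) :=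
    hdz.clm_apply (hk.clm_apply (ht.continuousOn_covector.clm_comp hdz))
  have hf' := (hf.comp ht.continuousOn_point hD).clm_apply hV
  have hqV := ((hq.continuousOn_fderivWithin hu (by simp)).comp ht.continuousOn_point hD).clm_apply hV
  have hu1 : uIcc 0 τ = Icc 0 τ := uIcc_of_le ht.pos.le
  obtain ⟨c, hc⟩ := hm.exists_maximalGeodesic ht
  have h1 := hI c
  rw [hc] at h1
  have h2 : ∫ t in (0 : ℝ)..τ, fderivWithin ℝ q (halfBall z₀ r) (z t)
      (modelVelocity (coordZero n) (basisZero n) (rootDualMetric G p a) (z t) (P t)) = 0 := by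
    rw [intervalIntegral.integral_eq_sub_of_hasDerivAt_of_le ht.pos.le (f := fun t => q (z t))
      (hq.continuousOn.comp ht.continuousOn_point hD) ?_
      (ContinuousOn.intervalIntegrable (by rw [hu1]; exact hqV))]
    · rw [hq0 _ (hD τ ⟨ht.pos.le, le_rfl⟩) ht.end_mem, hq0 _ (hD 0 ⟨le_rfl, ht.pos.le⟩) ht.start_mem,
        sub_zero]
    · intro t ht'
      have hD' : halfBall z₀ r ∈ 𝓝 (z t) := by
        refine inter_mem (Metric.isOpen_ball.mem_nhds (hB (ht.mem t (Ioo_subset_Icc_self ht')))) ?_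
        have : IsOpen {z : EuclideanSpace ℝ (Fin n) | 0 < coordZero n z} :=
          isOpen_lt continuous_const (coordZero n).continuous
        exact mem_of_superset (this.mem_nhds (ht.interior_mem t ht')) fun w hw =>
          (le_of_lt hw : (0 : ℝ) ≤ coordZero n w)
      have hd := ((hq.differentiableOn (by simp)) _
        (hD t (Ioo_subset_Icc_self ht'))).hasFDerivWithinAt.hasFDerivAt hD'
      exact hd.comp_hasDerivAt t (ht.deriv_point t ht')
  simp only [sub_apply]
  rw [intervalIntegral.integral_sub, h1, h2, sub_zero]
  · exact ContinuousOn.intervalIntegrable (by rw [hu1]; exact hf')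
  · exact ContinuousOn.intervalIntegrable (by rw [hu1]; exact hqV)

/-- In normal gauge, a form in the kernel of the X-ray transform vanishes to infinite order at the
boundary. -/
theorem exists_eq_coord_pow_smul_normal_form {f : OneForm n (RootManifold M)}
    (hI : ∀ c : G.MaximalGeodesic, G.xray f c = 0)
    {z₀ : EuclideanSpace ℝ (Fin n)} (h0 : z₀ 0 = 0) {r : ℝ} {a : EuclideanSpace ℝ (Fin n) → ℝ}
    (hm : IsModelChart G p a (Metric.ball z₀ r)) (ha : ∀ z ∈ Metric.ball z₀ r, 0 < a (squareMap z))
    (hf : ContDiffOn ℝ ∞ (f.inChart (chartAt (EuclideanHalfSpace n) p)) (halfBall z₀ r))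
    {q : EuclideanSpace ℝ (Fin n) → ℝ} (hq : ContDiffOn ℝ ∞ q (halfBall z₀ r))
    (hq0 : ∀ z ∈ halfBall z₀ r, z 0 = 0 → q z = 0)
    (hfq : ∀ z ∈ halfBall z₀ r, fderivWithin ℝ q (halfBall z₀ r) z (basisZero n) =
      f.inChart (chartAt (EuclideanHalfSpace n) p) z (basisZero n)) (k : ℕ) :
    ∃ w : EuclideanSpace ℝ (Fin n) → EuclideanSpace ℝ (Fin n) →L[ℝ] ℝ,
      ContDiffOn ℝ ∞ w (halfBall z₀ r) ∧ ∀ z ∈ halfBall z₀ r,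
        f.inChart (chartAt (EuclideanHalfSpace n) p) z - fderivWithin ℝ q (halfBall z₀ r) z =
          z 0 ^ k • w z := by
  have hu := uniqueDiffOn_halfBall h0 r
  induction k with
  | zero =>
    exact ⟨_, hf.sub (hq.fderivWithin hu (m := ∞) (by simp)), fun z _ => by rw [pow_zero, one_smul]⟩
  | succ k ih =>
    obtain ⟨w, hw, hwF⟩ := ih
    set F := fun z => f.inChart (chartAt (EuclideanHalfSpace n) p) z -
      fderivWithin ℝ q (halfBall z₀ r) z with hF
    have hwF' : ∀ z ∈ halfBall z₀ r, F z = z 0 ^ k • w z := hwF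
    -- The gauge condition says that `F` kills the normal vector, so only tangential components
    -- matter.
    have hFproj : ∀ z ∈ halfBall z₀ r, ∀ v,
        F z v = F z (tangentialProj (coordZero n) (basisZero n) v) := by
      intro z hz v
      have : F z (basisZero n) = 0 := by
        rw [hF]; simp only [sub_apply]; rw [hfq z hz, sub_self]
      rw [tangentialProj_apply, map_sub, map_smul, this, smul_zero, sub_zero]
    -- The condition on the normal vector is known for `x ^ k w` rather than for `w`, so `w` is
    -- replaced by its tangential part before dividing by `x` once more.
    have hw' : ContDiffOn ℝ ∞
        (fun z => (w z).comp (tangentialProj (coordZero n) (basisZero n))) (halfBall z₀ r) :=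
      hw.clm_comp contDiffOn_const
    obtain ⟨v, hv, hvw⟩ := exists_eq_coord_smul h0 hw' (by
      intro z₁ hz₁ hz₁0
      have hz₁' := mem_halfBall.1 hz₁
      -- A ball centred at the boundary point under test is stable under reflection of negative
      -- first coordinates.
      set B := Metric.ball z₁ (r - dist z₁ z₀) with hBdef
      have hB : B ⊆ Metric.ball z₀ r := Metric.ball_subset_ball' (by linarith)
      have hmB : IsModelChart G p a B := ⟨Metric.isOpen_ball, fun z hz => hm.mem_target z (hB hz),
        hm.contDiffOn.mono hB, fun z hz => hm.ρ_eq z (hB hz)⟩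
      have hz₁B : z₁ ∈ B := Metric.mem_ball_self (by linarith [hz₁'.1])
      refine tangential_eq_zero_of_integral_eq_zero (ν := coordZero n) (e := basisZero n)
        (k := rootDualMetric G p a) coordZero_basisZero Metric.isOpen_ball
        (fun z hz => reflect_mem_ball hz₁0 hz) hmB.contDiffOn
        (fun z hz => rootDualMetric_symm G p (hmB.mem_target z hz)) hz₁B hz₁0
        (fun P hP => rootDualMetric_pos G p (hmB.mem_target z₁ hz₁B) (ha z₁ (hB hz₁B)) hP)
        (hw.continuousOn.mono fun z hz => mem_halfBall.2 ⟨Metric.mem_ball.1 (hB hz.1), hz.2⟩) k ?_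
      intro τ z P ht
      have h1 := integral_normal_form_eq_zero hI hmB hB hf.continuousOn hq hu hq0 ht
      refine Eq.trans (intervalIntegral.integral_congr fun t ht' => ?_) h1
      rw [uIcc_of_le ht.pos.le] at ht'
      have hpos : 0 ≤ z t 0 := by
        rcases eq_or_lt_of_le ht'.1 with h1 | h1
        · rw [← h1]; exact ht.start_mem.ge
        rcases eq_or_lt_of_le ht'.2 with h2 | h2
        · rw [h2]; exact ht.end_mem.ge
        exact (ht.interior_mem t ⟨h1, h2⟩).le
      have hD : z t ∈ halfBall z₀ r :=
        mem_halfBall.2 ⟨Metric.mem_ball.1 (hB (ht.mem t ht')), hpos⟩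
      have h2 := hFproj _ hD (modelVelocity (coordZero n) (basisZero n)
        (rootDualMetric G p a) (z t) (P t))
      refine Eq.trans ?_ h2.symm
      rw [hwF' _ hD]
      rfl)
    refine ⟨v, hv, fun z hz => ?_⟩
    rw [pow_succ, mul_smul, ← hvw z hz]
    refine ContinuousLinearMap.ext fun v => ?_
    rw [hFproj z hz v, hwF' z hz]
    rfl

end LocalFlatness

/-! ### Functions and forms that are flat at the boundary. -/

section Flatness

variable {n : ℕ} [NeZero n] {M : Type*} [TopologicalSpace M]
    [ChartedSpace (EuclideanHalfSpace n) M] [IsManifold (𝓡∂ n) ∞ M] (G : GasGiant n M)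
    {p : RootManifold M}

/-- The function `h` is, near `p`, divisible by every power of the boundary defining function. -/
def FlatFn (h : RootManifold M → ℝ) (p : RootManifold M) : Prop :=
  ∀ k : ℕ, ∃ H : RootManifold M → ℝ, ∀ᶠ x in 𝓝 p,
    ContMDiffAt (𝓡∂ n) 𝓘(ℝ, ℝ) ∞ H x ∧ h x = G.x x ^ k * H x

/-- The 1-form `u` is, near `p`, divisible by every power of the boundary defining function. -/
def FlatForm (u : OneForm n (RootManifold M)) (p : RootManifold M) : Prop :=
  ∀ k : ℕ, ∃ w : OneForm n (RootManifold M), ∀ᶠ x in 𝓝 p, w.SmoothAt x ∧ u x = G.x x ^ k • w x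

variable {G}

theorem FlatFn.congr {h h' : RootManifold M → ℝ} (hh : FlatFn G h p) (he : h' =ᶠ[𝓝 p] h) :
    FlatFn G h' p := by
  intro k
  obtain ⟨H, hH⟩ := hh k
  refine ⟨H, ?_⟩
  filter_upwards [hH, he] with x hx hx'
  exact ⟨hx.1, hx'.trans hx.2⟩

theorem FlatFn.mul {χ h : RootManifold M → ℝ}
    (hχ : ContMDiff (𝓡∂ n) 𝓘(ℝ, ℝ) ∞ χ) (hh : FlatFn G h p) :
    FlatFn G (fun x => χ x * h x) p := by
  intro k
  obtain ⟨H, hH⟩ := hh k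
  refine ⟨fun x => χ x * H x, ?_⟩
  filter_upwards [hH] with x hx
  exact ⟨(hχ x).mul hx.1, by rw [hx.2]; ring⟩

theorem FlatFn.sum {ι : Type*} (s : Finset ι) {h : ι → RootManifold M → ℝ}
    (hh : ∀ i ∈ s, FlatFn G (h i) p) : FlatFn G (fun x => ∑ i ∈ s, h i x) p := by
  classical
  induction s using Finset.induction_on with
  | empty =>
    intro k
    exact ⟨fun _ => 0, Eventually.of_forall fun x => ⟨contMDiffAt_const, by simp⟩⟩
  | insert i s hi ih =>
    intro k
    obtain ⟨H, hH⟩ := ih (fun j hj => hh j (Finset.mem_insert_of_mem hj)) k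
    obtain ⟨H', hH'⟩ := hh i (Finset.mem_insert_self _ _) k
    refine ⟨fun x => H' x + H x, ?_⟩
    filter_upwards [hH, hH'] with x hx hx'
    exact ⟨hx'.1.add hx.1, by rw [Finset.sum_insert hi, hx.2, hx'.2, mul_add]⟩

theorem FlatForm.congr {u v : OneForm n (RootManifold M)} (hu : FlatForm G u p)
    (h : ∀ᶠ x in 𝓝 p, v x = u x) : FlatForm G v p := by
  intro k
  obtain ⟨w, hw⟩ := hu k
  refine ⟨w, ?_⟩
  filter_upwards [hw, h] with x hx hx'
  exact ⟨hx.1, hx'.trans hx.2⟩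

theorem FlatForm.sub {u v : OneForm n (RootManifold M)} (hu : FlatForm G u p)
    (hv : FlatForm G v p) : FlatForm G (fun x => u x - v x) p := by
  intro k
  obtain ⟨w, hw⟩ := hu k
  obtain ⟨w', hw'⟩ := hv k
  refine ⟨fun x => w x - w' x, ?_⟩
  filter_upwards [hw, hw'] with x hx hx'
  exact ⟨hx.1.sub hx'.1, by rw [hx.2, hx'.2, smul_sub]⟩

theorem differential_pow_succ {N : Type*} [TopologicalSpace N]
    [ChartedSpace (EuclideanHalfSpace n) N] [IsManifold (𝓡∂ n) ∞ N] {p : N} {g : N → ℝ}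
    (hg : ContMDiffAt (𝓡∂ n) 𝓘(ℝ, ℝ) ∞ g p) (k : ℕ) :
    differential n (fun x => g x ^ (k + 1)) p = ((k + 1) * g p ^ k) • differential n g p := by
  induction k with
  | zero => simp
  | succ k ih =>
    have h1 := differential_mul hg (hg.pow (k + 1))
    have h2 : (fun x => g x ^ (k + 1 + 1)) = fun x => g x * g x ^ (k + 1) := by
      funext x; ring
    rw [h2]
    refine h1.trans ?_
    change g p • differential n (fun x => g x ^ (k + 1)) p + g p ^ (k + 1) • _ = _
    rw [ih, smul_smul, ← add_smul]
    congr 1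
    push_cast
    ring

theorem FlatFn.differential {h : RootManifold M → ℝ} (hh : FlatFn G h p) :
    FlatForm G (differential n h) p := by
  intro k
  obtain ⟨H, hH⟩ := hh (k + 1)
  -- Differentiation costs one power: `d(x ^ (k + 1) H) = x ^ k (x dH + (k + 1) H dx)`.
  refine ⟨fun x => G.x x • GasGiant.differential n H x +
    ((k + 1 : ℝ) * H x) • GasGiant.differential n G.x x, ?_⟩
  filter_upwards [eventually_eventually_nhds.2 hH] with x hx
  have hHx := hx.self_of_nhds.1
  have hX := G.contMDiff_x x
  refine ⟨((smoothAt_differential hHx).smul hX).add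
    ((smoothAt_differential hX).smul (contMDiffAt_const.mul hHx)), ?_⟩
  have h1 : h =ᶠ[𝓝 x] fun y => G.x y ^ (k + 1) * H y := hx.mono fun y hy => hy.2
  rw [differential_congr h1]
  refine (differential_mul (hX.pow (k + 1)) hHx).trans ?_
  change G.x x ^ (k + 1) • _ + H x • GasGiant.differential n (fun x => G.x x ^ (k + 1)) x = _
  rw [differential_pow_succ hX, smul_add, smul_smul, smul_smul, smul_smul, pow_succ]
  congr 2
  ring

theorem contDiffOn_inChart {N : Type*} [TopologicalSpace N]
    [ChartedSpace (EuclideanHalfSpace n) N] [IsManifold (𝓡∂ n) ∞ N]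
    {e : OpenPartialHomeomorph N (EuclideanHalfSpace n)}
    (he : e ∈ IsManifold.maximalAtlas (𝓡∂ n) ∞ N) {w : OneForm n N}
    {z₀ : EuclideanSpace ℝ (Fin n)} {r : ℝ} (hr : halfBall z₀ r ⊆ (e.extend (𝓡∂ n)).target)
    (hw : ∀ z ∈ halfBall z₀ r, w.SmoothAt ((e.extend (𝓡∂ n)).symm z)) :
    ContDiffOn ℝ ∞ (w.inChart e) (halfBall z₀ r) := by
  refine contDiffOn_halfBall_of_contMDiffAt (g := fun x => (w x).comp (coordVector e x)) he hr
    fun z hz => (OneForm.smoothAt_iff he ?_).1 (hw z hz)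
  rw [← e.extend_source (I := 𝓡∂ n)]
  exact PartialEquiv.map_target _ (hr hz)

theorem differential_inChart {N : Type*} [TopologicalSpace N]
    [ChartedSpace (EuclideanHalfSpace n) N] [IsManifold (𝓡∂ n) ∞ N]
    {e : OpenPartialHomeomorph N (EuclideanHalfSpace n)}
    (he : e ∈ IsManifold.maximalAtlas (𝓡∂ n) ∞ N) {h : N → ℝ}
    {z₀ : EuclideanSpace ℝ (Fin n)} {r : ℝ} (hr : halfBall z₀ r ⊆ (e.extend (𝓡∂ n)).target)
    (hh : ContDiffOn ℝ ∞ (fun z => h ((e.extend (𝓡∂ n)).symm z)) (halfBall z₀ r))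
    {z : EuclideanSpace ℝ (Fin n)} (hz : z ∈ halfBall z₀ r) :
    (differential n h).inChart e z =
      fderivWithin ℝ (fun z => h ((e.extend (𝓡∂ n)).symm z)) (halfBall z₀ r) z := by
  have hs : (e.extend (𝓡∂ n)).symm z ∈ e.source := by
    rw [← e.extend_source (I := 𝓡∂ n)]
    exact PartialEquiv.map_target _ (hr hz)
  have h1 := ((hh.differentiableOn (by simp)) z hz).hasFDerivWithinAt.mono_of_mem_nhdsWithin
    (halfBall_mem_nhdsWithin hz)
  have hri := (e.extend (𝓡∂ n)).right_inv (hr hz)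
  have h2 := differential_eq_comp (q := h) he hs (by rw [hri]; exact h1) (by
    filter_upwards [e.open_source.mem_nhds hs] with x hx
    rw [e.extend_left_inv hx])
  rw [OneForm.inChart, h2, ContinuousLinearMap.comp_assoc, coordCovector_comp_coordVector he hs]
  exact ContinuousLinearMap.comp_id _

/-- A smooth function that vanishes on the boundary and whose derivative in the first coordinate of
some chart is flat is itself flat. -/
theorem flatFn_of_normal_derivative (hp : p ∈ (𝓡∂ n).boundary (RootManifold M))
    {e : OpenPartialHomeomorph (RootManifold M) (EuclideanHalfSpace n)}
    (he : e ∈ IsManifold.maximalAtlas (𝓡∂ n) ∞ (RootManifold M)) (hps : p ∈ e.source)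
    {h : RootManifold M → ℝ} (hh : ∀ᶠ x in 𝓝 p, ContMDiffAt (𝓡∂ n) 𝓘(ℝ, ℝ) ∞ h x)
    (h0 : ∀ᶠ x in 𝓝 p, x ∈ (𝓡∂ n).boundary (RootManifold M) → h x = 0)
    {u : OneForm n (RootManifold M)} (hu : FlatForm G u p)
    (hd : ∀ᶠ x in 𝓝 p, differential n h x (coordVector e x (basisZero n)) =
      u x (coordVector e x (basisZero n))) : FlatFn G h p := by
  intro k
  obtain ⟨w, hw⟩ := hu k
  -- The first coordinate of an arbitrary chart is not `√ρ`, but each is a smooth multiple of the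
  -- other (`c` here, `m` below). This transfers powers in both directions.
  obtain ⟨c, hc⟩ := exists_eq_x_mul G hp (h := fun x => (e.extend (𝓡∂ n) x) 0) (by
      filter_upwards [e.open_source.mem_nhds hps] with x hx
      exact contMDiffAt_of_contDiffWithinAt (g := fun z => z 0) he hx (by fun_prop)) (by
      filter_upwards [e.open_source.mem_nhds hps] with x hx hx'
      exact (mem_boundary_iff_coord he hx).1 hx')
  obtain ⟨r, hr, hrt, hQ⟩ := exists_halfBall_of_eventually hps (hh.and (h0.and (hw.and hd)))
  have hz₀ := (mem_boundary_iff_coord he hps).1 hp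
  have hs : ∀ z ∈ halfBall (e.extend (𝓡∂ n) p) r, (e.extend (𝓡∂ n)).symm z ∈ e.source :=
    fun z hz => by
      rw [← e.extend_source (I := 𝓡∂ n)]
      exact PartialEquiv.map_target _ (hrt hz)
  have hbd : ∀ z ∈ halfBall (e.extend (𝓡∂ n) p) r, z 0 = 0 →
      (e.extend (𝓡∂ n)).symm z ∈ (𝓡∂ n).boundary (RootManifold M) := fun z hz hz0 => by
    rw [mem_boundary_iff_coord he (hs z hz), PartialEquiv.right_inv _ (hrt hz), hz0]
  obtain ⟨m, hm, hxm⟩ := exists_eq_coord_smul hz₀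
    (contDiffOn_halfBall_of_contMDiffAt he hrt fun z _ => G.contMDiff_x _)
    (fun z hz hz0 => (G.x_eq_zero_iff _).2 (hbd z hz hz0))
  have hhs := contDiffOn_halfBall_of_contMDiffAt he hrt fun z hz => (hQ z hz).1
  have hws := contDiffOn_inChart he hrt fun z hz => (hQ z hz).2.2.1.1
  obtain ⟨H, hH, hhH⟩ := exists_eq_coord_pow_smul (k := k)
    (g := fun z => m z ^ k * w.inChart e z (basisZero n)) hz₀ hhs
    (fun z hz hz0 => (hQ z hz).2.1 (hbd z hz hz0))
    ((hm.pow k).mul (hws.clm_apply contDiffOn_const)) (fun z hz => by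
      rw [← differential_inChart he hrt hhs hz]
      refine (hQ z hz).2.2.2.trans ?_
      rw [(hQ z hz).2.2.1.2, hxm z hz]
      change (z 0 • m z) ^ k * _ = z 0 ^ k * (m z ^ k * _)
      rw [smul_eq_mul, mul_pow, mul_assoc]
      rfl)
  -- Integration in the normal direction gains one power, which is left over as the additional
  -- factor `G.x x`.
  refine ⟨fun x => G.x x * (c x ^ (k + 1) * H (e.extend (𝓡∂ n) x)), ?_⟩
  filter_upwards [hc, eventually_mem_halfBall hps hr] with x hcx hx
  refine ⟨(G.contMDiff_x x).mul ((hcx.1.pow (k + 1)).mul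
    (contMDiffAt_of_contDiffOn_halfBall he hx.1 hH hx.2)), ?_⟩
  have h1 := hhH _ hx.2
  rw [e.extend_left_inv hx.1] at h1
  rw [h1, hcx.2, smul_eq_mul]
  ring

end Flatness

/-! ### Local gauges and their comparison. -/

section Gauge

variable {n : ℕ} [NeZero n] {M : Type*} [TopologicalSpace M]
    [ChartedSpace (EuclideanHalfSpace n) M] [IsManifold (𝓡∂ n) ∞ M] {G : GasGiant n M}
    {p : RootManifold M}

/-- The normal gauge near a boundary point. -/
theorem exists_local_gauge {f : OneForm n (RootManifold M)} (hf : f.IsSmooth)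
    (hI : ∀ c : G.MaximalGeodesic, G.xray f c = 0) (hp : p ∈ (𝓡∂ n).boundary (RootManifold M)) :
    ∃ V : Set (RootManifold M), IsOpen V ∧ p ∈ V ∧ ∃ q : RootManifold M → ℝ, ∀ x ∈ V,
      ContMDiffAt (𝓡∂ n) 𝓘(ℝ, ℝ) ∞ q x ∧ (x ∈ (𝓡∂ n).boundary (RootManifold M) →
        q x = 0 ∧ FlatForm G (fun y => f y - differential n q y) x) := by
  have he := IsManifold.chart_mem_maximalAtlas (I := 𝓡∂ n) (n := ∞) p
  have hps := mem_chart_source (EuclideanHalfSpace n) p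
  obtain ⟨r, hr, a, hm, ha⟩ := exists_isModelChart G hp
  have hz₀ := (mem_boundary_iff_coord he hps).1 hp
  set e := chartAt (EuclideanHalfSpace n) p with hedef
  set z₀ := e.extend (𝓡∂ n) p with hz₀def
  have hrt : halfBall z₀ r ⊆ (e.extend (𝓡∂ n)).target := fun z hz =>
    hm.mem_rootChart (Metric.mem_ball.2 (mem_halfBall.1 hz).1) (mem_halfBall.1 hz).2
  have hfs : ContDiffOn ℝ ∞ (f.inChart e) (halfBall z₀ r) :=
    contDiffOn_inChart he hrt fun z _ => hf _
  obtain ⟨q, hq, hq0, hfq⟩ := exists_normal_primitive hz₀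
    (hfs.clm_apply (contDiffOn_const (c := basisZero n)))
  have hflat := exists_eq_coord_pow_smul_normal_form hI hz₀ hm (fun z hz => (ha z hz).1) hfs hq hq0 hfq
  have hV : ∀ x ∈ e.source ∩ e.extend (𝓡∂ n) ⁻¹' Metric.ball z₀ r,
      x ∈ e.source ∧ e.extend (𝓡∂ n) x ∈ halfBall z₀ r := fun x hx =>
    ⟨hx.1, mem_halfBall.2 ⟨Metric.mem_ball.1 hx.2, (e x).2⟩⟩
  have hVo : IsOpen (e.source ∩ e.extend (𝓡∂ n) ⁻¹' Metric.ball z₀ r) :=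
    e.isOpen_extend_preimage Metric.isOpen_ball
  refine ⟨_, hVo, ⟨hps, Metric.mem_ball_self hr⟩, fun x => q (e.extend (𝓡∂ n) x), fun x hx => ?_⟩
  refine ⟨contMDiffAt_of_contDiffOn_halfBall he hx.1 hq (hV x hx).2, fun hxb => ⟨hq0 _ (hV x hx).2
    ((mem_boundary_iff_coord he hx.1).1 hxb), fun k => ?_⟩⟩
  obtain ⟨w, hw, hwk⟩ := hflat k
  -- Turns powers of the chart coordinate into powers of `√ρ`.
  obtain ⟨c, hc⟩ := exists_eq_x_mul G hxb (h := fun x => (e.extend (𝓡∂ n) x) 0) (by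
      filter_upwards [e.open_source.mem_nhds hx.1] with x hx
      exact contMDiffAt_of_contDiffWithinAt (g := fun z => z 0) he hx (by fun_prop)) (by
      filter_upwards [e.open_source.mem_nhds hx.1] with x hx hx'
      exact (mem_boundary_iff_coord he hx).1 hx')
  refine ⟨fun y => c y ^ k • (w (e.extend (𝓡∂ n) y)).comp (coordCovector e y), ?_⟩
  filter_upwards [hc, hVo.mem_nhds hx] with y hcy hy
  obtain ⟨hys, hyD⟩ := hV y hy
  refine ⟨OneForm.SmoothAt.smul (hcy.1.pow k) ?_, ?_⟩
  · rw [OneForm.smoothAt_iff he hys]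
    refine (contMDiffAt_of_contDiffOn_halfBall he hys hw hyD).congr_of_eventuallyEq ?_
    filter_upwards [e.open_source.mem_nhds hys] with x hx
    rw [ContinuousLinearMap.comp_assoc, coordCovector_comp_coordVector he hx]
    exact ContinuousLinearMap.comp_id _
  · have h1 : differential n (fun x => q (e.extend (𝓡∂ n) x)) y = _ :=
      differential_eq_comp he hys
        (((hq.differentiableOn (by simp)) _ hyD).hasFDerivWithinAt.mono_of_mem_nhdsWithin
        (halfBall_mem_nhdsWithin hyD)) (EventuallyEq.refl _ _)
    have h2 : f y = (f.inChart e (e.extend (𝓡∂ n) y)).comp (coordCovector e y) := by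
      rw [OneForm.inChart, e.extend_left_inv hys, ContinuousLinearMap.comp_assoc,
        coordVector_comp_coordCovector he hys]
      exact (ContinuousLinearMap.comp_id _).symm
    have h3 := hwk _ hyD
    rw [hcy.2, mul_pow, mul_smul] at h3
    have h4 : f y - differential n (fun x => q (e.extend (𝓡∂ n) x)) y =
        (f.inChart e (e.extend (𝓡∂ n) y) - fderivWithin ℝ q (halfBall z₀ r)
          (e.extend (𝓡∂ n) y)).comp (coordCovector e y) := by
      rw [h1, ContinuousLinearMap.sub_comp, ← h2]
    rw [h4, h3]
    rfl

/-- If some gauge makes a form flat at a boundary point, then so does the normal gauge of any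
chart. -/
theorem flatForm_of_normal (hp : p ∈ (𝓡∂ n).boundary (RootManifold M))
    {e : OpenPartialHomeomorph (RootManifold M) (EuclideanHalfSpace n)}
    (he : e ∈ IsManifold.maximalAtlas (𝓡∂ n) ∞ (RootManifold M)) (hps : p ∈ e.source)
    {f : OneForm n (RootManifold M)} {q q' : RootManifold M → ℝ}
    (hq : ∀ᶠ x in 𝓝 p, ContMDiffAt (𝓡∂ n) 𝓘(ℝ, ℝ) ∞ q x)
    (hq' : ∀ᶠ x in 𝓝 p, ContMDiffAt (𝓡∂ n) 𝓘(ℝ, ℝ) ∞ q' x)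
    (h0 : ∀ᶠ x in 𝓝 p, x ∈ (𝓡∂ n).boundary (RootManifold M) → q x = 0)
    (h0' : ∀ᶠ x in 𝓝 p, x ∈ (𝓡∂ n).boundary (RootManifold M) → q' x = 0)
    (hf' : FlatForm G (fun y => f y - differential n q' y) p)
    (hd : ∀ᶠ x in 𝓝 p, (f x - differential n q x) (coordVector e x (basisZero n)) = 0) :
    FlatForm G (fun y => f y - differential n q y) p := by
  -- As `f - dq` has no normal component, the normal derivative of `q - q'` is the normal component
  -- of the flat form `f - dq'`.
  have h1 : FlatFn G (fun x => q x - q' x) p := by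
    refine flatFn_of_normal_derivative hp he hps ?_ ?_ hf' ?_
    · filter_upwards [hq, hq'] with x hx hx' using hx.sub hx'
    · filter_upwards [h0, h0'] with x hx hx' hb
      rw [hx hb, hx' hb, sub_zero]
    · filter_upwards [hq, hq', hd] with x hx hx' hdx
      rw [differential_sub hx hx']
      simp only [sub_apply] at hdx ⊢
      linarith
  refine (hf'.sub h1.differential).congr ?_
  filter_upwards [hq, hq'] with x hx hx'
  rw [differential_sub hx hx']
  abel

end Gauge

/-! ### Gluing the local gauges. -/

section Global

variable {n : ℕ} [NeZero n] {M : Type*} [TopologicalSpace M]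
    [ChartedSpace (EuclideanHalfSpace n) M] [IsManifold (𝓡∂ n) ∞ M] {G : GasGiant n M}

theorem isOpen_compl_boundary (G : GasGiant n M) :
    IsOpen ((𝓡∂ n).boundary (RootManifold M))ᶜ := by
  have : ((𝓡∂ n).boundary (RootManifold M))ᶜ = {p | G.x p ≠ 0} := by
    ext p
    exact (G.x_eq_zero_iff p).not.symm
  rw [this]
  exact isOpen_ne_fun G.contMDiff_x.continuous continuous_const

/-- A smooth form that is flat at every boundary point is divisible by every power of the boundary
defining function. -/
theorem exists_eq_x_pow_smul {u : OneForm n (RootManifold M)} (hu : ∀ p, u.SmoothAt p)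
    (hflat : ∀ p ∈ (𝓡∂ n).boundary (RootManifold M), FlatForm G u p) (k : ℕ) :
    ∃ w : OneForm n (RootManifold M), w.IsSmooth ∧ ∀ p, u p = G.x p ^ k • w p := by
  -- This is `u / x ^ k` off the boundary and, as `0⁻¹ = 0`, zero on it. Near the boundary it equals
  -- `x w` where `u = x ^ (k + 1) w`, so using flatness of order `k + 1` makes the value zero there
  -- the correct one.
  refine ⟨fun p => (G.x p * (G.x p ^ (k + 1))⁻¹) • u p, fun p => ?_, fun p => ?_⟩
  · change OneForm.SmoothAt _ p
    by_cases hp : p ∈ (𝓡∂ n).boundary (RootManifold M)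
    · obtain ⟨w, hw⟩ := hflat p hp (k + 1)
      refine ((hw.self_of_nhds.1).smul (G.contMDiff_x p)).congr ?_
      filter_upwards [hw] with x hx
      rw [hx.2, smul_smul]
      by_cases h0 : G.x x = 0
      · rw [h0, zero_mul, zero_mul, zero_smul]
      · rw [mul_assoc, inv_mul_cancel₀ (pow_ne_zero _ h0), mul_one]
    · refine (hu p).smul ((G.contMDiff_x p).mul ?_)
      exact ((G.contMDiff_x p).pow (k + 1)).inv₀
        (pow_ne_zero _ fun h => hp ((G.x_eq_zero_iff p).1 h))
  · by_cases h0 : G.x p = 0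
    · obtain ⟨w, hw⟩ := hflat p ((G.x_eq_zero_iff p).1 h0) 1
      have hup : u p = 0 := by rw [hw.self_of_nhds.2, h0, pow_one, zero_smul]
      simp only [hup, smul_zero]
    · rw [smul_smul, pow_succ]
      field_simp
      rw [one_smul]

/-- At interior points the zero function serves, on the complement of the boundary, where the
flatness condition is void. The alternative in the conclusion controls the support after gluing. -/
theorem exists_gauge_cover {f : OneForm n (RootManifold M)} (hf : f.IsSmooth)
    (hI : ∀ c : G.MaximalGeodesic, G.xray f c = 0) {U : Set (RootManifold M)} (hU : IsOpen U)
    (hbU : (𝓡∂ n).boundary (RootManifold M) ⊆ U) (p : RootManifold M) :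
    ∃ V : Set (RootManifold M), IsOpen V ∧ p ∈ V ∧ ∃ q : RootManifold M → ℝ, (V ⊆ U ∨ q = 0) ∧
      ∀ x ∈ V, ContMDiffAt (𝓡∂ n) 𝓘(ℝ, ℝ) ∞ q x ∧ (x ∈ (𝓡∂ n).boundary (RootManifold M) →
        q x = 0 ∧ FlatForm G (fun y => f y - differential n q y) x) := by
  by_cases hp : p ∈ (𝓡∂ n).boundary (RootManifold M)
  · obtain ⟨V, hV, hpV, q, hq⟩ := exists_local_gauge hf hI hp
    exact ⟨V ∩ U, hV.inter hU, ⟨hpV, hbU hp⟩, q, Or.inl inter_subset_right, fun x hx => hq x hx.1⟩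
  · exact ⟨_, isOpen_compl_boundary G, hp, 0, Or.inr rfl, fun x hx =>
      ⟨contMDiffAt_const, fun hx' => absurd hx' hx⟩⟩

/-- The difference of the two flat forms is `d(q - q')`, so in particular the normal derivative of
`q - q'` is flat. -/
theorem flatFn_sub_of_flatForm {p : RootManifold M} (hp : p ∈ (𝓡∂ n).boundary (RootManifold M))
    {f : OneForm n (RootManifold M)} {q q' : RootManifold M → ℝ}
    (hq : ∀ᶠ x in 𝓝 p, ContMDiffAt (𝓡∂ n) 𝓘(ℝ, ℝ) ∞ q x)
    (hq' : ∀ᶠ x in 𝓝 p, ContMDiffAt (𝓡∂ n) 𝓘(ℝ, ℝ) ∞ q' x)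
    (h0 : ∀ᶠ x in 𝓝 p, x ∈ (𝓡∂ n).boundary (RootManifold M) → q x = 0)
    (h0' : ∀ᶠ x in 𝓝 p, x ∈ (𝓡∂ n).boundary (RootManifold M) → q' x = 0)
    (hf : FlatForm G (fun y => f y - differential n q y) p)
    (hf' : FlatForm G (fun y => f y - differential n q' y) p) :
    FlatFn G (fun x => q x - q' x) p := by
  refine flatFn_of_normal_derivative hp (IsManifold.chart_mem_maximalAtlas p)
    (mem_chart_source _ p) ?_ ?_ (hf'.sub hf) ?_
  · filter_upwards [hq, hq'] with x hx hx' using hx.sub hx'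
  · filter_upwards [h0, h0'] with x hx hx' hb
    rw [hx hb, hx' hb, sub_zero]
  · filter_upwards [hq, hq'] with x hx hx'
    rw [differential_sub hx hx', sub_sub_sub_cancel_left]

/-- A form in the kernel of the X-ray transform is, up to a flat error, the differential of a
function that is supported near the boundary. -/
theorem exists_global_gauge [T2Space M] [CompactSpace M] {f : OneForm n (RootManifold M)}
    (hf : f.IsSmooth) (hI : ∀ c : G.MaximalGeodesic, G.xray f c = 0) {U : Set (RootManifold M)}
    (hU : IsOpen U) (hbU : (𝓡∂ n).boundary (RootManifold M) ⊆ U) :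
    ∃ q : RootManifold M → ℝ, ContMDiff (𝓡∂ n) 𝓘(ℝ, ℝ) ∞ q ∧ tsupport q ⊆ U ∧
      (∀ p ∈ (𝓡∂ n).boundary (RootManifold M), q p = 0) ∧
      ∀ p ∈ (𝓡∂ n).boundary (RootManifold M), FlatForm G (fun y => f y - differential n q y) p := by
  have : T2Space (RootManifold M) := inferInstanceAs (T2Space M)
  have : CompactSpace (RootManifold M) := inferInstanceAs (CompactSpace M)
  choose V hVo hpV q hVU hq using exists_gauge_cover hf hI hU hbU
  obtain ⟨χ, hχ⟩ := SmoothPartitionOfUnity.exists_isSubordinate (𝓡∂ n) isClosed_univ V hVo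
    (fun p _ => mem_iUnion.2 ⟨p, hpV p⟩)
  have hQs : ContMDiff (𝓡∂ n) 𝓘(ℝ, ℝ) ∞ (fun x => ∑ᶠ i, χ i x • q i x) :=
    χ.contMDiff_finsum_smul fun i x hx => (hq i x (hχ i hx)).1
  refine ⟨fun x => ∑ᶠ i, χ i x • q i x, hQs, ?_, ?_, ?_⟩
  · have hsub : ∀ i, Function.support (fun x => χ i x • q i x) ⊆ Function.support (χ i) :=
      fun i x hx h0 => hx (by simp only [h0, zero_smul])
    -- Local finiteness makes the union of the closed supports closed, so that it contains the
    -- support of the sum.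
    have hlf : LocallyFinite fun i => tsupport (fun x => χ i x • q i x) :=
      (χ.locallyFinite.subset hsub).closure
    have hcl : IsClosed (⋃ i, tsupport (fun x => χ i x • q i x)) :=
      hlf.isClosed_iUnion fun i => isClosed_tsupport _
    refine (closure_minimal (fun x hx => ?_) hcl).trans (iUnion_subset fun i => ?_)
    · by_contra hcon
      rw [mem_iUnion, not_exists] at hcon
      exact hx (finsum_eq_zero_of_forall_eq_zero fun i => image_eq_zero_of_notMem_tsupport
        (f := fun x => χ i x • q i x) (hcon i))
    · rcases hVU i with h | h
      · exact (closure_mono (hsub i)).trans ((hχ i).trans h)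
      · have : (fun x => χ i x • q i x) = 0 := by
          funext x; rw [h]; simp
        rw [this, tsupport_zero]
        exact empty_subset _
  · intro p hp
    refine finsum_eq_zero_of_forall_eq_zero fun i => ?_
    by_cases hi : p ∈ tsupport (χ i)
    · rw [((hq i p (hχ i hi)).2 hp).1, smul_zero]
    · rw [image_eq_zero_of_notMem_tsupport hi, zero_smul]
  · intro p hp
    have hev : ∀ i, p ∈ V i → (∀ᶠ x in 𝓝 p, ContMDiffAt (𝓡∂ n) 𝓘(ℝ, ℝ) ∞ (q i) x) ∧
        (∀ᶠ x in 𝓝 p, x ∈ (𝓡∂ n).boundary (RootManifold M) → q i x = 0) := fun i hi =>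
      ⟨mem_of_superset ((hVo i).mem_nhds hi) fun x hx => (hq i x hx).1,
        mem_of_superset ((hVo i).mem_nhds hi) fun x hx hb => ((hq i x hx).2 hb).1⟩
    have hqp := hq p p (hpV p)
    -- Since the weights sum to one, `∑ χᵢ qᵢ - q_p = ∑ χᵢ (qᵢ - q_p)`, a finite sum of flat
    -- functions near `p`. Thus the derivatives of the `χᵢ` do no harm.
    have hflat : FlatFn G (fun x => ∑ i ∈ χ.fintsupport p, χ i x * (q i x - q p x)) p := by
      refine FlatFn.sum _ fun i hi => FlatFn.mul (χ i).contMDiff ?_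
      have hpi := hχ i ((χ.mem_fintsupport_iff p i).1 hi)
      exact flatFn_sub_of_flatForm hp (hev i hpi).1 (hev p (hpV p)).1 (hev i hpi).2
        (hev p (hpV p)).2 ((hq i p hpi).2 hp).2 (hqp.2 hp).2
    have hflat' : FlatFn G (fun x => (∑ᶠ i, χ i x • q i x) - q p x) p := by
      refine hflat.congr ?_
      filter_upwards [χ.eventually_finsupport_subset p] with x hx
      have h1 : ∑ᶠ i, χ i x • q i x = ∑ i ∈ χ.fintsupport p, χ i x • q i x := by
        refine finsum_eq_sum_of_support_subset _ fun i hi => ?_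
        refine hx ((χ.mem_finsupport x).2 fun h0 => hi ?_)
        simp only at h0
        simp [h0]
      have h2 := χ.sum_finsupport' x (mem_univ x) hx
      rw [h1]
      simp only [mul_sub, Finset.sum_sub_distrib, ← Finset.sum_mul, h2, one_mul, smul_eq_mul]
    refine ((hqp.2 hp).2.sub hflat'.differential).congr ?_
    filter_upwards [(hev p (hpV p)).1] with x hx
    rw [differential_sub (hQs x) hx]
    abel

end Global

/-! ### Normal derivatives of the coefficients in an arbitrary chart. -/

section NormalDerivatives

theorem iteratedDerivWithin_eq_zero_of_eq_pow_mul (k : ℕ) {φ g : ℝ → ℝ} {ε : ℝ} (hε : 0 < ε)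
    (hg : ContDiffOn ℝ ∞ g (Ico 0 ε)) (hφ : ∀ s ∈ Ico 0 ε, φ s = s ^ (k + 1) * g s) :
    iteratedDerivWithin k φ (Ici 0) 0 = 0 := by
  induction k generalizing φ g with
  | zero =>
    rw [iteratedDerivWithin_zero, hφ 0 ⟨le_rfl, hε⟩]
    simp
  | succ k ih =>
    rw [iteratedDerivWithin_succ']
    have hu : UniqueDiffOn ℝ (Ico 0 ε) := uniqueDiffOn_Ico 0 ε
    -- The derivative of `s ^ (k + 2) g` is `s ^ (k + 1) ((k + 2) g + s g')`, one power lower.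
    refine ih (g := fun s => (k + 2) * g s + s * derivWithin g (Ico 0 ε) s) ?_ ?_
    · exact (contDiffOn_const.mul hg).add
        (contDiffOn_id.mul (hg.derivWithin hu (m := ∞) (by simp)))
    · intro s hs
      have h1 : HasDerivWithinAt g (derivWithin g (Ico 0 ε) s) (Ico 0 ε) s :=
        ((hg.differentiableOn (by simp)) s hs).hasDerivWithinAt
      have h2 := (((hasDerivAt_pow (k + 1 + 1) s).hasDerivWithinAt (s := Ico 0 ε)).mul h1).congr
        (f₁ := φ) (fun t ht => hφ t ht) (hφ s hs)
      have h3 : Ico 0 ε ∈ 𝓝[Ici 0] s := by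
        rw [← Ici_inter_Iio]
        exact inter_mem self_mem_nhdsWithin (mem_nhdsWithin_of_mem_nhds (Iio_mem_nhds hs.2))
      have h4 := h2.mono_of_mem_nhdsWithin h3
      rw [h4.derivWithin (uniqueDiffOn_Ici 0 s hs.1)]
      push_cast
      ring

variable {n : ℕ} [NeZero n] {M : Type*} [TopologicalSpace M]
    [ChartedSpace (EuclideanHalfSpace n) M] [IsManifold (𝓡∂ n) ∞ M] {G : GasGiant n M}

/-- The coefficients of a flat form have vanishing normal derivatives in every chart. -/
theorem iteratedDerivWithin_coeff_eq_zero {e : OpenPartialHomeomorph (RootManifold M)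
    (EuclideanHalfSpace n)} (he : e ∈ IsManifold.maximalAtlas (𝓡∂ n) ∞ (RootManifold M))
    {u : OneForm n (RootManifold M)} {z : EuclideanSpace ℝ (Fin n)}
    (hz : z ∈ (e.extend (𝓡∂ n)).target) (hz0 : z 0 = 0)
    (hu : FlatForm G u ((e.extend (𝓡∂ n)).symm z)) (i : Fin n) (k : ℕ) :
    iteratedDerivWithin k (fun s : ℝ => u.coeff e i (WithLp.toLp 2 (Function.update z 0 s)))
      (Ici 0) 0 = 0 := by
  have hps : (e.extend (𝓡∂ n)).symm z ∈ e.source := by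
    rw [← e.extend_source (I := 𝓡∂ n)]
    exact PartialEquiv.map_target _ hz
  obtain ⟨w, hw⟩ := hu (k + 1)
  obtain ⟨r, hr, hrt, hQ⟩ := exists_halfBall_of_eventually hps hw
  rw [PartialEquiv.right_inv _ hz] at hrt hQ
  obtain ⟨m, hm, hxm⟩ := exists_eq_coord_smul hz0
    (contDiffOn_halfBall_of_contMDiffAt he hrt fun z _ => G.contMDiff_x _)
    (fun z hz hz0 => (G.x_eq_zero_iff _).2 (by
      rw [mem_boundary_iff_coord he, PartialEquiv.right_inv _ (hrt hz), hz0]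
      rw [← e.extend_source (I := 𝓡∂ n)]
      exact PartialEquiv.map_target _ (hrt hz)))
  have hws := contDiffOn_inChart he hrt fun z hz => (hQ z hz).1
  have hline : ∀ s : ℝ, WithLp.toLp 2 (Function.update z 0 s) = z + s • basisZero n := by
    intro s
    ext j
    by_cases hj : j = 0
    · subst hj; simp [hz0]
    · simp [hj]
  have hmem : MapsTo (fun s : ℝ => z + s • basisZero n) (Ico 0 r) (halfBall z r) := by
    intro s hs
    refine mem_halfBall.2 ⟨?_, ?_⟩
    · simp [dist_eq_norm, norm_smul, abs_of_nonneg hs.1, hs.2]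
    · simp [hz0, hs.1]
  refine iteratedDerivWithin_eq_zero_of_eq_pow_mul k hr
    (g := fun s => m (z + s • basisZero n) ^ (k + 1) *
      w.inChart e (z + s • basisZero n) (EuclideanSpace.single i 1)) ?_ ?_
  · have h1 : ContDiffOn ℝ ∞ (fun s : ℝ => z + s • basisZero n) (Ico 0 r) := by fun_prop
    exact ((hm.comp h1 hmem).pow (k + 1)).mul ((hws.comp h1 hmem).clm_apply contDiffOn_const)
  · intro s hs
    have hD := hmem hs
    simp only [hline]
    rw [OneForm.coeff, (hQ _ hD).2, hxm _ hD]
    change ((z + s • basisZero n) 0 * m _) ^ (k + 1) * _ = _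
    have : (z + s • basisZero n) 0 = s := by simp [hz0]
    rw [this, mul_pow, mul_assoc]
    rfl

/-- In the normal gauge of any chart, all normal derivatives vanish at the boundary. -/
theorem iteratedDerivWithin_normal_gauge_eq_zero {f : OneForm n (RootManifold M)} (hf : f.IsSmooth)
    (hI : ∀ c : G.MaximalGeodesic, G.xray f c = 0)
    {e : OpenPartialHomeomorph (RootManifold M) (EuclideanHalfSpace n)}
    (he : e ∈ IsManifold.maximalAtlas (𝓡∂ n) ∞ (RootManifold M)) {q : RootManifold M → ℝ}
    (hq : ContMDiffOn (𝓡∂ n) 𝓘(ℝ, ℝ) ∞ q e.source)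
    (hq0 : ∀ p ∈ e.source ∩ (𝓡∂ n).boundary (RootManifold M), q p = 0)
    (hq1 : ∀ z ∈ (e.extend (𝓡∂ n)).target, (f - differential n q).coeff e 0 z = 0)
    {z : EuclideanSpace ℝ (Fin n)} (hz : z ∈ (e.extend (𝓡∂ n)).target) (hz0 : z 0 = 0)
    (i : Fin n) (k : ℕ) :
    iteratedDerivWithin k (fun s : ℝ => (f - differential n q).coeff e i
      (WithLp.toLp 2 (Function.update z 0 s))) (Ici 0) 0 = 0 := by
  have hps : (e.extend (𝓡∂ n)).symm z ∈ e.source := by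
    rw [← e.extend_source (I := 𝓡∂ n)]
    exact PartialEquiv.map_target _ hz
  have hp : (e.extend (𝓡∂ n)).symm z ∈ (𝓡∂ n).boundary (RootManifold M) := by
    rw [mem_boundary_iff_coord he hps, PartialEquiv.right_inv _ hz, hz0]
  -- The chart `e` need not be adapted to the metric. A flattening `q'` is taken from the preferred
  -- chart and compared with the given `q`.
  obtain ⟨V, hV, hpV, q', hq'⟩ := exists_local_gauge hf hI hp
  refine iteratedDerivWithin_coeff_eq_zero (G := G) he hz hz0 ?_ i k
  have hes := e.open_source.mem_nhds hps
  refine flatForm_of_normal hp he hps (q := q) (q' := q') ?_ ?_ ?_ ?_ ((hq' _ hpV).2 hp).2 ?_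
  · filter_upwards [hes] with x hx
    exact hq.contMDiffAt (e.open_source.mem_nhds hx)
  · filter_upwards [hV.mem_nhds hpV] with x hx using (hq' x hx).1
  · filter_upwards [hes] with x hx hb using hq0 x ⟨hx, hb⟩
  · filter_upwards [hV.mem_nhds hpV] with x hx hb using ((hq' x hx).2 hb).1
  · filter_upwards [hes] with x hx
    have h := hq1 (e.extend (𝓡∂ n) x) (PartialEquiv.map_source _ (by rwa [e.extend_source]))
    rw [OneForm.coeff, e.extend_left_inv hx] at h
    exact h

end NormalDerivatives

end GasGiant

/-! ### The theorem. -/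

theorem lemma2p1 (n : ℕ) [NeZero n] (hn : 2 ≤ n) (M : Type*) [TopologicalSpace M] [T2Space M]
    [CompactSpace M] [ChartedSpace (EuclideanHalfSpace n) M] [IsManifold (𝓡∂ n) ∞ M]
    (G : GasGiant n M) (f : GasGiant.OneForm n (GasGiant.RootManifold M)) (hf : f.IsSmooth)
    (hI : ∀ c : G.MaximalGeodesic, G.xray f c = 0) :
    (∀ U : Set (GasGiant.RootManifold M), IsOpen U →
      (𝓡∂ n).boundary (GasGiant.RootManifold M) ⊆ U →
      ∃ q : GasGiant.RootManifold M → ℝ, ContMDiff (𝓡∂ n) 𝓘(ℝ, ℝ) ∞ q ∧ tsupport q ⊆ U ∧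
        (∀ p ∈ (𝓡∂ n).boundary (GasGiant.RootManifold M), q p = 0) ∧
        ∀ k : ℕ, ∃ w : GasGiant.OneForm n (GasGiant.RootManifold M), w.IsSmooth ∧
          ∀ p, f p - GasGiant.differential n q p = G.x p ^ k • w p) ∧
    (∀ e ∈ IsManifold.maximalAtlas (𝓡∂ n) ∞ (GasGiant.RootManifold M),
      ∀ q : GasGiant.RootManifold M → ℝ, ContMDiffOn (𝓡∂ n) 𝓘(ℝ, ℝ) ∞ q e.source →
        (∀ p ∈ e.source ∩ (𝓡∂ n).boundary (GasGiant.RootManifold M), q p = 0) →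
        (∀ z ∈ (e.extend (𝓡∂ n)).target, (f - GasGiant.differential n q).coeff e 0 z = 0) →
        ∀ z ∈ (e.extend (𝓡∂ n)).target, z 0 = 0 → ∀ (i : Fin n) (k : ℕ),
          iteratedDerivWithin k (fun s : ℝ => (f - GasGiant.differential n q).coeff e i
            (WithLp.toLp 2 (Function.update z 0 s))) (Ici 0) 0 = 0) := by
  refine ⟨fun U hU hbU => ?_, fun e he q hq hq0 hq1 z hz hz0 i k =>
    GasGiant.iteratedDerivWithin_normal_gauge_eq_zero hf hI he hq hq0 hq1 hz hz0 i k⟩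
  obtain ⟨q, hq, hqU, hq0, hflat⟩ := GasGiant.exists_global_gauge hf hI hU hbU
  exact ⟨q, hq, hqU, hq0, fun k => GasGiant.exists_eq_x_pow_smul
    (fun p => GasGiant.OneForm.SmoothAt.sub (hf p) (GasGiant.smoothAt_differential (hq p))) hflat k⟩
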